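/- **Conventions.** $\mathbb K$ is a field of characteristic zero; $V$ and $A$ are cochain complexes (unbounded, over $\mathbb Z$). $\mathbf s^{-1}$ lowers degrees by one, $S(X)$ and $T(X)$ are the graded symmetric and the tensor algebra of a graded space $X$ (with the scalars), $\underline S(X)$, $\underline T(X)$ are the truncated ones (without the scalars), and all signs follow the Koszul rule. Let $\mathbf{Ger}^\vee=\Lambda^2\mathbf{Ger}^*$, where $\mathbf{Ger}^*$ is the linear dual of the Gerstenhaber operad, and let $\mathbf{Ger}^\vee(V)$ be the cofree conilpotent $\mathbf{Ger}^\vee$-coalgebra cogenerated by $V$, with comultiplication $\Delta_{\mathfrak c}$ and cobracket $\delta_{\mathfrak c}$. It contains $\Lambda^2\mathbf{cocomm}(V)=\mathbf s^2\underline S(\mathbf s^{-2}V)$, the cofree cocommutative part, on which $\delta_{\mathfrak c}$ vanishes. **The coalgebra $\mathbf S(V,A)$.** An $\mathbf S$-coalgebra is a pair of a $\mathbf{Ger}^\vee$-coalgebra and a $\Lambda\mathbf{coassoc}$-coalgebra with a map $\rho$ of degree $\pm1$ from the second to the first that is compatible with the comultiplications, on whose image $\delta_{\mathfrak c}$ is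 zero, and for which $(\rho\otimes 1)\Delta_{\mathfrak o}=\sigma(1\otimes\rho)\Delta_{\mathfrak o}$, $\sigma$ being the flip. The cofree one cogenerated by $(V,A)$ is $\mathbf S(V,A)=\mathbf S^{\mathfrak c}\oplus\mathbf S^{\mathfrak o}$ with $\mathbf S^{\mathfrak c}=\mathbf{Ger}^\vee(V)$ and $$\mathbf S^{\mathfrak o}=\mathbf s\big(\underline S(\mathbf s^{-2}V)\otimes T(\mathbf s^{-1}A)\big)\oplus\mathbf s\,\underline T(\mathbf s^{-1}A).$$ After desuspension, $\Delta_{\mathfrak o}$ is the reduced comultiplication of the tensor product of $S(\mathbf s^{-2}V)$ (shuffle coproduct) and $T(\mathbf s^{-1}A)$ (deconcatenation), and $\rho(v_1,\dots,v_k;a_1,\dots,a_n)$ is $v_1\cdots v_k\in\Lambda^2\mathbf{cocomm}(V)\subset\mathbf{Ger}^\vee(V)$ (up to suspensions) if $n=0$, and $0$ if $n\ge1$. **Structures.** A *$\mathbf{Ger}_\infty$-structure* on $V$ is a codifferential (a coderivation of degree $1$ with square zero) of $\mathbf{Ger}^\vee(V)$ whose component $V\to V$ is the differential of $V$. A *$\mathbf{Ger}^+_\infty$-algebra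 structure* on $(V,A)$, i.e. one over the operad $\mathbf{Ger}^+_\infty=\mathrm{Cobar}(\mathbf S)$ where $\mathbf S$ is the 2-coloured cooperad that governs $\mathbf S$-coalgebras, is a codifferential $\hat Q=(\hat Q^{\mathfrak c},\hat Q^{\mathfrak o})$ of degree $1$ of the cofree coalgebra $\mathbf S(V,A)$ whose components $V\to V$ and $A\to A$ are the given differentials. In the formulas below $\hat Q^{\mathfrak o}$ is transported to the desuspension $\mathbf s^{-1}\mathbf S^{\mathfrak o}$, and $Q^{\mathfrak o}$ is its composition with the projection to $\mathbf s^{-1}A$. The Hochschild cochains $C^\bullet(A,A)$ are, in each degree, the product over $n\ge0$ of $\mathbf s^n\mathrm{Hom}(A^{\otimes n},A)$; equivalently, cochains of degree $k$ are the linear maps $T(\mathbf s^{-1}A)\to\mathbf s^{-1}A$ of degree $k-1$. They carry the Gerstenhaber bracket $[f,g]_G=f\circ g-(-1)^{(|f|+1)(|g|+1)}g\circ f$, where $f\circ g$ is the sum of the signed insertions of $g$ into $f$. An *$A_\infty$-structure* on $A$ is a cochain $m$ of degree $2$ without component in $\mathrm{Hom}(\mathbb K,A)$, with $[m,m]_G=0$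 and with the differential of $A$ as its unary component (on $\mathbf s^{-1}A$). The Hochschild cochain complex of $(A,m)$ is $C^\bullet(A,A)$ with the differential $[m,\cdot]_G$; with the bracket it is a $\Lambda\mathbf{Lie}$-algebra. A $\Lambda\mathbf{Lie}_\infty$-structure on a graded space $W$ is a degree $1$ codifferential of the coalgebra $S(\mathbf s^{-2}W)$ that kills $1$. For the Hochschild cochain complex it has the Taylor components $f\mapsto[m,f]_G$ and $fg\mapsto(-1)^{|f|}[f,g]_G$. An *$L_\infty$-morphism* is a morphism of degree zero of these coaugmented cocommutative coalgebras that commutes with the codifferentials; it is determined by its Taylor components. **Theorem.** Let $V$ and $A$ be cochain complexes over $\mathbb K$. (1) For every $\mathbf{Ger}_\infty$-structure on $V$ the codifferential maps $\Lambda^2\mathbf{cocomm}(V)\subset\mathbf{Ger}^\vee(V)$ to itself, and its restriction is the coderivation whose Taylor components are the restrictions of those of the codifferential. Thus $V$ becomes a $\Lambda\mathbf{Lie}_\infty$-algebra. (2) A $\mathbf{Ger}^+_\infty$-algebra structure on $(V,A)$ is the same as a triple consisting of a $\mathbf{Ger}_\infty$-structure on $V$, an $A_\infty$-structure $m$ on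 $A$, and an $L_\infty$-morphism from $V$, with the $\Lambda\mathbf{Lie}_\infty$-structure of (1), to the Hochschild cochain complex $C^\bullet(A,A)$ of the $A_\infty$-algebra $(A,m)$. More precisely, there is a bijection from the set of $\mathbf{Ger}^+_\infty$-algebra structures on $(V,A)$ to the set of such triples, which sends $\hat Q$ to $\hat Q^{\mathfrak c}$, the $A_\infty$-structure $$m(a_1,\dots,a_n)=Q^{\mathfrak o}(a_1,\dots,a_n),$$ and the $L_\infty$-morphism with Taylor components $$U(v_1,\dots,v_k)(a_1,\dots,a_n)=Q^{\mathfrak o}(v_1,\dots,v_k;a_1,\dots,a_n)\qquad(k\ge1,\ n\ge0).$$ -/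

import Mathlib

open scoped DirectSum TensorProduct
universe u v w

noncomputable section
namespace GerPlus

section GradedSpaces
variable {K : Type u} [Field K]

/-- A graded vector space is a family `X : ℤ → ModuleCat K`; its total space is `⨁ i, X i`. -/
abbrev Tot (X : ℤ → ModuleCat.{v} K) : Type v := ⨁ i, X i

/-- The inclusion of the component of degree `i`. -/
abbrev inc (X : ℤ → ModuleCat.{v} K) (i : ℤ) : X i →ₗ[K] Tot X :=
  DirectSum.lof K ℤ (fun i => X i) i

variable (K) in
/-- The sign `(-1)^n` as an element of `K`. -/
def sgn (n : ℤ) : K := ((n.negOnePow : ℤ) : K)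

/-- The operator `x ↦ (-1)^{|x|} x`. -/
def parity (X : ℤ → ModuleCat.{v} K) : Tot X →ₗ[K] Tot X :=
  DirectSum.toModule K ℤ _ fun i => sgn K i • inc X i

/-- For an involution `e`, the power `e^n`; it only depends on the parity of `n`. -/
def epow {M : Type*} [AddCommGroup M] [Module K M] (e : M →ₗ[K] M) (n : ℤ) : M →ₗ[K] M :=
  if Even n then LinearMap.id else e

/-- For the parity operators `e`, `f` of two graded spaces this is
`x ⊗ y ↦ (-1)^{|x| |y|} x ⊗ y` (characteristic different from two). -/
def twist {M N : Type*} [AddCommGroup M] [Module K M] [AddCommGroup N] [Module K N]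
    (e : M →ₗ[K] M) (f : N →ₗ[K] N) : M ⊗[K] N →ₗ[K] M ⊗[K] N :=
  (2 : K)⁻¹ • (LinearMap.id + TensorProduct.map e LinearMap.id + TensorProduct.map LinearMap.id f
    - TensorProduct.map e f)

theorem twist_tmul {M N : Type*} [AddCommGroup M] [Module K M] [AddCommGroup N] [Module K N]
    (e : M →ₗ[K] M) (f : N →ₗ[K] N) (x : M) (y : N) :
    twist e f (x ⊗ₜ y) = (2 : K)⁻¹ • (x ⊗ₜ y + e x ⊗ₜ y + x ⊗ₜ f y - e x ⊗ₜ[K] f y) := by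
  simp [twist]

/-- The desuspension `s^{-n} X`, whose component of degree `i` is the component of degree `i + n` of `X`. -/
abbrev desusp (n : ℤ) (X : ℤ → ModuleCat.{v} K) : ℤ → ModuleCat.{v} K := fun i => X (i + n)

end GradedSpaces

section Sym
variable {K : Type u} [Field K] (X : ℤ → ModuleCat.{v} K)

/-- The relations `x y = (-1)^{|x| |y|} y x` of the graded symmetric algebra. -/
inductive SymRel : TensorAlgebra K (Tot X) → TensorAlgebra K (Tot X) → Prop
  | swap (i j : ℤ) (x : X i) (y : X j) :
      SymRel (TensorAlgebra.ι K (inc X i x) * TensorAlgebra.ι K (inc X j y))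
        (sgn K (i * j) • (TensorAlgebra.ι K (inc X j y) * TensorAlgebra.ι K (inc X i x)))

/-- The graded symmetric algebra `S(X)`, including the scalars `S^0(X) = K`. -/
def Sym : Type (max u v) := RingQuot (SymRel X)

instance : Ring (Sym X) := inferInstanceAs (Ring (RingQuot (SymRel X)))

instance : Algebra K (Sym X) := inferInstanceAs (Algebra K (RingQuot (SymRel X)))

namespace Sym

/-- The quotient map from the tensor algebra. -/
def mk : TensorAlgebra K (Tot X) →ₐ[K] Sym X := RingQuot.mkAlgHom K (SymRel X)

/-- The generators. -/
def ι : Tot X →ₗ[K] Sym X := (mk X).toLinearMap ∘ₗ TensorAlgebra.ι K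

variable {X} in
/-- Algebra maps out of `S(X)`. -/
def lift {R : Type*} [Semiring R] [Algebra K R] (f : Tot X →ₗ[K] R)
    (hf : ∀ (i j : ℤ) (x : X i) (y : X j),
      f (inc X i x) * f (inc X j y) = sgn K (i * j) • (f (inc X j y) * f (inc X i x))) :
    Sym X →ₐ[K] R :=
  RingQuot.liftAlgHom K ⟨TensorAlgebra.lift K f, by
    rintro _ _ ⟨i, j, x, y⟩
    simpa using hf i j x y⟩

variable {X} in
theorem lift_ι {R : Type*} [Semiring R] [Algebra K R] (f : Tot X →ₗ[K] R) (hf) (x : Tot X) :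
    lift f hf (ι X x) = f x := by
  change RingQuot.liftAlgHom K _ (RingQuot.mkAlgHom K (SymRel X) (TensorAlgebra.ι K x)) = f x
  simp

theorem ι_swap (i j : ℤ) (x : X i) (y : X j) :
    ι X (inc X i x) * ι X (inc X j y) = sgn K (i * j) • (ι X (inc X j y) * ι X (inc X i x)) := by
  have h : mk X _ = mk X _ := RingQuot.mkAlgHom_rel K (SymRel.swap i j x y)
  rw [map_mul, map_smul, map_mul] at h
  exact h


theorem induct {N : Submodule K (Sym X)} (h1 : (1 : Sym X) ∈ N)
    (hm : ∀ (i : ℤ) (v : X i) (x : Sym X), x ∈ N → ι X (inc X i v) * x ∈ N) (x : Sym X) :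
    x ∈ N := by
  have hm' : ∀ (v : Tot X) (x : Sym X), x ∈ N → ι X v * x ∈ N := by
    intro v x hx
    induction v using DirectSum.induction_on with
    | zero => simp
    | of i v => exact hm i v x hx
    | add v w hv hw => rw [map_add, add_mul]; exact N.add_mem hv hw
  obtain ⟨a, rfl⟩ : ∃ a, mk X a = x := RingQuot.mkAlgHom_surjective K (SymRel X) x
  have key : ∀ y ∈ N, mk X a * y ∈ N := by
    induction a using TensorAlgebra.induction with
    | algebraMap r => intro y hy; simpa [Algebra.algebraMap_eq_smul_one] using N.smul_mem r hy
    | ι v => intro y hy; exact hm' v y hy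
    | mul a b ha hb => intro y hy; rw [map_mul, mul_assoc]; exact ha _ (hb _ hy)
    | add a b ha hb => intro y hy; rw [map_add, add_mul]; exact N.add_mem (ha _ hy) (hb _ hy)
  simpa using key 1 h1

/-- The counit, which is the projection to `S^0(X) = K`; its kernel is the truncated symmetric algebra. -/
def counit : Sym X →ₐ[K] K := lift 0 (by intros; simp only [LinearMap.zero_apply, mul_zero, smul_zero])

/-- Auxiliary operators for `proj`. -/
def projStep : Tot X →ₗ[K] Module.End K (K × Tot X) :=
  LinearMap.mk₂ K (fun v c => (0, c.1 • v)) (by simp) (by simp [smul_smul, mul_comm]) (by simp [add_smul]) (by simp [mul_smul])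

/-- Auxiliary representation for `proj`. -/
def projAct : Sym X →ₐ[K] Module.End K (K × Tot X) :=
  lift (projStep X) (by intros; ext <;> simp [projStep])

/-- The projection `S(X) → S^1(X) = X`. -/
def proj : Sym X →ₗ[K] Tot X :=
  LinearMap.snd K K (Tot X) ∘ₗ (projAct X).toLinearMap.flip (1, 0)

/-- The operator `x ↦ (-1)^{|x|} x`. -/
def par : Sym X →ₐ[K] Sym X :=
  lift (ι X ∘ₗ parity X) (by
    intro i j x y
    simp only [parity, LinearMap.comp_apply, DirectSum.toModule_lof, LinearMap.smul_apply, map_smul,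
      smul_mul_smul_comm]
    rw [ι_swap, smul_comm, mul_comm (sgn K i)])

theorem par_ι (i : ℤ) (x : X i) : par X (ι X (inc X i x)) = sgn K i • ι X (inc X i x) := by
  simp [par, lift_ι, parity]

theorem epow_par (i j : ℤ) (y : X j) (a : Sym X) :
    epow (par X).toLinearMap i (ι X (inc X j y) * a) =
      sgn K (i * j) • (ι X (inc X j y) * epow (par X).toLinearMap i a) := by
  unfold epow
  split_ifs with h
  · simp [sgn, Int.negOnePow_even _ (h.mul_right j)]
  · have : sgn K (i * j) = sgn K j := by
      rw [Int.not_even_iff_odd] at h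
      obtain hj | hj := Int.even_or_odd j
      · simp [sgn, Int.negOnePow_even _ (hj.mul_left i), Int.negOnePow_even _ hj]
      · simp [sgn, Int.negOnePow_odd _ (h.mul hj), Int.negOnePow_odd _ hj]
    simp [this, par_ι]

/-- The elements of degree `d`: spanned by the products of homogeneous generators of total degree `d`. -/
def deg (d : ℤ) : Submodule K (Sym X) :=
  Submodule.span K {x | ∃ l : List (Σ i, X i), (l.map Sigma.fst).sum = d ∧
    (l.map fun p => ι X (inc X p.1 p.2)).prod = x}

/-- Left multiplication by `v ⊗ 1 + 1 ⊗ v` on `S(X) ⊗ S(X)`, with the Koszul sign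
`(1 ⊗ v) (a ⊗ b) = (-1)^{|v| |a|} a ⊗ v b`. -/
def comulStep : Tot X →ₗ[K] Module.End K (Sym X ⊗[K] Sym X) :=
  DirectSum.toModule K ℤ _ fun i =>
    ((TensorProduct.mapBilinear (RingHom.id K) (Sym X) (Sym X) (Sym X) (Sym X)).flip LinearMap.id
      + TensorProduct.mapBilinear (RingHom.id K) (Sym X) (Sym X) (Sym X) (Sym X) (epow (par X).toLinearMap i))
      ∘ₗ LinearMap.mul K (Sym X) ∘ₗ ι X ∘ₗ inc X i

theorem comulStep_apply (i : ℤ) (v : X i) (a b : Sym X) :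
    comulStep X (inc X i v) (a ⊗ₜ b) = (ι X (inc X i v) * a) ⊗ₜ b
      + epow (par X).toLinearMap i a ⊗ₜ (ι X (inc X i v) * b) := by
  simp [comulStep]

theorem epow_comm {M : Type*} [AddCommGroup M] [Module K M] (e : M →ₗ[K] M) (i j : ℤ) (x : M) :
  epow e i (epow e j x) = epow e j (epow e i x) := by
  unfold epow; split_ifs <;> rfl

theorem comulStep_swap (i j : ℤ) (x : X i) (y : X j) :
    comulStep X (inc X i x) * comulStep X (inc X j y)
      = sgn K (i * j) • (comulStep X (inc X j y) * comulStep X (inc X i x)) := by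
  refine LinearMap.ext fun z => ?_
  induction z using TensorProduct.induction_on with
  | zero => simp only [map_zero]
  | add a b ha hb => rw [map_add, map_add, ha, hb]
  | tmul a b =>
    have h1 : sgn K (i * j) * sgn K (i * j) = 1 := by
      simp only [sgn]; norm_cast; simp
    simp only [Module.End.mul_apply, LinearMap.smul_apply, comulStep_apply, map_add, epow_par,
      ← mul_assoc, ι_swap X i j x y, epow_comm _ i j, smul_mul_assoc, smul_add,
      TensorProduct.smul_tmul', TensorProduct.tmul_smul, mul_comm j i, smul_smul, h1, one_smul]
    abel

/-- The action of `S(X)` on `S(X) ⊗ S(X)` through the comultiplication. -/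
def comulAct : Sym X →ₐ[K] Module.End K (Sym X ⊗[K] Sym X) :=
  lift (comulStep X) (comulStep_swap X)

/-- The (shuffle) comultiplication of `S(X)`: the algebra map with `Δ v = v ⊗ 1 + 1 ⊗ v`, so
`Δ(v₁ ⋯ vₖ) = ∑ ± (v_{λ(1)} ⋯ v_{λ(p)}) ⊗ (v_{λ(p+1)} ⋯ v_{λ(k)})` over all shuffles. -/
def comul : Sym X →ₗ[K] Sym X ⊗[K] Sym X := (comulAct X).toLinearMap.flip (1 ⊗ₜ 1)

theorem comul_one : comul X 1 = 1 ⊗ₜ 1 := by simp [comul]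

theorem comul_mul (v : Tot X) (x : Sym X) : comul X (ι X v * x) = comulStep X v (comul X x) := by
  simp [comul, comulAct, lift_ι]


theorem par_epow (i : ℤ) (a : Sym X) :
    par X (epow (par X).toLinearMap i a) = epow (par X).toLinearMap i (par X a) := by
  unfold epow; split_ifs <;> simp

theorem comul_par (x : Sym X) :
    comul X (par X x) = TensorProduct.map (par X).toLinearMap (par X).toLinearMap (comul X x) := by
  suffices h : x ∈ LinearMap.eqLocus (comul X ∘ₗ (par X).toLinearMap)
      (TensorProduct.map (par X).toLinearMap (par X).toLinearMap ∘ₗ comul X) from h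
  refine induct X ?_ (fun i v x hx => ?_) x
  · simp [comul_one]
  · simp only [LinearMap.mem_eqLocus, LinearMap.comp_apply, AlgHom.toLinearMap_apply, map_mul,
      par_ι, smul_mul_assoc, map_smul, comul_mul] at hx ⊢
    rw [hx]
    generalize comul X x = z
    induction z using TensorProduct.induction_on with
    | zero => simp
    | add a b ha hb => simp only [map_add, smul_add, ha, hb]
    | tmul a b =>
      simp only [TensorProduct.map_tmul, comulStep_apply, AlgHom.toLinearMap_apply, map_add, map_mul,
        par_ι, smul_add, TensorProduct.smul_tmul', TensorProduct.tmul_smul, smul_mul_assoc]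
      rw [par_epow]

theorem comul_epow (i : ℤ) (a : Sym X) :
    comul X (epow (par X).toLinearMap i a) =
      epow (TensorProduct.map (par X).toLinearMap (par X).toLinearMap) i (comul X a) := by
  unfold epow; split_ifs
  · simp
  · exact comul_par X a

theorem comul_coassoc (x : Sym X) :
    TensorProduct.assoc K _ _ _ (TensorProduct.map (comul X) LinearMap.id (comul X x)) =
      TensorProduct.map LinearMap.id (comul X) (comul X x) := by
  suffices h : x ∈ LinearMap.eqLocus ((TensorProduct.assoc K _ _ _).toLinearMap ∘ₗ
      TensorProduct.map (comul X) LinearMap.id ∘ₗ comul X)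
      (TensorProduct.map LinearMap.id (comul X) ∘ₗ comul X) from h
  refine induct X ?_ (fun i v x hx => ?_) x
  · simp [comul_one]
  · simp only [LinearMap.mem_eqLocus, LinearMap.comp_apply, LinearEquiv.coe_coe, comul_mul] at hx ⊢
    let L : Sym X ⊗[K] (Sym X ⊗[K] Sym X) →ₗ[K] Sym X ⊗[K] (Sym X ⊗[K] Sym X) :=
      TensorProduct.map (LinearMap.mulLeft K (ι X (inc X i v))) LinearMap.id +
        TensorProduct.map (epow (par X).toLinearMap i) (comulStep X (inc X i v))
    have h1 : ∀ z : Sym X ⊗[K] Sym X,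
        TensorProduct.map LinearMap.id (comul X) (comulStep X (inc X i v) z) =
          L (TensorProduct.map LinearMap.id (comul X) z) := by
      intro z
      induction z using TensorProduct.induction_on with
      | zero => simp
      | add a b ha hb => simp only [map_add, ha, hb]
      | tmul a b => simp [comulStep_apply, comul_mul, L]
    have h2 : ∀ z : Sym X ⊗[K] Sym X,
        TensorProduct.assoc K _ _ _ (TensorProduct.map (comul X) LinearMap.id
          (comulStep X (inc X i v) z)) =
          L (TensorProduct.assoc K _ _ _ (TensorProduct.map (comul X) LinearMap.id z)) := by
      intro z
      induction z using TensorProduct.induction_on with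
      | zero => simp
      | add a b ha hb => simp only [map_add, ha, hb]
      | tmul a b =>
        simp only [comulStep_apply, map_add, TensorProduct.map_tmul, LinearMap.id_apply, comul_mul]
        rw [comul_epow]
        generalize comul X a = z
        induction z using TensorProduct.induction_on with
        | zero => simp [TensorProduct.zero_tmul]
        | add p q hp hq =>
          simp only [map_add, TensorProduct.add_tmul] at hp hq ⊢
          rw [← hp, ← hq]; abel
        | tmul p q =>
          have h3 : epow (TensorProduct.map (par X).toLinearMap (par X).toLinearMap) i (p ⊗ₜ q)
              = epow (par X).toLinearMap i p ⊗ₜ[K] epow (par X).toLinearMap i q := by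
            unfold epow; split_ifs <;> simp
          simp only [comulStep_apply, h3, TensorProduct.add_tmul, map_add, TensorProduct.assoc_tmul,
            L, LinearMap.add_apply, TensorProduct.map_tmul, LinearMap.mulLeft_apply,
            LinearMap.id_apply, TensorProduct.tmul_add]
          abel
    rw [h1, h2, hx]

theorem par_par (a : Sym X) : par X (par X a) = a := by
  suffices h : a ∈ LinearMap.eqLocus ((par X).toLinearMap ∘ₗ (par X).toLinearMap) LinearMap.id from h
  refine induct X (by simp) (fun i v x hx => ?_) a
  have h1 : sgn K i * sgn K i = 1 := by
    simp only [sgn]; norm_cast; simp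
  simp only [LinearMap.mem_eqLocus, LinearMap.comp_apply, AlgHom.toLinearMap_apply, map_mul,
    par_ι, smul_mul_assoc, map_smul, LinearMap.id_apply, smul_smul, h1, one_smul] at hx ⊢
  rw [hx]

theorem comul_cocomm [CharZero K] (x : Sym X) :
    TensorProduct.comm K _ _ (twist (par X).toLinearMap (par X).toLinearMap (comul X x)) =
      comul X x := by
  suffices h : x ∈ LinearMap.eqLocus ((TensorProduct.comm K _ _).toLinearMap ∘ₗ
      twist (par X).toLinearMap (par X).toLinearMap ∘ₗ comul X) (comul X) from h
  refine induct X ?_ (fun i v x hx => ?_) x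
  · have h2 : (2 : K)⁻¹ + (2 : K)⁻¹ = 1 := by
      rw [← two_mul, mul_inv_cancel₀ two_ne_zero]
    simp only [LinearMap.mem_eqLocus, LinearMap.comp_apply, LinearEquiv.coe_coe, comul_one,
      twist_tmul, AlgHom.toLinearMap_apply, map_one, add_sub_cancel_right, smul_add, map_add,
      map_smul, TensorProduct.comm_tmul, ← add_smul, h2, one_smul]
  · simp only [LinearMap.mem_eqLocus, LinearMap.comp_apply, LinearEquiv.coe_coe, comul_mul] at hx ⊢
    conv_rhs => rw [← hx]
    generalize comul X x = z
    have hv := par_ι X i v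
    obtain hi | hi := Int.even_or_odd i
    · have hs : sgn K i = 1 := by simp [sgn, Int.negOnePow_even _ hi]
      induction z using TensorProduct.induction_on with
      | zero => simp
      | add a b ha hb => simp only [map_add, ha, hb]
      | tmul a b =>
        simp only [comulStep_apply, twist_tmul, epow, hi, if_true, hs, hv,  map_add, map_sub, map_smul,
          LinearMap.id_apply, AlgHom.toLinearMap_apply, map_mul, TensorProduct.comm_tmul, one_smul]
        module
    · have hs : sgn K i = -1 := by simp [sgn, Int.negOnePow_odd _ hi]
      rw [hs, neg_one_smul] at hv
      have hp : ∀ a, par X (par X a) = a := fun a => par_par X a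
      have hi' : ¬ Even i := by simpa using hi
      induction z using TensorProduct.induction_on with
      | zero => simp
      | add a b ha hb => simp only [map_add, ha, hb]
      | tmul a b =>
        simp only [comulStep_apply, twist_tmul, epow, hi', if_false, hs, hv,  map_add, map_sub, map_smul, neg_mul, neg_smul,
          LinearMap.id_apply, AlgHom.toLinearMap_apply, map_mul, TensorProduct.comm_tmul, one_smul,
          TensorProduct.neg_tmul, TensorProduct.tmul_neg, map_neg, hp]
        module

end Sym
end Sym


section Ten
variable {K : Type u} [Field K] (X : ℤ → ModuleCat.{v} K)

/-- The tensor algebra `T(X)`, including the scalars. -/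
abbrev Ten : Type (max u v) := TensorAlgebra K (Tot X)

namespace Ten

/-- The generators. -/
def ι : Tot X →ₗ[K] Ten X := TensorAlgebra.ι K

/-- The operator `x ↦ (-1)^{|x|} x`. -/
def par : Ten X →ₐ[K] Ten X := TensorAlgebra.lift K (ι X ∘ₗ parity X)

/-- The projection to the scalars. -/
def counit : Ten X →ₐ[K] K := TensorAlgebra.algebraMapInv

/-- The projection `T(X) → X`. -/
def proj : Ten X →ₗ[K] Tot X := TensorAlgebra.ιInv

/-- The recursion step of the deconcatenation: `(x, Δ x) ↦ (v x, 1 ⊗ v x + (v ⊗ 1) Δ x)`. -/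
def comulStep : Tot X →ₗ[K] Module.End K (Ten X × Ten X ⊗[K] Ten X) :=
  LinearMap.mk₂ K (fun v p => (ι X v * p.1, 1 ⊗ₜ (ι X v * p.1) +
      TensorProduct.map (LinearMap.mulLeft K (ι X v)) LinearMap.id p.2))
    (by
      intro v w p
      have h : LinearMap.mulLeft K (ι X v + ι X w) = LinearMap.mulLeft K (ι X v) + LinearMap.mulLeft K (ι X w) := by
        ext; simp [add_mul]
      ext1
      · simp [add_mul]
      · simp only [map_add, add_mul, TensorProduct.tmul_add, h, TensorProduct.map_add_left, LinearMap.add_apply, Prod.snd_add]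
        abel)
    (by
      intro c v p
      have h : LinearMap.mulLeft K (c • ι X v) = c • LinearMap.mulLeft K (ι X v) := by
        ext; simp
      ext1
      · simp
      · simp only [map_smul, smul_mul_assoc, TensorProduct.tmul_smul, h, TensorProduct.map_smul_left, LinearMap.smul_apply, Prod.smul_snd, smul_add])
    (by
      intro v p q
      ext1
      · simp [mul_add]
      · simp only [map_add, mul_add, TensorProduct.tmul_add, Prod.snd_add, Prod.fst_add]
        abel)
    (by
      intro c v p
      ext1
      · simp
      · simp only [map_smul, mul_smul_comm, TensorProduct.tmul_smul, Prod.smul_snd, smul_add, Prod.smul_fst])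

/-- The iterated recursion step of the deconcatenation. -/
def comulAct : Ten X →ₐ[K] Module.End K (Ten X × Ten X ⊗[K] Ten X) :=
  TensorAlgebra.lift K (comulStep X)

/-- The deconcatenation `Δ(a₁ ⋯ aₙ) = ∑ (a₁ ⋯ aₜ) ⊗ (aₜ₊₁ ⋯ aₙ)`, `0 ≤ t ≤ n`. -/
def comul : Ten X →ₗ[K] Ten X ⊗[K] Ten X :=
  LinearMap.snd K _ _ ∘ₗ (comulAct X).toLinearMap.flip (1, 1 ⊗ₜ 1)

theorem comul_one : comul X 1 = 1 ⊗ₜ 1 := by simp [comul]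

theorem comulAct_fst (x : Ten X) (p : Ten X × Ten X ⊗[K] Ten X) :
    (comulAct X x p).1 = x * p.1 := by
  induction x using TensorAlgebra.induction generalizing p with
  | algebraMap r => simp [Algebra.algebraMap_eq_smul_one]
  | ι v => simp [comulAct, comulStep, ι]
  | mul a b ha hb => rw [map_mul, Module.End.mul_apply, ha, hb, mul_assoc]
  | add a b ha hb => rw [map_add, LinearMap.add_apply, Prod.fst_add, ha, hb, add_mul]

theorem comul_mul (v : Tot X) (x : Ten X) :
    comul X (ι X v * x) = 1 ⊗ₜ (ι X v * x) +
      TensorProduct.map (LinearMap.mulLeft K (ι X v)) LinearMap.id (comul X x) := by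
  have h := comulAct_fst X x (1, 1 ⊗ₜ 1)
  have h2 : comulAct X (ι X v) = comulStep X v := TensorAlgebra.lift_ι_apply _ _
  simp only [comul, LinearMap.comp_apply, LinearMap.flip_apply, AlgHom.toLinearMap_apply, map_mul,
    Module.End.mul_apply, h2, LinearMap.snd_apply]
  simp only [comulStep, LinearMap.mk₂_apply, h, mul_one]

/-- The elements of degree `d`. -/
def deg (d : ℤ) : Submodule K (Ten X) :=
  Submodule.span K {x | ∃ l : List (Σ i, X i), (l.map Sigma.fst).sum = d ∧
    (l.map fun p => ι X (inc X p.1 p.2)).prod = x}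

theorem mul_deg {i j d : ℤ} (h : i + j = d) {x y : Ten X} (hx : x ∈ deg X i) (hy : y ∈ deg X j) :
    x * y ∈ deg X d := by
  induction hx using Submodule.span_induction with
  | zero => simp
  | add a b _ _ ha hb => rw [add_mul]; exact add_mem ha hb
  | smul c a _ ha => rw [smul_mul_assoc]; exact Submodule.smul_mem _ _ ha
  | mem a ha =>
    induction hy using Submodule.span_induction with
    | zero => simp
    | add a b _ _ ha hb => rw [mul_add]; exact add_mem ha hb
    | smul c a _ ha => rw [mul_smul_comm]; exact Submodule.smul_mem _ _ ha
    | mem b hb =>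
      obtain ⟨l, rfl, rfl⟩ := ha
      obtain ⟨l', rfl, rfl⟩ := hb
      exact Submodule.subset_span ⟨l ++ l', by simp [h], by simp⟩

theorem ι_deg {i : ℤ} (x : X i) : ι X (inc X i x) ∈ deg X i :=
  Submodule.subset_span ⟨[⟨i, x⟩], by simp, by simp⟩

theorem one_deg : (1 : Ten X) ∈ deg X 0 := Submodule.subset_span ⟨[], by simp, by simp⟩

theorem par_deg {i : ℤ} {x : Ten X} (hx : x ∈ deg X i) : par X x ∈ deg X i := by
  induction hx using Submodule.span_induction with
  | zero => simp
  | add a b _ _ ha hb => rw [map_add]; exact add_mem ha hb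
  | smul c a _ ha => rw [map_smul]; exact Submodule.smul_mem _ _ ha
  | mem a ha =>
    obtain ⟨l, rfl, rfl⟩ := ha
    induction l with
    | nil => simpa using one_deg X
    | cons p l ih =>
      simp only [List.map_cons, List.prod_cons, List.sum_cons, map_mul]
      refine mul_deg X rfl ?_ ih
      have : par X (ι X (inc X p.1 p.2)) = sgn K p.1 • ι X (inc X p.1 p.2) := by
        simp [par, ι, parity]
      rw [this]
      exact Submodule.smul_mem _ _ (ι_deg X p.2)

theorem conv_deg {f g : Ten X →ₗ[K] Ten X} {a b : ℤ}
    (hf : ∀ d, ∀ x ∈ deg X d, f x ∈ deg X (d + a))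
    (hg : ∀ d, ∀ x ∈ deg X d, g x ∈ deg X (d + b)) (d : ℤ) (x : Ten X) (hx : x ∈ deg X d) :
    LinearMap.mul' K (Ten X) (TensorProduct.map f g (comul X x)) ∈ deg X (d + (a + b)) := by
  let P : ℤ → Submodule K (Ten X ⊗[K] Ten X) := fun d =>
    Submodule.span K {z | ∃ i j x y, i + j = d ∧ x ∈ deg X i ∧ y ∈ deg X j ∧ x ⊗ₜ y = z}
  have h1 : ∀ d, ∀ z ∈ P d, LinearMap.mul' K (Ten X) (TensorProduct.map f g z) ∈ deg X (d + (a + b)) := by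
    intro d z hz
    induction hz using Submodule.span_induction with
    | zero => simp
    | add a b _ _ ha hb => rw [map_add, map_add]; exact add_mem ha hb
    | smul c a _ ha => rw [map_smul, map_smul]; exact Submodule.smul_mem _ _ ha
    | mem z hz =>
      obtain ⟨i, j, x, y, rfl, hx, hy, rfl⟩ := hz
      rw [TensorProduct.map_tmul, LinearMap.mul'_apply]
      exact mul_deg X (by ring) (hf _ _ hx) (hg _ _ hy)
  have h2 : ∀ (i : ℤ) (v : X i) (d : ℤ), ∀ z ∈ P d,
      TensorProduct.map (LinearMap.mulLeft K (ι X (inc X i v))) LinearMap.id z ∈ P (i + d) := by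
    intro i v d z hz
    induction hz using Submodule.span_induction with
    | zero => simp
    | add a b _ _ ha hb => rw [map_add]; exact add_mem ha hb
    | smul c a _ ha => rw [map_smul]; exact Submodule.smul_mem _ _ ha
    | mem z hz =>
      obtain ⟨k, j, x, y, rfl, hx, hy, rfl⟩ := hz
      exact Submodule.subset_span ⟨i + k, j, _, y, by ring, mul_deg X rfl (ι_deg X v) hx, hy, rfl⟩
  refine h1 d _ ?_
  induction hx using Submodule.span_induction with
  | zero => simp
  | add a b _ _ ha hb => rw [map_add]; exact add_mem ha hb
  | smul c a _ ha => rw [map_smul]; exact Submodule.smul_mem _ _ ha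
  | mem x hx =>
    obtain ⟨l, rfl, rfl⟩ := hx
    induction l with
    | nil =>
      simp only [List.map_nil, List.prod_nil, List.sum_nil, comul_one]
      exact Submodule.subset_span ⟨0, 0, 1, 1, by ring, one_deg X, one_deg X, rfl⟩
    | cons p l ih =>
      simp only [List.map_cons, List.prod_cons, List.sum_cons, comul_mul]
      refine add_mem (Submodule.subset_span ⟨0, _, 1, _, zero_add _, one_deg X, ?_, rfl⟩) (h2 _ _ _ _ ih)
      exact mul_deg X rfl (ι_deg X p.2) (Submodule.subset_span ⟨l, rfl, rfl⟩)

end Ten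
end Ten

section Hochschild
variable {K : Type u} [Field K] (X : ℤ → ModuleCat.{v} K)

/-- For `X = s^{-1} A` these are the Hochschild cochains of `A` of total degree `k`: the elements of
degree `k` of `∏ₙ s^n Hom(A^{⊗ n}, A)` are the linear maps `T(s^{-1} A) → s^{-1} A` of
degree `k - 1`. -/
def cochain (k : ℤ) : Submodule K (Ten X →ₗ[K] Tot X) where
  carrier := {f | ∀ d, ∀ x ∈ Ten.deg X d, f x ∈ LinearMap.range (inc X (d + (k - 1)))}
  zero_mem' := by intro d x _; simp
  add_mem' := fun hf hg d x hx => add_mem (hf d x hx) (hg d x hx)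
  smul_mem' := fun c f hf d x hx => Submodule.smul_mem _ c (hf d x hx)

/-- `a₁ ⋯ aₙ ↦ ∑ₜ f(a₁ ⋯ aₜ) aₜ₊₁ ⋯ aₙ`. -/
def insPrefix : (Ten X →ₗ[K] Tot X) →ₗ[K] Ten X →ₗ[K] Ten X where
  toFun f := LinearMap.mul' K (Ten X) ∘ₗ TensorProduct.map (Ten.ι X ∘ₗ f) LinearMap.id ∘ₗ Ten.comul X
  map_add' f g := by simp only [LinearMap.comp_add, TensorProduct.map_add_left, LinearMap.add_comp]
  map_smul' c f := by simp only [LinearMap.comp_smul, TensorProduct.map_smul_left, LinearMap.smul_comp, RingHom.id_apply]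

/-- Insertion of a cochain of total degree `k`:
`a₁ ⋯ aₙ ↦ ∑ (-1)^{(k - 1)(|a₁| + ⋯ + |aᵢ₋₁|)} a₁ ⋯ aᵢ₋₁ f(aᵢ ⋯ aⱼ) aⱼ₊₁ ⋯ aₙ`,
with the degrees taken in `X = s^{-1} A`. -/
def ins (k : ℤ) : (Ten X →ₗ[K] Tot X) →ₗ[K] Ten X →ₗ[K] Ten X where
  toFun f := LinearMap.mul' K (Ten X) ∘ₗ
    TensorProduct.map (epow (Ten.par X).toLinearMap (k - 1)) (insPrefix X f) ∘ₗ Ten.comul X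
  map_add' f g := by simp only [map_add, LinearMap.comp_add, TensorProduct.map_add_right, LinearMap.add_comp]
  map_smul' c f := by simp only [map_smul, LinearMap.comp_smul, TensorProduct.map_smul_right, LinearMap.smul_comp, RingHom.id_apply]

/-- The Gerstenhaber bracket of cochains of total degrees `k` and `l`:
`[f, g] = f ∘ g - (-1)^{(k+1)(l+1)} g ∘ f`, where `f ∘ g` inserts `g` into `f` in all places. -/
def gerst (k l : ℤ) (f g : Ten X →ₗ[K] Tot X) : Ten X →ₗ[K] Tot X :=
  f ∘ₗ ins X l g - sgn K ((k + 1) * (l + 1)) • (g ∘ₗ ins X k f)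

theorem ins_deg {k : ℤ} {f : Ten X →ₗ[K] Tot X} (hf : f ∈ cochain X k) (d : ℤ) (x : Ten X)
    (hx : x ∈ Ten.deg X d) : ins X k f x ∈ Ten.deg X (d + (k - 1)) := by
  have h1 : ∀ d, ∀ x ∈ Ten.deg X d, insPrefix X f x ∈ Ten.deg X (d + (k - 1)) := by
    have := @Ten.conv_deg K _ X (Ten.ι X ∘ₗ f) LinearMap.id (k - 1) 0 (fun d x hx => by
      obtain ⟨y, hy⟩ := hf d x hx
      rw [LinearMap.comp_apply, ← hy]
      exact Ten.ι_deg X y) (fun d x hx => by simpa using hx)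
    simp only [add_zero] at this
    exact this
  have := Ten.conv_deg X (f := epow (Ten.par X).toLinearMap (k - 1)) (a := 0) (fun d x hx => by
    unfold epow
    split_ifs
    · simpa using hx
    · simpa using Ten.par_deg X hx) h1 d x hx
  simp only [zero_add] at this
  exact this

theorem gerst_mem {k l n : ℤ} (h : n = k + l - 1) {f g : Ten X →ₗ[K] Tot X}
    (hf : f ∈ cochain X k) (hg : g ∈ cochain X l) : gerst X k l f g ∈ cochain X n := by
  intro d x hx
  refine sub_mem ?_ (Submodule.smul_mem _ _ ?_)
  · have := hf _ _ (ins_deg X hg d x hx)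
    rwa [show d + (l - 1) + (k - 1) = d + (n - 1) by rw [h]; ring] at this
  · have := hg _ _ (ins_deg X hf d x hx)
    rwa [show d + (k - 1) + (l - 1) = d + (n - 1) by rw [h]; ring] at this

/-- The Gerstenhaber bracket on homogeneous cochains. -/
def gerstHom (k l n : ℤ) (h : n = k + l - 1) : cochain X k →ₗ[K] cochain X l →ₗ[K] cochain X n :=
  LinearMap.mk₂ K (fun f g => ⟨gerst X k l f g, gerst_mem X h f.2 g.2⟩)
    (by intro f f' g; ext1; simp only [gerst, Submodule.coe_add, map_add, LinearMap.add_comp, LinearMap.comp_add, smul_add]; abel)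
    (by intro c f g; ext1; simp only [gerst, Submodule.coe_smul, map_smul, LinearMap.smul_comp, LinearMap.comp_smul, smul_sub, smul_comm c])
    (by intro f g g'; ext1; simp only [gerst, Submodule.coe_add, map_add, LinearMap.add_comp, LinearMap.comp_add, smul_add]; abel)
    (by intro c f g; ext1; simp only [gerst, Submodule.coe_smul, map_smul, LinearMap.smul_comp, LinearMap.comp_smul, smul_sub, smul_comm c])

/-- For `X = s^{-1} A`: the graded space `s^{-2} C(A, A)`, where `C(A, A)` is the graded space of Hochschild cochains. -/
abbrev hoch : ℤ → ModuleCat.{max u v} K := fun i => ModuleCat.of K (cochain X (i + 2))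

/-- The operation `f ⊗ g ↦ (-1)^{|f|} [f, g]` on `s^{-2} C(A, A)`; it has degree one and is
graded symmetric. -/
def hochBracket : Tot (hoch X) ⊗[K] Tot (hoch X) →ₗ[K] Tot (hoch X) :=
  TensorProduct.lift <| DirectSum.toModule K ℤ _ fun i => LinearMap.flip <| DirectSum.toModule K ℤ _ fun j =>
    LinearMap.flip <| sgn K i • (gerstHom X (i + 2) (j + 2) (i + j + 1 + 2) (by ring)).compr₂ (inc (hoch X) (i + j + 1))

/-- The Hochschild differential `f ↦ [m, f]` on `s^{-2} C(A, A)`. -/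
def hochDiff (m : cochain X 2) : Tot (hoch X) →ₗ[K] Tot (hoch X) :=
  DirectSum.toModule K ℤ _ fun i => inc (hoch X) (i + 1) ∘ₗ gerstHom X 2 (i + 2) (i + 1 + 2) (by ring) m

/-- A finite sum of homogeneous Hochschild cochains, as a map `T(s^{-1} A) → s^{-1} A`. -/
def hochEval : Tot (hoch X) →ₗ[K] Ten X →ₗ[K] Tot X :=
  DirectSum.toModule K ℤ _ fun i => (cochain X (i + 2)).subtype

end Hochschild


section Trees
variable {K : Type u} [Field K] (X : ℤ → ModuleCat.{v} K)

/-- Planar binary trees whose vertices carry one of two labels, `dot` (for `Δ`) or `br` (for `δ`). -/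
inductive Shape : Type
  | leaf : Shape
  | dot : Shape → Shape → Shape
  | br : Shape → Shape → Shape
  deriving DecidableEq

namespace Shape

/-- The number of leaves. -/
def leaves : Shape → ℕ
  | leaf => 1
  | dot l r => l.leaves + r.leaves
  | br l r => l.leaves + r.leaves

theorem leaves_pos (T : Shape) : 0 < T.leaves := by
  induction T <;> simp [leaves] <;> omega

theorem finite_leaves (n : ℕ) : {T : Shape | T.leaves ≤ n}.Finite := by
  induction n with
  | zero =>
    refine Set.Finite.subset Set.finite_empty fun T hT => ?_
    have := leaves_pos T
    simp only [Set.mem_ofPred_eq] at hT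
    omega
  | succ n ih =>
    refine Set.Finite.subset ((Set.finite_singleton leaf).union
      ((ih.image2 dot ih).union (ih.image2 br ih))) fun T hT => ?_
    cases T with
    | leaf => exact Or.inl rfl
    | dot l r =>
      have := leaves_pos l
      have := leaves_pos r
      simp only [Set.mem_ofPred_eq, leaves] at hT
      exact Or.inr (Or.inl ⟨l, by simp only [Set.mem_ofPred_eq]; omega, r, by simp only [Set.mem_ofPred_eq]; omega, rfl⟩)
    | br l r =>
      have := leaves_pos l
      have := leaves_pos r
      simp only [Set.mem_ofPred_eq, leaves] at hT
      exact Or.inr (Or.inr ⟨l, by simp only [Set.mem_ofPred_eq]; omega, r, by simp only [Set.mem_ofPred_eq]; omega, rfl⟩)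

end Shape

open Shape

/-- The tensor power of `X` indexed by the leaves of a tree, bracketed as in the tree. -/
def TreePow : Shape → ModuleCat.{v} K
  | leaf => ModuleCat.of K (Tot X)
  | dot l r => ModuleCat.of K (TreePow l ⊗[K] TreePow r)
  | br l r => ModuleCat.of K (TreePow l ⊗[K] TreePow r)

/-- The parity operator; a vertex `br` contributes one to the degree. -/
def TreePow.par : (T : Shape) → TreePow X T →ₗ[K] TreePow X T
  | leaf => parity X
  | dot l r => TensorProduct.map (TreePow.par l) (TreePow.par r)
  | br l r => -TensorProduct.map (TreePow.par l) (TreePow.par r)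

/-- The elements of degree `d`; a vertex `br` contributes one to the degree. -/
def TreePow.deg : (T : Shape) → ℤ → Submodule K (TreePow X T)
  | leaf, d => LinearMap.range (inc X d)
  | dot l r, d => Submodule.span K {z : TreePow X l ⊗[K] TreePow X r |
      ∃ i j x y, i + j = d ∧ x ∈ TreePow.deg l i ∧ y ∈ TreePow.deg r j ∧ x ⊗ₜ y = z}
  | br l r, d => Submodule.span K {z : TreePow X l ⊗[K] TreePow X r |
      ∃ i j x y, i + j + 1 = d ∧ x ∈ TreePow.deg l i ∧ y ∈ TreePow.deg r j ∧ x ⊗ₜ y = z}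

/-- The cofree conilpotent coalgebra cogenerated by `X` over two binary cooperations without any
relations, `Δ` of degree `0` and `δ` of degree `-1`: a copy of the tensor power of `X` for every
tree, on which the cooperation that labels the root splits the tree at its root (and the other
one is zero). -/
abbrev Tree : Type v := ⨁ T : Shape, TreePow X T

namespace Tree

/-- The inclusion of the component of a tree. -/
def of (T : Shape) : TreePow X T →ₗ[K] Tree X := DirectSum.lof K Shape (fun T => TreePow X T) T

/-- The operator `x ↦ (-1)^{|x|} x`. -/
def par : Tree X →ₗ[K] Tree X := DirectSum.toModule K Shape _ fun T => of X T ∘ₗ TreePow.par X T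

/-- The elements of degree `d`. -/
def deg (d : ℤ) : Submodule K (Tree X) where
  carrier := {x | ∀ T, x T ∈ TreePow.deg X T d}
  zero_mem' := fun T => zero_mem _
  add_mem' := fun hx hy T => add_mem (hx T) (hy T)
  smul_mem' := fun c x hx T => Submodule.smul_mem _ c (hx T)

/-- The projection to the cogenerators. -/
def proj : Tree X →ₗ[K] Tot X := DirectSum.component K Shape (fun T => TreePow X T) leaf

/-- The cooperation `Δ`. -/
def comul : Tree X →ₗ[K] Tree X ⊗[K] Tree X := DirectSum.toModule K Shape _ fun
  | leaf => 0
  | dot l r => TensorProduct.map (of X l) (of X r)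
  | br _ _ => 0

/-- The cooperation `δ`. -/
def cobr : Tree X →ₗ[K] Tree X ⊗[K] Tree X := DirectSum.toModule K Shape _ fun
  | leaf => 0
  | dot _ _ => 0
  | br l r => TensorProduct.map (of X l) (of X r)

end Tree
end Trees

section CoGer
variable {K : Type u} [Field K] {M : Type v} [AddCommGroup M] [Module K M]

/-- The Koszul flip `x ⊗ y ↦ (-1)^{|x| |y|} y ⊗ x`, for parity operators `e` and `f`. -/
def gswap {P Q : Type*} [AddCommGroup P] [Module K P] [AddCommGroup Q] [Module K Q]
    (e : P →ₗ[K] P) (f : Q →ₗ[K] Q) : P ⊗[K] Q →ₗ[K] Q ⊗[K] P :=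
  (TensorProduct.comm K P Q).toLinearMap ∘ₗ twist e f

/-- `N` is closed under the cooperations `Δ` (of degree `0`) and `δ` (of degree `-1`), and on `N` they
satisfy the axioms of a coalgebra over the linear dual of the Gerstenhaber operad: `Δ` is graded
cocommutative and coassociative, `δ` is a cobracket, and the two satisfy the co-Leibniz rule. These are
the duals of the axioms `a b = (-1)^{|a| |b|} b a`, `(a b) c = a (b c)`,
`β(a, b) = (-1)^{|a| |b|} β(b, a)`, `β (β ⊗ 1) (1 + σ + σ²) = 0` and
`β (1 ⊗ μ) = μ (β ⊗ 1) + μ (1 ⊗ β) (τ ⊗ 1)` of a Gerstenhaber algebra, whose bracket of degree `-1` is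
`{a, b} = (-1)^{|a|} β(a, b)`, with all permutations and maps of odd degree acting with Koszul signs. -/
structure IsGerCoalg (e : M →ₗ[K] M) (Δ δ : M →ₗ[K] M ⊗[K] M) (N : Submodule K M) : Prop where
  comul_mem : ∀ x ∈ N, Δ x ∈ LinearMap.range (TensorProduct.mapIncl N N)
  cobr_mem : ∀ x ∈ N, δ x ∈ LinearMap.range (TensorProduct.mapIncl N N)
  cocomm : ∀ x ∈ N, gswap e e (Δ x) = Δ x
  coassoc : ∀ x ∈ N, TensorProduct.assoc K M M M (TensorProduct.map Δ LinearMap.id (Δ x)) =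
    TensorProduct.map LinearMap.id Δ (Δ x)
  cosymm : ∀ x ∈ N, gswap e e (δ x) = δ x
  cojacobi : ∀ x ∈ N,
    let σ : M ⊗[K] (M ⊗[K] M) →ₗ[K] M ⊗[K] (M ⊗[K] M) :=
      (TensorProduct.assoc K M M M).toLinearMap ∘ₗ gswap e (TensorProduct.map e e)
    let y := TensorProduct.assoc K M M M (TensorProduct.map δ LinearMap.id (δ x))
    y + σ y + σ (σ y) = 0
  coleibniz : ∀ x ∈ N, TensorProduct.map LinearMap.id Δ (δ x) =
    TensorProduct.assoc K M M M (TensorProduct.map δ LinearMap.id (Δ x)) +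
    TensorProduct.assoc K M M M (TensorProduct.map (gswap e e) LinearMap.id
      ((TensorProduct.assoc K M M M).symm (TensorProduct.map e δ (Δ x))))

end CoGer

section GerCofree
variable {K : Type u} [Field K] (X : ℤ → ModuleCat.{v} K)

/-- The cofree conilpotent coalgebra over the linear dual `Ger^*` of the Gerstenhaber operad that is
cogenerated by `X`: the largest subcoalgebra of the cofree conilpotent coalgebra over `Δ` and `δ` on which
the relations of `IsGerCoalg` hold. (A morphism from a conilpotent `Ger^*`-coalgebra to the latter has
its image in this subcoalgebra. Dually, the free Gerstenhaber algebra is the largest quotient of the free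
algebra over two binary operations in which the axioms hold.)
For `X = s^{-2} V` this is `s^{-2} Ger^∨(V)`, where `Ger^∨ = Λ² Ger^*`. -/
def GerCofree : Submodule K (Tree X) :=
  sSup {N | IsGerCoalg (Tree.par X) (Tree.comul X) (Tree.cobr X) N}

theorem mapIncl_mono {M : Type*} [AddCommGroup M] [Module K M] {N N' : Submodule K M} (h : N ≤ N') :
    LinearMap.range (TensorProduct.mapIncl N N) ≤ LinearMap.range (TensorProduct.mapIncl N' N') := by
  rintro _ ⟨z, rfl⟩
  refine ⟨TensorProduct.map (Submodule.inclusion h) (Submodule.inclusion h) z, ?_⟩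
  rw [TensorProduct.mapIncl, TensorProduct.mapIncl, ← LinearMap.comp_apply, ← TensorProduct.map_comp]
  rfl

theorem isGerCoalg_cofree :
    IsGerCoalg (Tree.par X) (Tree.comul X) (Tree.cobr X) (GerCofree X) := by
  have key : ∀ P : Submodule K (Tree X),
      (∀ N, IsGerCoalg (Tree.par X) (Tree.comul X) (Tree.cobr X) N → N ≤ P) →
      ∀ x ∈ GerCofree X, x ∈ P := fun P hP x hx => sSup_le (fun N hN => hP N hN) hx
  have hle : ∀ N, IsGerCoalg (Tree.par X) (Tree.comul X) (Tree.cobr X) N → N ≤ GerCofree X :=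
    fun N hN => le_sSup hN
  constructor
  · exact key (Submodule.comap (Tree.comul X) (LinearMap.range (TensorProduct.mapIncl _ _)))
      fun N hN x hx => mapIncl_mono (hle N hN) (hN.comul_mem x hx)
  · exact key (Submodule.comap (Tree.cobr X) (LinearMap.range (TensorProduct.mapIncl _ _)))
      fun N hN x hx => mapIncl_mono (hle N hN) (hN.cobr_mem x hx)
  · exact key (LinearMap.eqLocus (gswap (Tree.par X) (Tree.par X) ∘ₗ Tree.comul X) (Tree.comul X))
      fun N hN x hx => hN.cocomm x hx
  · exact key (LinearMap.eqLocus ((TensorProduct.assoc K _ _ _).toLinearMap ∘ₗ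
      TensorProduct.map (Tree.comul X) LinearMap.id ∘ₗ Tree.comul X)
      (TensorProduct.map LinearMap.id (Tree.comul X) ∘ₗ Tree.comul X))
      fun N hN x hx => hN.coassoc x hx
  · exact key (LinearMap.eqLocus (gswap (Tree.par X) (Tree.par X) ∘ₗ Tree.cobr X) (Tree.cobr X))
      fun N hN x hx => hN.cosymm x hx
  · let σ : Tree X ⊗[K] (Tree X ⊗[K] Tree X) →ₗ[K] Tree X ⊗[K] (Tree X ⊗[K] Tree X) :=
      (TensorProduct.assoc K _ _ _).toLinearMap ∘ₗ
        gswap (Tree.par X) (TensorProduct.map (Tree.par X) (Tree.par X))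
    exact key (LinearMap.ker ((LinearMap.id + σ + σ ∘ₗ σ) ∘ₗ (TensorProduct.assoc K _ _ _).toLinearMap ∘ₗ
      TensorProduct.map (Tree.cobr X) LinearMap.id ∘ₗ Tree.cobr X))
      fun N hN x hx => LinearMap.mem_ker.mpr (hN.cojacobi x hx)
  · exact key (LinearMap.eqLocus (TensorProduct.map LinearMap.id (Tree.comul X) ∘ₗ Tree.cobr X)
      ((TensorProduct.assoc K _ _ _).toLinearMap ∘ₗ
        TensorProduct.map (Tree.cobr X) LinearMap.id ∘ₗ Tree.comul X +
      (TensorProduct.assoc K _ _ _).toLinearMap ∘ₗ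
        TensorProduct.map (gswap (Tree.par X) (Tree.par X)) LinearMap.id ∘ₗ
        (TensorProduct.assoc K _ _ _).symm.toLinearMap ∘ₗ
        TensorProduct.map (Tree.par X) (Tree.cobr X) ∘ₗ Tree.comul X))
      fun N hN x hx => hN.coleibniz x hx

end GerCofree


section Rho
variable {K : Type u} [Field K] (X : ℤ → ModuleCat.{v} K)

namespace Sym

theorem counit_mul (v : Tot X) (x : Sym X) : counit X (ι X v * x) = 0 := by
  simp [counit, lift_ι]

theorem projAct_fst (x : Sym X) : (projAct X x (1, 0)).1 = counit X x := by
  suffices h : x ∈ LinearMap.eqLocus (LinearMap.fst K K (Tot X) ∘ₗ (projAct X).toLinearMap.flip (1, 0))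
      (counit X).toLinearMap from h
  refine induct X ?_ (fun i v x hx => ?_) x
  · simp only [LinearMap.mem_eqLocus, LinearMap.comp_apply, LinearMap.flip_apply,
      AlgHom.toLinearMap_apply, map_one, Module.End.one_apply, LinearMap.fst_apply]
  · simp [counit_mul, projAct, lift_ι, projStep]

theorem proj_one : proj X 1 = 0 := by simp [proj]

theorem proj_mul (v : Tot X) (x : Sym X) : proj X (ι X v * x) = counit X x • v := by
  rw [← projAct_fst]
  simp [proj, projAct, lift_ι, projStep]

theorem counit_par (x : Sym X) : counit X (par X x) = counit X x := by
  suffices h : x ∈ LinearMap.eqLocus ((counit X).toLinearMap ∘ₗ (par X).toLinearMap)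
      (counit X).toLinearMap from h
  refine induct X (by simp) (fun i v x hx => ?_) x
  simp [counit_mul, par_ι]

theorem proj_par (x : Sym X) : proj X (par X x) = parity X (proj X x) := by
  suffices h : x ∈ LinearMap.eqLocus (proj X ∘ₗ (par X).toLinearMap) (parity X ∘ₗ proj X) from h
  refine induct X (by simp [proj_one]) (fun i v x hx => ?_) x
  simp only [LinearMap.mem_eqLocus, LinearMap.comp_apply, AlgHom.toLinearMap_apply, map_mul, par_ι,
    smul_mul_assoc, map_smul, proj_mul, counit_par, parity, DirectSum.toModule_lof,
    LinearMap.smul_apply]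
  rw [smul_comm]

/-- The image `S^n(X)` of the `n`-th tensor power. -/
def wt (n : ℕ) : Submodule K (Sym X) :=
  Submodule.span K {x | ∃ l : List (Σ i, X i), l.length = n ∧
    (l.map fun p => ι X (inc X p.1 p.2)).prod = x}

theorem one_wt : (1 : Sym X) ∈ wt X 0 := Submodule.subset_span ⟨[], by simp, by simp⟩

theorem mul_wt {n : ℕ} {i : ℤ} (v : X i) {x : Sym X} (hx : x ∈ wt X n) :
    ι X (inc X i v) * x ∈ wt X (n + 1) := by
  induction hx using Submodule.span_induction with
  | zero => simp
  | add a b _ _ ha hb => rw [mul_add]; exact add_mem ha hb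
  | smul c a _ ha => rw [mul_smul_comm]; exact Submodule.smul_mem _ _ ha
  | mem a ha =>
    obtain ⟨l, rfl, rfl⟩ := ha
    exact Submodule.subset_span ⟨⟨i, v⟩ :: l, by simp, by simp⟩

theorem wt_induct {P : ℕ → Sym X → Prop} (h0 : ∀ n, P n 0)
    (ha : ∀ n x y, P n x → P n y → P n (x + y)) (hs : ∀ n (c : K) x, P n x → P n (c • x))
    (h1 : P 0 1) (hm : ∀ n i (v : X i) x, x ∈ wt X n → P n x → P (n + 1) (ι X (inc X i v) * x))
    {n : ℕ} {x : Sym X} (hx : x ∈ wt X n) : P n x := by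
  induction hx using Submodule.span_induction with
  | zero => exact h0 n
  | add a b _ _ h h' => exact ha _ _ _ h h'
  | smul c a _ h => exact hs _ _ _ h
  | mem a h =>
    obtain ⟨l, rfl, rfl⟩ := h
    induction l with
    | nil => exact h1
    | cons p l ih =>
      simp only [List.length_cons, List.map_cons, List.prod_cons]
      exact hm _ _ _ _ (Submodule.subset_span ⟨l, rfl, rfl⟩) ih

theorem epow_wt (i : ℤ) {n : ℕ} {x : Sym X} (hx : x ∈ wt X n) :
    epow (par X).toLinearMap i x ∈ wt X n := by
  unfold epow
  split_ifs
  · exact hx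
  · refine wt_induct X (P := fun n x => (par X).toLinearMap x ∈ wt X n) (by simp)
      (fun n x y hx hy => by rw [map_add]; exact add_mem hx hy)
      (fun n c x hx => by rw [map_smul]; exact Submodule.smul_mem _ _ hx)
      (by simpa using one_wt X) (fun n i v x _ hx => ?_) hx
    simp only [AlgHom.toLinearMap_apply, map_mul, par_ι, smul_mul_assoc] at hx ⊢
    exact Submodule.smul_mem _ _ (mul_wt X v hx)

theorem comul_wt {n : ℕ} {x : Sym X} (hx : x ∈ wt X n) :
    comul X x ∈ Submodule.span K {z | ∃ p q a b, p + q = n ∧ a ∈ wt X p ∧ b ∈ wt X q ∧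
      a ⊗ₜ[K] b = z} := by
  refine wt_induct X (P := fun n x => comul X x ∈ Submodule.span K {z | ∃ p q a b, p + q = n ∧
      a ∈ wt X p ∧ b ∈ wt X q ∧ a ⊗ₜ[K] b = z}) (by simp)
    (fun n x y hx hy => by rw [map_add]; exact add_mem hx hy)
    (fun n c x hx => by rw [map_smul]; exact Submodule.smul_mem _ _ hx)
    ?_ (fun n i v x _ hx => ?_) hx
  · rw [comul_one]
    exact Submodule.subset_span ⟨0, 0, 1, 1, rfl, one_wt X, one_wt X, rfl⟩
  · rw [comul_mul]
    generalize comul X x = z at hx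
    induction hx using Submodule.span_induction with
    | zero => simp
    | add a b _ _ ha hb => rw [map_add]; exact add_mem ha hb
    | smul c a _ ha => rw [map_smul]; exact Submodule.smul_mem _ _ ha
    | mem a ha =>
      obtain ⟨p, q, a, b, rfl, ha, hb, rfl⟩ := ha
      rw [comulStep_apply]
      exact add_mem
        (Submodule.subset_span ⟨p + 1, q, _, b, by ring, mul_wt X v ha, hb, rfl⟩)
        (Submodule.subset_span ⟨p, q + 1, _, _, by ring, epow_wt X i ha, mul_wt X v hb, rfl⟩)

theorem iSup_wt (x : Sym X) : x ∈ ⨆ n, wt X n := by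
  refine induct X (Submodule.mem_iSup_of_mem 0 (one_wt X)) (fun i v x hx => ?_) x
  induction hx using Submodule.iSup_induction' with
  | mem n x hx => exact Submodule.mem_iSup_of_mem (n + 1) (mul_wt X v hx)
  | zero => simp
  | add a b _ _ ha hb => rw [mul_add]; exact add_mem ha hb

/-- The component at a tree of the embedding of `S(X)` (without the scalars) as the largest
subcoalgebra with zero cobracket. -/
def treeComponent : (T : Shape) → Sym X →ₗ[K] TreePow X T
  | Shape.leaf => proj X
  | Shape.dot l r => TensorProduct.map (treeComponent l) (treeComponent r) ∘ₗ comul X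
  | Shape.br _ _ => 0

theorem treeComponent_wt (T : Shape) {n : ℕ} (hn : T.leaves ≠ n) {x : Sym X} (hx : x ∈ wt X n) :
    treeComponent X T x = 0 := by
  induction T generalizing n x with
  | leaf =>
    have h : (n ≠ 0 → counit X x = 0) ∧ (n ≠ 1 → proj X x = 0) := by
      refine wt_induct X (P := fun n x => (n ≠ 0 → counit X x = 0) ∧ (n ≠ 1 → proj X x = 0))
        (fun n => by simp) (fun n x y hx hy => ⟨fun h => ?_, fun h => ?_⟩)
        (fun n c x hx => ⟨fun h => ?_, fun h => ?_⟩) (by simp [proj_one])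
        (fun n i v x _ hx => ⟨fun _ => counit_mul X _ _, fun h => ?_⟩) hx
      · rw [map_add, hx.1 h, hy.1 h, add_zero]
      · rw [map_add, hx.2 h, hy.2 h, add_zero]
      · rw [map_smul, hx.1 h, smul_zero]
      · rw [map_smul, hx.2 h, smul_zero]
      · rw [proj_mul, hx.1 (by omega), zero_smul]
    exact h.2 (Ne.symm hn)
  | dot l r hl hr =>
    have h := comul_wt X hx
    change TensorProduct.map (treeComponent X l) (treeComponent X r) (comul X x) = 0
    generalize comul X x = z at h
    induction h using Submodule.span_induction with
    | zero => simp
    | add a b _ _ ha hb => rw [map_add, ha, hb, add_zero]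
    | smul c a _ ha => rw [map_smul, ha, smul_zero]
    | mem a ha =>
      obtain ⟨p, q, a, b, rfl, ha, hb, rfl⟩ := ha
      rw [TensorProduct.map_tmul]
      by_cases hp : l.leaves = p
      · rw [hr (fun hq => hn (by rw [Shape.leaves, hp, hq])) hb, TensorProduct.tmul_zero]
      · rw [hl hp ha, TensorProduct.zero_tmul]
  | br l r => rfl

theorem treeComponent_par (T : Shape) (x : Sym X) :
    treeComponent X T (par X x) = TreePow.par X T (treeComponent X T x) := by
  induction T generalizing x with
  | leaf => exact proj_par X x
  | dot l r hl hr =>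
    change TensorProduct.map (treeComponent X l) (treeComponent X r) (comul X (par X x)) =
      TensorProduct.map (TreePow.par X l) (TreePow.par X r)
        (TensorProduct.map (treeComponent X l) (treeComponent X r) (comul X x))
    rw [comul_par]
    generalize comul X x = z
    induction z using TensorProduct.induction_on with
    | zero => simp
    | add a b ha hb => simp only [map_add, ha, hb]
    | tmul a b => simp [hl, hr]
  | br l r => exact (map_zero (TreePow.par X (Shape.br l r))).symm

theorem treeComponent_finite (x : Sym X) : LinearMap.pi (treeComponent X) x ∈
    LinearMap.range (DirectSum.coeFnLinearMap K (M := fun T => TreePow X T)) := by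
  suffices h : ⨆ n, wt X n ≤ Submodule.comap (LinearMap.pi (treeComponent X))
      (LinearMap.range (DirectSum.coeFnLinearMap K (M := fun T => TreePow X T))) from h (iSup_wt X x)
  refine iSup_le fun n x hx => ?_
  refine ⟨∑ T ∈ (Shape.finite_leaves n).toFinset, Tree.of X T (treeComponent X T x), ?_⟩
  funext T
  rw [DirectSum.coeFnLinearMap_apply, LinearMap.pi_apply]
  rw [DFinsupp.finsetSum_apply]
  have h0 : ∀ S : Shape, S ≠ T → Tree.of X S (treeComponent X S x) T = 0 :=
    fun S hS => DFinsupp.single_eq_of_ne (Ne.symm hS)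
  have h1 : Tree.of X T (treeComponent X T x) T = treeComponent X T x := DFinsupp.single_eq_same
  by_cases hT : T ∈ (Shape.finite_leaves n).toFinset
  · rw [Finset.sum_eq_single_of_mem T hT (fun S _ hS => h0 S hS), h1]
  · rw [Finset.sum_eq_zero (fun S hS => h0 S (fun h => hT (h ▸ hS))), treeComponent_wt X T ?_ hx]
    rintro rfl
    simp at hT


/-- The coalgebra map `S(X) → Tree X` over `X` that is compatible with `Δ` and has `δ = 0` on its image. -/
def toTree : Sym X →ₗ[K] Tree X :=
  (LinearEquiv.ofInjective (DirectSum.coeFnLinearMap K (M := fun T => TreePow X T))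
    DFunLike.coe_injective).symm.toLinearMap ∘ₗ
  (LinearMap.pi (treeComponent X)).codRestrict _ (treeComponent_finite X)

theorem toTree_apply (x : Sym X) (T : Shape) : toTree X x T = treeComponent X T x := by
  have := (LinearEquiv.ofInjective (DirectSum.coeFnLinearMap K (M := fun T => TreePow X T))
    DFunLike.coe_injective).apply_symm_apply
    ((LinearMap.pi (treeComponent X)).codRestrict _ (treeComponent_finite X) x)
  exact congrFun (congrArg Subtype.val this) T

theorem _root_.GerPlus.Tree.of_same (T : Shape) (a : TreePow X T) : Tree.of X T a T = a :=
  DFinsupp.single_eq_same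

theorem _root_.GerPlus.Tree.of_ne {S T : Shape} (h : S ≠ T) (a : TreePow X S) :
    Tree.of X S a T = 0 := DFinsupp.single_eq_of_ne (Ne.symm h)

theorem _root_.GerPlus.directSum_tensor_ext {I : Type*} [DecidableEq I] {M : I → Type*}
    [∀ i, AddCommGroup (M i)] [∀ i, Module K (M i)] {z w : (⨁ i, M i) ⊗[K] (⨁ i, M i)}
    (h : ∀ l r, TensorProduct.map (DirectSum.component K I M l) (DirectSum.component K I M r) z =
      TensorProduct.map (DirectSum.component K I M l) (DirectSum.component K I M r) w) : z = w := by
  have he : ∀ (z : (⨁ i, M i) ⊗[K] (⨁ i, M i)) (l r : I),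
      DirectSum.component K (I × I) (fun p => M p.1 ⊗[K] M p.2) (l, r)
        (TensorProduct.directSum K K M M z) =
      TensorProduct.map (DirectSum.component K I M l) (DirectSum.component K I M r) z := by
    intro z l r
    induction z using TensorProduct.induction_on with
    | zero => simp only [map_zero]
    | add a b ha hb => simp only [map_add, ha, hb]
    | tmul a b =>
      induction a using DirectSum.induction_on with
      | zero => simp only [TensorProduct.zero_tmul, map_zero]
      | add a a' ha ha' => simp only [TensorProduct.add_tmul, map_add, ha, ha']
      | of i a =>
        induction b using DirectSum.induction_on with
        | zero => simp only [TensorProduct.tmul_zero, map_zero]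
        | add b b' hb hb' => simp only [TensorProduct.tmul_add, map_add, hb, hb']
        | of j b =>
          have h1 := TensorProduct.directSum_lof_tmul_lof (R := K) K (M₁ := M) (M₂ := M) i a j b
          rw [DirectSum.lof_eq_of, DirectSum.lof_eq_of] at h1
          rw [h1, TensorProduct.map_tmul]
          have hs : ∀ (i : I) (a : M i), DirectSum.component K I M i (DirectSum.of M i a) = a :=
            fun i a => DirectSum.of_eq_same i a
          have hne : ∀ (i j : I) (a : M i), ¬ i = j →
              DirectSum.component K I M j (DirectSum.of M i a) = 0 :=
            fun i j a hij => DirectSum.of_eq_of_ne i j a (Ne.symm hij)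
          by_cases hi : i = l
          · subst hi
            by_cases hj : j = r
            · subst hj
              rw [hs, hs]
              exact DFinsupp.single_eq_same
            · rw [hne _ _ _ hj, TensorProduct.tmul_zero]
              exact DFinsupp.single_eq_of_ne fun h => hj (congrArg Prod.snd h).symm
          · rw [hne _ _ _ hi, TensorProduct.zero_tmul]
            exact DFinsupp.single_eq_of_ne fun h => hi (congrArg Prod.fst h).symm
  refine (TensorProduct.directSum K K M M).injective (DFinsupp.ext fun ⟨l, r⟩ => ?_)
  exact (he z l r).trans ((h l r).trans (he w l r).symm)

theorem _root_.GerPlus.Tree.component_comul (y : Tree X) (l r : Shape) :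
    TensorProduct.map (DirectSum.component K Shape (fun T => TreePow X T) l)
        (DirectSum.component K Shape (fun T => TreePow X T) r) (Tree.comul X y) =
      y (Shape.dot l r) := by
  induction y using DirectSum.induction_on with
  | zero => rw [map_zero, map_zero]; rfl
  | add a b ha hb => rw [map_add, map_add, ha, hb]; rfl
  | of T y =>
    change TensorProduct.map _ _ (Tree.comul X (Tree.of X T y)) = Tree.of X T y (Shape.dot l r)
    rw [Tree.comul, Tree.of, DirectSum.toModule_lof]
    match T, y with
    | Shape.leaf, y => exact (map_zero _).trans (Tree.of_ne X (T := Shape.dot l r) (by simp) y).symm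
    | Shape.br a b, y => exact (map_zero _).trans (Tree.of_ne X (T := Shape.dot l r) (by simp) y).symm
    | Shape.dot a b, y =>
      change TensorProduct.map _ _ (TensorProduct.map (Tree.of X a) (Tree.of X b) y) =
        Tree.of X (Shape.dot a b) y (Shape.dot l r)
      have h1 : ∀ (i j : Shape) (z : TreePow X i), DirectSum.component K Shape (fun T => TreePow X T) j
          (Tree.of X i z) = Tree.of X i z j := fun _ _ _ => rfl
      by_cases ha : a = l
      · subst ha
        by_cases hb : b = r
        · subst hb
          rw [Tree.of_same]
          change TensorProduct.map _ _ (TensorProduct.map (Tree.of X a) (Tree.of X b)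
            (y : TreePow X a ⊗[K] TreePow X b)) = (y : TreePow X a ⊗[K] TreePow X b)
          change TreePow X a ⊗[K] TreePow X b at y
          induction y using TensorProduct.induction_on with
          | zero => simp
          | add p q hp hq => rw [map_add, map_add, hp, hq]
          | tmul p q => simp only [TensorProduct.map_tmul, h1, Tree.of_same]
        · rw [Tree.of_ne X (by simpa using hb)]
          change TensorProduct.map _ _ (TensorProduct.map (Tree.of X a) (Tree.of X b)
            (y : TreePow X a ⊗[K] TreePow X b)) = 0
          change TreePow X a ⊗[K] TreePow X b at y
          induction y using TensorProduct.induction_on with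
          | zero => simp
          | add p q hp hq => rw [map_add, map_add, hp, hq, add_zero]
          | tmul p q => simp only [TensorProduct.map_tmul, h1, Tree.of_ne X hb, TensorProduct.tmul_zero]
      · rw [Tree.of_ne X (by simp [ha])]
        change TensorProduct.map _ _ (TensorProduct.map (Tree.of X a) (Tree.of X b)
          (y : TreePow X a ⊗[K] TreePow X b)) = 0
        change TreePow X a ⊗[K] TreePow X b at y
        induction y using TensorProduct.induction_on with
        | zero => simp
        | add p q hp hq => rw [map_add, map_add, hp, hq, add_zero]
        | tmul p q => simp only [TensorProduct.map_tmul, h1, Tree.of_ne X ha, TensorProduct.zero_tmul]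

theorem comul_toTree (x : Sym X) :
    Tree.comul X (toTree X x) = TensorProduct.map (toTree X) (toTree X) (comul X x) := by
  refine directSum_tensor_ext fun l r => ?_
  rw [Tree.component_comul, toTree_apply]
  change TensorProduct.map (treeComponent X l) (treeComponent X r) (comul X x) = _
  generalize comul X x = z
  induction z using TensorProduct.induction_on with
  | zero => simp
  | add a b ha hb => simp only [map_add, ha, hb]
  | tmul a b =>
    simp only [TensorProduct.map_tmul]
    exact congrArg₂ _ (toTree_apply X a l).symm (toTree_apply X b r).symm

theorem cobr_toTree (x : Sym X) : Tree.cobr X (toTree X x) = 0 := by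
  have key : ∀ y : Tree X, (∀ l r, y (Shape.br l r) = 0) → Tree.cobr X y = 0 := by
    intro y hy
    classical
    rw [← DirectSum.sum_support_of y, map_sum]
    refine Finset.sum_eq_zero fun T _ => ?_
    change Tree.cobr X (Tree.of X T (y T)) = 0
    rw [Tree.cobr, Tree.of, DirectSum.toModule_lof]
    match T with
    | Shape.leaf => rfl
    | Shape.dot a b => rfl
    | Shape.br a b => rw [hy, map_zero]
  exact key _ fun l r => toTree_apply X x (Shape.br l r)

theorem par_toTree (x : Sym X) : Tree.par X (toTree X x) = toTree X (par X x) := by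
  have key : ∀ (y : Tree X) (T : Shape), Tree.par X y T = TreePow.par X T (y T) := by
    intro y T
    induction y using DirectSum.induction_on with
    | zero => rw [map_zero]; exact (map_zero (TreePow.par X T)).symm
    | add a b ha hb => 
      rw [map_add]
      exact (congrArg₂ (· + ·) ha hb).trans (map_add (TreePow.par X T) _ _).symm
    | of S y =>
      change Tree.par X (Tree.of X S y) T = TreePow.par X T (Tree.of X S y T)
      rw [Tree.par, Tree.of, DirectSum.toModule_lof]
      change Tree.of X S (TreePow.par X S y) T = TreePow.par X T (Tree.of X S y T)
      by_cases h : S = T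
      · subst h; rw [Tree.of_same, Tree.of_same]
      · rw [Tree.of_ne X h, Tree.of_ne X h, map_zero]
  refine DFinsupp.ext fun T => ?_
  rw [key, toTree_apply, toTree_apply, treeComponent_par]

theorem toTree_mem [CharZero K] (x : Sym X) : toTree X x ∈ GerCofree X := by
  suffices h : IsGerCoalg (Tree.par X) (Tree.comul X) (Tree.cobr X) (LinearMap.range (toTree X)) from
    (le_sSup h : _ ≤ GerCofree X) ⟨x, rfl⟩
  constructor
  · rintro _ ⟨x, rfl⟩
    rw [comul_toTree]
    refine ⟨TensorProduct.map (toTree X).rangeRestrict (toTree X).rangeRestrict (comul X x), ?_⟩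
    rw [TensorProduct.mapIncl, ← LinearMap.comp_apply, ← TensorProduct.map_comp]
    rfl
  · rintro _ ⟨x, rfl⟩
    rw [cobr_toTree]; exact zero_mem _
  · rintro _ ⟨x, rfl⟩
    rw [comul_toTree]
    conv_rhs => rw [← comul_cocomm]
    generalize comul X x = z
    induction z using TensorProduct.induction_on with
    | zero => simp
    | add a b ha hb => simp only [map_add, ha, hb]
    | tmul a b =>
      simp [gswap, twist_tmul, par_toTree]
  · rintro _ ⟨x, rfl⟩
    rw [comul_toTree]
    have h1 : ∀ z : Sym X ⊗[K] Sym X, TensorProduct.assoc K _ _ _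
        (TensorProduct.map (Tree.comul X) LinearMap.id (TensorProduct.map (toTree X) (toTree X) z)) =
        TensorProduct.map (toTree X) (TensorProduct.map (toTree X) (toTree X))
          (TensorProduct.assoc K _ _ _ (TensorProduct.map (comul X) LinearMap.id z)) := by
      intro z
      induction z using TensorProduct.induction_on with
      | zero => simp
      | add a b ha hb => simp only [map_add, ha, hb]
      | tmul a b =>
        simp only [TensorProduct.map_tmul, comul_toTree, LinearMap.id_apply]
        generalize comul X a = z
        induction z using TensorProduct.induction_on with
        | zero => simp
        | add p q hp hq => simp only [map_add, TensorProduct.add_tmul, hp, hq]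
        | tmul p q => simp
    have h2 : ∀ z : Sym X ⊗[K] Sym X,
        TensorProduct.map LinearMap.id (Tree.comul X) (TensorProduct.map (toTree X) (toTree X) z) =
        TensorProduct.map (toTree X) (TensorProduct.map (toTree X) (toTree X))
          (TensorProduct.map LinearMap.id (comul X) z) := by
      intro z
      induction z using TensorProduct.induction_on with
      | zero => simp
      | add a b ha hb => simp only [map_add, ha, hb]
      | tmul a b => simp [comul_toTree]
    rw [h1, h2, comul_coassoc]
  · rintro _ ⟨x, rfl⟩
    rw [cobr_toTree, map_zero]
  · rintro _ ⟨x, rfl⟩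
    simp [cobr_toTree]
  · rintro _ ⟨x, rfl⟩
    rw [cobr_toTree, comul_toTree]
    have h1 : TensorProduct.map (Tree.cobr X) LinearMap.id ∘ₗ
        TensorProduct.map (toTree X) (toTree X) = 0 := by
      refine TensorProduct.ext' fun a b => ?_
      simp [cobr_toTree]
    have h2 : TensorProduct.map (Tree.par X) (Tree.cobr X) ∘ₗ
        TensorProduct.map (toTree X) (toTree X) = 0 := by
      refine TensorProduct.ext' fun a b => ?_
      simp [cobr_toTree]
    rw [← LinearMap.comp_apply (TensorProduct.map (Tree.cobr X) _), h1,
      ← LinearMap.comp_apply (TensorProduct.map (Tree.par X) _), h2]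
    simp

/-- The embedding of the cofree cocommutative coalgebra into the cofree `Ger^*`-coalgebra; for
`X = s^{-2} V` it is the double desuspension of `Λ² cocomm(V) ⊂ Ger^∨(V)`. The scalars go to zero. -/
def toGer [CharZero K] : Sym X →ₗ[K] GerCofree X := (toTree X).codRestrict _ (toTree_mem X)

end Sym
end Rho


section GerCofreeOps
variable {K : Type u} [Field K] (X : ℤ → ModuleCat.{v} K)

/-- Corestriction of a cooperation `f : M → M ⊗ M` to a subspace `N` with `f N ⊆ N ⊗ N`
(over a field `N ⊗ N → M ⊗ M` is injective). -/
def restrictCoop {M : Type*} [AddCommGroup M] [Module K M] (f : M →ₗ[K] M ⊗[K] M)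
    (N : Submodule K M) (h : ∀ x ∈ N, f x ∈ LinearMap.range (TensorProduct.mapIncl N N)) :
    N →ₗ[K] N ⊗[K] N :=
  (LinearEquiv.ofInjective (TensorProduct.mapIncl N N)
    (Module.Flat.tensorProduct_mapIncl_injective_of_right N N)).symm.toLinearMap ∘ₗ
  (f ∘ₗ N.subtype).codRestrict _ fun x => h x x.2

namespace GerCofree

/-- The comultiplication `Δ` of the cofree coalgebra, of degree `0` after desuspension. -/
def comul : GerCofree X →ₗ[K] GerCofree X ⊗[K] GerCofree X :=
  restrictCoop (Tree.comul X) _ (isGerCoalg_cofree X).comul_mem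

/-- The cobracket `δ` of the cofree coalgebra, of degree `-1` after desuspension. -/
def cobr : GerCofree X →ₗ[K] GerCofree X ⊗[K] GerCofree X :=
  restrictCoop (Tree.cobr X) _ (isGerCoalg_cofree X).cobr_mem

/-- The projection to the cogenerators. -/
def proj : GerCofree X →ₗ[K] Tot X := Tree.proj X ∘ₗ (GerCofree X).subtype

/-- The elements of degree `d`. -/
def deg (d : ℤ) : Submodule K (GerCofree X) := (Tree.deg X d).comap (GerCofree X).subtype

/-- For a linear map `D` of odd degree, the map `D ⊗ 1 + 1 ⊗ D` with the Koszul sign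
`(1 ⊗ D)(x ⊗ y) = (-1)^{|x|} x ⊗ D y`, with values in the tensor square of the ambient space
(into which the tensor square of the cofree coalgebra embeds). -/
def leibniz (D : GerCofree X →ₗ[K] GerCofree X) :
    GerCofree X ⊗[K] GerCofree X →ₗ[K] Tree X ⊗[K] Tree X :=
  TensorProduct.map ((GerCofree X).subtype ∘ₗ D) (GerCofree X).subtype +
    TensorProduct.map (Tree.par X ∘ₗ (GerCofree X).subtype) ((GerCofree X).subtype ∘ₗ D)

end GerCofree
end GerCofreeOps

section OpenPart
variable {K : Type u} [Field K] (X : ℤ → ModuleCat.{v} K) (Y : ℤ → ModuleCat.{w} K)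

/-- The coalgebra `S(X) ⊗ T(Y)`. For `X = s^{-2} V` and `Y = s^{-1} A` the kernel of its counit is
`S'(s^{-2} V) ⊗ T(s^{-1} A) ⊕ T'(s^{-1} A)` (a prime denotes truncation), that is, the desuspension of
the part of colour `o` of the cofree coalgebra `S(V, A)`. -/
abbrev OpenC : Type (max u v w) := Sym X ⊗[K] Ten Y

namespace OpenC

/-- `z ↦ (-1)^{|z|} z`. -/
def par : OpenC X Y →ₗ[K] OpenC X Y :=
  TensorProduct.map (Sym.par X).toLinearMap (Ten.par Y).toLinearMap

/-- The comultiplication of the tensor product of the two graded coalgebras,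
`Δ(x ⊗ t) = ∑ (-1)^{|x''| |t'|} (x' ⊗ t') ⊗ (x'' ⊗ t'')`. -/
def comul : OpenC X Y →ₗ[K] OpenC X Y ⊗[K] OpenC X Y :=
  (TensorProduct.tensorTensorTensorComm K (Sym X) (Sym X) (Ten Y) (Ten Y)).toLinearMap ∘ₗ
  twist (TensorProduct.map LinearMap.id (Sym.par X).toLinearMap)
    (TensorProduct.map (Ten.par Y).toLinearMap LinearMap.id) ∘ₗ
  TensorProduct.map (Sym.comul X) (Ten.comul Y)

/-- The counit. -/
def counit : OpenC X Y →ₗ[K] K :=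
  LinearMap.mul' K K ∘ₗ TensorProduct.map (Sym.counit X).toLinearMap (Ten.counit Y).toLinearMap

/-- The projection to the cogenerators `Y`. -/
def proj : OpenC X Y →ₗ[K] Tot Y :=
  (TensorProduct.lid K (Tot Y)).toLinearMap ∘ₗ
    TensorProduct.map (Sym.counit X).toLinearMap (Ten.proj Y)

/-- The elements of degree `d`. -/
def deg (d : ℤ) : Submodule K (OpenC X Y) :=
  Submodule.span K {z | ∃ i j x y, i + j = d ∧ x ∈ Sym.deg X i ∧ y ∈ Ten.deg Y j ∧ x ⊗ₜ y = z}

/-- The cooperation `ρ`: on `x ⊗ 1` it is the embedding of `S(X)`, and it kills `x ⊗ t` for `t` of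
positive length. -/
def rho [CharZero K] : OpenC X Y →ₗ[K] GerCofree X :=
  (TensorProduct.rid K (GerCofree X)).toLinearMap ∘ₗ
    TensorProduct.map (Sym.toGer X) (Ten.counit Y).toLinearMap

end OpenC
end OpenPart

section Structures
variable {K : Type u} [Field K] [CharZero K]

/-- The differential of a cochain complex `C`, viewed on the total space of `s^{-n} C`. -/
def shiftDiff (n : ℤ) (C : CochainComplex (ModuleCat.{v} K) ℤ) :
    Tot (desusp n C.X) →ₗ[K] Tot (desusp n C.X) :=
  DirectSum.toModule K ℤ _ fun i => inc (desusp n C.X) (i + 1) ∘ₗ (C.d (i + n) (i + 1 + n)).hom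

/-- The closed cogenerators `s^{-2} V`. -/
abbrev closedGen (V : CochainComplex (ModuleCat.{v} K) ℤ) : ℤ → ModuleCat.{v} K := desusp 2 V.X

/-- The open cogenerators `s^{-1} A`. -/
abbrev openGen (A : CochainComplex (ModuleCat.{w} K) ℤ) : ℤ → ModuleCat.{w} K := desusp 1 A.X

/-- A `Ger_∞`-structure on the cochain complex `V`: a codifferential `D` of degree one on the cofree
`Ger^∨`-coalgebra `Ger^∨(V)` (desuspended twice) whose component `V → V` is the differential of `V`.
Since `δ` and `D` are of odd degree, compatibility with `δ` is `δ D = -(D ⊗ 1 + 1 ⊗ D) δ`. -/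
structure GerInf (V : CochainComplex (ModuleCat.{v} K) ℤ) where
  D : GerCofree (closedGen V) →ₗ[K] GerCofree (closedGen V)
  D_deg : ∀ d, ∀ x ∈ GerCofree.deg (closedGen V) d, D x ∈ GerCofree.deg (closedGen V) (d + 1)
  D_comul : ∀ x, Tree.comul (closedGen V) (D x) =
    GerCofree.leibniz (closedGen V) D (GerCofree.comul (closedGen V) x)
  D_cobr : ∀ x, Tree.cobr (closedGen V) (D x) =
    -GerCofree.leibniz (closedGen V) D (GerCofree.cobr (closedGen V) x)
  D_sq : ∀ x, D (D x) = 0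
  D_lin : ∀ v : Tot (closedGen V),
    GerCofree.proj (closedGen V) (D (Sym.toGer (closedGen V) (Sym.ι (closedGen V) v))) =
      shiftDiff 2 V v

/-- A `Ger^+_∞`-structure on `(V, A)`: a codifferential of degree one on the cofree coalgebra
`S(V, A)` whose components `V → V` and `A → A` are the given differentials. It consists of a codifferential
`D` of `Ger^∨(V)` and a codifferential `Q` of the part of colour `o`, which is desuspended once and to which
the scalars are added as a counit (a codifferential kills `1` and preserves the kernel of the counit).
The cooperation `ρ` has degree one before the desuspensions, so `D` and `Q` anticommute with it. -/
structure GerPlusInf (V : CochainComplex (ModuleCat.{v} K) ℤ)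
    (A : CochainComplex (ModuleCat.{w} K) ℤ) extends GerInf V where
  Q : OpenC (closedGen V) (openGen A) →ₗ[K] OpenC (closedGen V) (openGen A)
  Q_one : Q (1 ⊗ₜ 1) = 0
  Q_counit : ∀ x, OpenC.counit (closedGen V) (openGen A) (Q x) = 0
  Q_deg : ∀ d, ∀ x ∈ OpenC.deg (closedGen V) (openGen A) d,
    Q x ∈ OpenC.deg (closedGen V) (openGen A) (d + 1)
  Q_comul : ∀ x, OpenC.comul (closedGen V) (openGen A) (Q x) =
    TensorProduct.map Q LinearMap.id (OpenC.comul (closedGen V) (openGen A) x) +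
      TensorProduct.map (OpenC.par (closedGen V) (openGen A)) Q
        (OpenC.comul (closedGen V) (openGen A) x)
  Q_rho : ∀ x, D (OpenC.rho (closedGen V) (openGen A) x) =
    -OpenC.rho (closedGen V) (openGen A) (Q x)
  Q_sq : ∀ x, Q (Q x) = 0
  Q_lin : ∀ a : Tot (openGen A),
    OpenC.proj (closedGen V) (openGen A) (Q (1 ⊗ₜ Ten.ι (openGen A) a)) = shiftDiff 1 A a

/-- An `A_∞`-structure on the cochain complex `A`: a Hochschild cochain `m` of total degree two
without component in `Hom(K, A)`, with `[m, m] = 0` and with the differential of `A` as unary component. -/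
structure AInf (A : CochainComplex (ModuleCat.{w} K) ℤ) where
  m : cochain (openGen A) 2
  flat : m.1 1 = 0
  mc : gerst (openGen A) 2 2 m.1 m.1 = 0
  lin : ∀ a : Tot (openGen A), m.1 (Ten.ι (openGen A) a) = shiftDiff 1 A a

/-- The coderivation of the coalgebra `S(X)` with Taylor components `q`:
`v₁ ⋯ vₖ ↦ ∑ ± q(v_{λ(1)} ⋯ v_{λ(p)}) v_{λ(p+1)} ⋯ v_{λ(k)}`. -/
def coderOf {X : ℤ → ModuleCat.{v} K} (q : Sym X →ₗ[K] Tot X) : Sym X →ₗ[K] Sym X :=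
  LinearMap.mul' K (Sym X) ∘ₗ TensorProduct.map (Sym.ι X ∘ₗ q) LinearMap.id ∘ₗ Sym.comul X

/-- The `ΛLie_∞`-structure that underlies a `Ger_∞`-structure: the codifferential on `S(s^{-2} V)`
whose Taylor components are the restriction of those of `D` to `Λ² cocomm(V) ⊂ Ger^∨(V)`. -/
def GerInf.lie {V : CochainComplex (ModuleCat.{v} K) ℤ} (G : GerInf V) :
    Sym (closedGen V) →ₗ[K] Sym (closedGen V) :=
  coderOf (GerCofree.proj (closedGen V) ∘ₗ G.D ∘ₗ Sym.toGer (closedGen V))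

/-- The Hochschild complex of an `A_∞`-algebra as a `ΛLie_∞`-algebra: the codifferential on
`S(s^{-2} C(A, A))` with the Taylor components `f ↦ [m, f]` and `f g ↦ (-1)^{|f|} [f, g]`
(the factor `1/2` is there since `Δ(f g)` contains both `f ⊗ g` and `± g ⊗ f`). -/
def AInf.hochLie {A : CochainComplex (ModuleCat.{w} K) ℤ} (a : AInf A) :
    Sym (hoch (openGen A)) →ₗ[K] Sym (hoch (openGen A)) :=
  coderOf (hochDiff (openGen A) a.m ∘ₗ Sym.proj (hoch (openGen A)) +
    (2 : K)⁻¹ • (hochBracket (openGen A) ∘ₗ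
      TensorProduct.map (Sym.proj (hoch (openGen A))) (Sym.proj (hoch (openGen A))) ∘ₗ
      Sym.comul (hoch (openGen A))))

/-- An `L_∞`-morphism between two `ΛLie_∞`-algebras, given on `s^{-2}` of the underlying spaces by
codifferentials `P` and `R`: a morphism of degree zero of (coaugmented) cocommutative coalgebras
compatible with the codifferentials. -/
structure LInfMor (X : ℤ → ModuleCat.{v} K) (Y : ℤ → ModuleCat.{w} K)
    (P : Sym X →ₗ[K] Sym X) (R : Sym Y →ₗ[K] Sym Y) where
  U : Sym X →ₗ[K] Sym Y
  U_one : U 1 = 1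
  U_counit : ∀ x, Sym.counit Y (U x) = Sym.counit X x
  U_comul : ∀ x, Sym.comul Y (U x) = TensorProduct.map U U (Sym.comul X x)
  U_deg : ∀ d, ∀ x ∈ Sym.deg X d, U x ∈ Sym.deg Y d
  U_comm : ∀ x, U (P x) = R (U x)

/-- A `Ger_∞`-structure on `V`, an `A_∞`-structure on `A` and an `L_∞`-morphism from `V` to the
Hochschild complex of `A`. -/
structure Triple (V : CochainComplex (ModuleCat.{v} K) ℤ)
    (A : CochainComplex (ModuleCat.{w} K) ℤ) where
  ger : GerInf V
  ainf : AInf A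
  mor : LInfMor (closedGen V) (hoch (openGen A)) ger.lie ainf.hochLie

end Structures

end GerPlus
end

/-! Write X = s^{-2}V, Y = s^{-1}A, and let P be the coderivation `GerInf.lie` of S(X). Part (1) is
an induction over trees (`GerInf.D_toGer_apply`). At a root labelled `dot` both sides are
coderivations and the claim passes to the two subtrees; at a root labelled `br` both sides vanish,
since δ is zero on the image of S(X) and anticommutes with D. The embedding of S(X) into the cofree
coalgebra loses only the scalars (`Sym.eq_of_toGer`): splitting a word of length n into letters and
multiplying them back is n!, which is invertible in characteristic zero. Hence D² = 0 gives P² = 0.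

For part (2), a coderivation of S(X) ⊗ T(Y) is determined by its composites with the projections to
S(X) and to Y (`OpenC.eq_zero_of_proj`). Compatibility with ρ forces the first composite to be -P
after the projection to S(X). The second is a map ψ from S(X) to the Hochschild cochains.
Conversely, P and ψ produce the coderivation `OpenC.codiff`, x ⊗ t ↦ ∑ ± x' ⊗ ψ(x'')t - Px ⊗ t,
where a cochain acts on T(Y) as a coderivation by insertion.

The square of such a Q is again a coderivation. Its projection to S(X) comes from P² = 0, and its
projection to Y is ½[ψ, ψ] - ψP with the convolution bracket (`OpenC.proj_codiff_codiff`). So Q² = 0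
is the Maurer-Cartan equation ψP = ½[ψ, ψ].

Now split ψ = φ + mε with ε the counit and m = ψ(1). The value of the equation at 1 is [m, m] = 0,
and then the equation becomes φP = [m, φ] + ½[φ, φ] (`hochBracket_add_scalarPart`). The convolution
exponential of φ (`Sym.expMap`) is the unique coalgebra morphism U with Taylor components φ, and the
last equation is the Taylor component of UP = RU, with R the codifferential of the Hochschild
complex. Both sides of UP = RU are coderivations along U, so nothing more has to be checked
(`Sym.comm_of_proj`). -/

noncomputable section
namespace GerPlus

/-! ### Koszul signs by means of eigenvectors of parity operators. -/

section Signs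
variable {K : Type u} [Field K]

theorem sgn_add (a b : ℤ) : sgn K (a + b) = sgn K a * sgn K b := by
  simp [sgn, Int.negOnePow_add]

theorem sgn_congr {a b : ℤ} (h : Even (a - b)) : sgn K a = sgn K b := by
  rw [sgn, sgn, (Int.negOnePow_eq_iff a b).2 h]

theorem sgn_mul_self (a : ℤ) : sgn K a * sgn K a = 1 := by
  rw [← sgn_add, sgn_congr (b := 0) (by simp)]
  simp [sgn]

theorem sgn_even {a : ℤ} (h : Even a) : sgn K a = 1 := by simp [sgn, Int.negOnePow_even _ h]

theorem sgn_odd {a : ℤ} (h : Odd a) : sgn K a = -1 := by simp [sgn, Int.negOnePow_odd _ h]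

@[simp] theorem sgn_zero : sgn K 0 = 1 := sgn_even (by simp)

@[simp] theorem sgn_one : sgn K 1 = -1 := sgn_odd (by simp)

section
variable {M N P : Type*} [AddCommGroup M] [Module K M] [AddCommGroup N] [Module K N]
  [AddCommGroup P] [Module K P]

/-- `x` is an eigenvector of the parity operator `e`, of the parity of `i`. -/
def IsPar (e : M →ₗ[K] M) (i : ℤ) (x : M) : Prop := e x = sgn K i • x

theorem IsPar.congr {e : M →ₗ[K] M} {i j : ℤ} {x : M} (h : IsPar e i x) (hij : Even (i - j)) :
    IsPar e j x := h.trans (by rw [sgn_congr hij])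

theorem IsPar.epow {e : M →ₗ[K] M} {j : ℤ} {x : M} (h : IsPar e j x) (i : ℤ) :
    epow e i x = sgn K (i * j) • x := by
  unfold GerPlus.epow
  split_ifs with hi
  · rw [sgn_even (hi.mul_right j), one_smul, LinearMap.id_apply]
  · rw [Int.not_even_iff_odd] at hi
    rw [h, sgn_congr (b := i * j)]
    obtain ⟨k, rfl⟩ := hi
    exact ⟨-k * j, by ring⟩

theorem IsPar.tmul {e : M →ₗ[K] M} {f : N →ₗ[K] N} {i j : ℤ} {x : M} {y : N}
    (hx : IsPar e i x) (hy : IsPar f j y) : IsPar (TensorProduct.map e f) (i + j) (x ⊗ₜ[K] y) := by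
  rw [IsPar, TensorProduct.map_tmul, hx, hy, TensorProduct.smul_tmul_smul, sgn_add]

theorem IsPar.map {e : M →ₗ[K] M} {f : N →ₗ[K] N} {g : M →ₗ[K] N} {s i : ℤ}
    (hg : ∀ x, f (g x) = sgn K s • g (e x)) {x : M} (hx : IsPar e i x) : IsPar f (i + s) (g x) := by
  rw [IsPar, hg, hx, map_smul, smul_smul, sgn_add, mul_comm]

theorem IsPar.smul {e : M →ₗ[K] M} {i : ℤ} {x : M} (h : IsPar e i x) (c : K) :
    IsPar e i (c • x) := by
  rw [IsPar, map_smul, h, smul_comm]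

theorem IsPar.zero {e : M →ₗ[K] M} {i : ℤ} : IsPar e i 0 := by rw [IsPar, map_zero, smul_zero]

theorem map_map_self {e : M →ₗ[K] M} {f : N →ₗ[K] N} (he : ∀ x, e (e x) = x)
    (hf : ∀ x, f (f x) = x) (z : M ⊗[K] N) :
    TensorProduct.map e f (TensorProduct.map e f z) = z := by
  induction z using TensorProduct.induction_on with
  | zero => simp
  | add a b ha hb => simp only [map_add, ha, hb]
  | tmul a b => simp [he, hf]

variable [CharZero K]

/-- On eigenvectors ½(1 + e + f - ef) is the scalar -1 if both eigenvalues are -1, and 1 otherwise.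
-/
theorem IsPar.twist {e : M →ₗ[K] M} {f : N →ₗ[K] N} {i j : ℤ} {x : M} {y : N}
    (hx : IsPar e i x) (hy : IsPar f j y) :
    twist e f (x ⊗ₜ[K] y) = sgn K (i * j) • x ⊗ₜ[K] y := by
  have h2 : (2 : K) ≠ 0 := two_ne_zero
  rw [twist_tmul, hx, hy, TensorProduct.smul_tmul_smul, TensorProduct.tmul_smul,
    ← TensorProduct.smul_tmul']
  obtain hi | hi := Int.even_or_odd i <;> obtain hj | hj := Int.even_or_odd j
  · rw [sgn_even hi, sgn_even hj, sgn_even (hi.mul_right j)]; match_scalars; field_simp; norm_num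
  · rw [sgn_even hi, sgn_odd hj, sgn_even (hi.mul_right j)]; match_scalars; field_simp; norm_num
  · rw [sgn_odd hi, sgn_even hj, sgn_even (hj.mul_left i)]; match_scalars; field_simp; norm_num
  · rw [sgn_odd hi, sgn_odd hj, sgn_odd (hi.mul hj)]; match_scalars; field_simp; norm_num

theorem IsPar.gswap {e : M →ₗ[K] M} {f : N →ₗ[K] N} {i j : ℤ} {x : M} {y : N}
    (hx : IsPar e i x) (hy : IsPar f j y) :
    gswap e f (x ⊗ₜ[K] y) = sgn K (i * j) • y ⊗ₜ[K] x := by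
  rw [GerPlus.gswap, LinearMap.comp_apply, hx.twist hy, map_smul]; rfl

/-- As e is an involution, ½(1 + e) and ½(1 - e) project to its eigenspaces. Through the induction
principles below, an additive sign identity on tensors only has to be checked on eigenvectors,
without a decomposition into homogeneous components. -/
theorem exists_isPar {e : M →ₗ[K] M} (he : ∀ x, e (e x) = x) (x : M) :
    ∃ y z, IsPar e 0 y ∧ IsPar e 1 z ∧ y + z = x := by
  have h2 : (2 : K) ≠ 0 := two_ne_zero
  refine ⟨(2 : K)⁻¹ • (x + e x), (2 : K)⁻¹ • (x - e x), ?_, ?_, ?_⟩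
  · rw [IsPar, map_smul, map_add, he, sgn_zero, one_smul, add_comm]
  · rw [IsPar, map_smul, map_sub, he, sgn_one]; module
  · match_scalars <;> field_simp <;> norm_num

@[elab_as_elim]
theorem par_induction {e : M →ₗ[K] M} (he : ∀ x, e (e x) = x) {p : M → Prop}
    (ha : ∀ x y, p x → p y → p (x + y)) (h : ∀ i x, IsPar e i x → p x) (x : M) : p x := by
  obtain ⟨y, z, hy, hz, rfl⟩ := exists_isPar he x
  exact ha _ _ (h _ _ hy) (h _ _ hz)

@[elab_as_elim]
theorem tmul_par_induction {e : M →ₗ[K] M} {f : N →ₗ[K] N} (he : ∀ x, e (e x) = x)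
    (hf : ∀ x, f (f x) = x) {p : M ⊗[K] N → Prop}
    (ha : ∀ x y, p x → p y → p (x + y))
    (h : ∀ i j x y, IsPar e i x → IsPar f j y → p (x ⊗ₜ y)) (z : M ⊗[K] N) : p z := by
  induction z using TensorProduct.induction_on with
  | zero => simpa using h 0 0 0 0 .zero .zero
  | add a b hx hy => exact ha _ _ hx hy
  | tmul x y =>
    refine par_induction he (p := fun x => p (x ⊗ₜ y))
      (fun x x' hx hx' => by rw [TensorProduct.add_tmul]; exact ha _ _ hx hx') (fun i x hx => ?_) x
    exact par_induction hf (p := fun y => p (x ⊗ₜ y))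
      (fun y y' hy hy' => by rw [TensorProduct.tmul_add]; exact ha _ _ hy hy')
      (fun j y hy => h i j x y hx hy) y

@[elab_as_elim]
theorem tmul_tmul_par_induction {e : M →ₗ[K] M} {f : N →ₗ[K] N} {g : P →ₗ[K] P}
    (he : ∀ x, e (e x) = x) (hf : ∀ x, f (f x) = x) (hg : ∀ x, g (g x) = x)
    {p : M ⊗[K] (N ⊗[K] P) → Prop} (ha : ∀ x y, p x → p y → p (x + y))
    (h : ∀ i j k x y z, IsPar e i x → IsPar f j y → IsPar g k z → p (x ⊗ₜ (y ⊗ₜ z)))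
    (z : M ⊗[K] (N ⊗[K] P)) : p z := by
  induction z using TensorProduct.induction_on with
  | zero => simpa using h 0 0 0 0 0 0 .zero .zero .zero
  | add a b hx hy => exact ha _ _ hx hy
  | tmul x w =>
    refine par_induction he (p := fun x => p (x ⊗ₜ w))
      (fun x x' hx hx' => by rw [TensorProduct.add_tmul]; exact ha _ _ hx hx') (fun i x hx => ?_) x
    exact tmul_par_induction hf hg (p := fun w => p (x ⊗ₜ w))
      (fun y y' hy hy' => by rw [TensorProduct.tmul_add]; exact ha _ _ hy hy')
      (fun j k y z hy hz => h i j k x y z hx hy hz) w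

end

section
variable (X : ℤ → ModuleCat.{v} K)

theorem parity_inc (i : ℤ) (x : X i) : parity X (inc X i x) = sgn K i • inc X i x := by
  simp [parity]

theorem isPar_inc (i : ℤ) (x : X i) : IsPar (parity X) i (inc X i x) := parity_inc X i x

theorem isPar_of_mem_range {i : ℤ} {x : Tot X} (h : x ∈ LinearMap.range (inc X i)) :
    IsPar (parity X) i x := by
  obtain ⟨y, rfl⟩ := h
  exact isPar_inc X i y

/-- Two linear expressions that depend on a generator of parity `i` agree if they agree on
homogeneous generators of that parity. -/
theorem isPar_ext [CharZero K] {M : Type*} [AddCommGroup M] [Module K M] {f g : Tot X →ₗ[K] M}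
    {i : ℤ} (h : ∀ j (x : X j), Even (i - j) → f (inc X j x) = g (inc X j x)) {x : Tot X}
    (hx : IsPar (parity X) i x) : f x = g x := by
  have h2 : (2 : K) ≠ 0 := two_ne_zero
  -- This combination is twice the part of y of the parity of i: generators of the other parity
  -- cancel, and at the eigenvector x it equals 2x.
  have key : ∀ y : Tot X, f (y + sgn K i • parity X y) = g (y + sgn K i • parity X y) := by
    intro y
    induction y using DirectSum.induction_on with
    | zero => simp
    | add a b ha hb =>
      rw [map_add (parity X), smul_add, add_add_add_comm]
      exact (map_add f _ _).trans ((congrArg₂ _ ha hb).trans (map_add g _ _).symm)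
    | of j a =>
      change f (inc X j a + sgn K i • parity X (inc X j a)) =
        g (inc X j a + sgn K i • parity X (inc X j a))
      rw [parity_inc, smul_smul, ← sgn_add]
      by_cases hij : Even (i - j)
      · rw [map_add, map_add, map_smul, map_smul, h j a hij]
      · have : sgn K (i + j) = -1 := sgn_odd (by
          rw [Int.not_even_iff_odd] at hij
          obtain ⟨k, hk⟩ := hij
          exact ⟨k + j, by omega⟩)
        rw [this]; simp
  have hk := key x
  rw [hx, smul_smul, sgn_mul_self, one_smul, ← two_smul K x, map_smul, map_smul] at hk
  exact smul_right_injective _ h2 hk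

end
end Signs

section Swap
variable {K : Type u} [Field K] {M N P : Type*} [AddCommGroup M] [Module K M]
  [AddCommGroup N] [Module K N] [AddCommGroup P] [Module K P]

/-- The Koszul flip of the first two tensor factors. -/
def gswap₁₂ (e : M →ₗ[K] M) (f : N →ₗ[K] N) :
    M ⊗[K] (N ⊗[K] P) →ₗ[K] N ⊗[K] (M ⊗[K] P) :=
  (TensorProduct.assoc K N M P).toLinearMap ∘ₗ TensorProduct.map (gswap e f) LinearMap.id ∘ₗ
    (TensorProduct.assoc K M N P).symm.toLinearMap

theorem IsPar.gswap₁₂ [CharZero K] {e : M →ₗ[K] M} {f : N →ₗ[K] N} {i j : ℤ} {x : M} {y : N}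
    (hx : IsPar e i x) (hy : IsPar f j y) (z : P) :
    gswap₁₂ e f (x ⊗ₜ[K] (y ⊗ₜ[K] z)) = sgn K (i * j) • y ⊗ₜ[K] (x ⊗ₜ[K] z) := by
  simp only [GerPlus.gswap₁₂, LinearMap.comp_apply, LinearEquiv.coe_coe,
    TensorProduct.assoc_symm_tmul, TensorProduct.map_tmul, hx.gswap hy, LinearMap.id_apply,
    ← TensorProduct.smul_tmul', map_smul, TensorProduct.assoc_tmul]

end Swap

/-! ### Cocommutativity, counit and grading of S(X). -/

namespace Sym
variable {K : Type u} [Field K] (X : ℤ → ModuleCat.{v} K)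

theorem par_par' (a : Sym X) : (par X).toLinearMap ((par X).toLinearMap a) = a := par_par X a

theorem isPar_one : IsPar (par X).toLinearMap 0 (1 : Sym X) := by simp [IsPar]

theorem isPar_ι {i : ℤ} {v : Tot X} (hv : IsPar (parity X) i v) :
    IsPar (par X).toLinearMap i (ι X v) := by
  rw [IsPar, AlgHom.toLinearMap_apply, par, lift_ι, LinearMap.comp_apply, hv, map_smul]

theorem isPar_mul {i j : ℤ} {a b : Sym X} (ha : IsPar (par X).toLinearMap i a)
    (hb : IsPar (par X).toLinearMap j b) : IsPar (par X).toLinearMap (i + j) (a * b) := by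
  rw [IsPar, AlgHom.toLinearMap_apply, map_mul]
  rw [IsPar, AlgHom.toLinearMap_apply] at ha hb
  rw [ha, hb, smul_mul_smul_comm, sgn_add]

/-- The iterated comultiplication. -/
def comul₃ : Sym X →ₗ[K] Sym X ⊗[K] (Sym X ⊗[K] Sym X) :=
  TensorProduct.map LinearMap.id (comul X) ∘ₗ comul X

theorem comul₃_apply (x : Sym X) :
    comul₃ X x = TensorProduct.map LinearMap.id (comul X) (comul X x) := rfl

theorem comul₃_eq_assoc (x : Sym X) : comul₃ X x =
    TensorProduct.assoc K _ _ _ (TensorProduct.map (comul X) LinearMap.id (comul X x)) :=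
  (comul_coassoc X x).symm

theorem gswap_comul [CharZero K] (x : Sym X) :
    gswap (par X).toLinearMap (par X).toLinearMap (comul X x) = comul X x := comul_cocomm X x

/-- By coassociativity the first two factors come from one comultiplication, which is cocommutative.
-/
theorem gswap₁₂_comul₃ [CharZero K] (x : Sym X) :
    gswap₁₂ (par X).toLinearMap (par X).toLinearMap (comul₃ X x) = comul₃ X x := by
  rw [comul₃_eq_assoc, gswap₁₂]
  simp only [LinearMap.comp_apply, LinearEquiv.coe_coe, LinearEquiv.symm_apply_apply]
  congr 1
  generalize comul X x = z
  induction z using TensorProduct.induction_on with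
  | zero => simp
  | add a b ha hb => simp only [map_add, ha, hb]
  | tmul a b => simp only [TensorProduct.map_tmul, gswap_comul, LinearMap.id_apply]

theorem gswap₂₃_comul₃ [CharZero K] (x : Sym X) :
    TensorProduct.map LinearMap.id (gswap (par X).toLinearMap (par X).toLinearMap) (comul₃ X x) =
      comul₃ X x := by
  rw [comul₃_apply]
  generalize comul X x = z
  induction z using TensorProduct.induction_on with
  | zero => simp
  | add a b ha hb => simp only [map_add, ha, hb]
  | tmul a b => simp only [TensorProduct.map_tmul, gswap_comul, LinearMap.id_apply]

theorem counit_ι (v : Tot X) : counit X (ι X v) = 0 := by simpa using counit_mul X v 1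

theorem counit_epow (i : ℤ) (x : Sym X) : counit X (epow (par X).toLinearMap i x) = counit X x := by
  unfold epow; split_ifs
  · rfl
  · exact counit_par X x

theorem map_counit_comul (x : Sym X) :
    TensorProduct.map (counit X).toLinearMap LinearMap.id (comul X x) = 1 ⊗ₜ x := by
  suffices h : x ∈ LinearMap.eqLocus (TensorProduct.map (counit X).toLinearMap LinearMap.id ∘ₗ comul X)
      (TensorProduct.mk K K (Sym X) 1) from h
  refine induct X (by simp [comul_one]) (fun i v x hx => ?_) x
  simp only [LinearMap.mem_eqLocus, LinearMap.comp_apply, comul_mul, TensorProduct.mk_apply] at hx ⊢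
  have : ∀ z, TensorProduct.map (counit X).toLinearMap LinearMap.id (comulStep X (inc X i v) z) =
      TensorProduct.map LinearMap.id (LinearMap.mulLeft K (ι X (inc X i v)))
        (TensorProduct.map (counit X).toLinearMap LinearMap.id z) := by
    intro z
    induction z using TensorProduct.induction_on with
    | zero => simp
    | add a b ha hb => simp only [map_add, ha, hb]
    | tmul a b => simp [comulStep_apply, counit_mul, counit_epow]
  rw [this, hx]; simp

theorem map_counit_comul' (x : Sym X) :
    TensorProduct.map LinearMap.id (counit X).toLinearMap (comul X x) = x ⊗ₜ 1 := by
  suffices h : x ∈ LinearMap.eqLocus (TensorProduct.map LinearMap.id (counit X).toLinearMap ∘ₗ comul X)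
      ((TensorProduct.mk K (Sym X) K).flip 1) from h
  refine induct X (by simp [comul_one]) (fun i v x hx => ?_) x
  simp only [LinearMap.mem_eqLocus, LinearMap.comp_apply, comul_mul, LinearMap.flip_apply,
    TensorProduct.mk_apply] at hx ⊢
  have : ∀ z, TensorProduct.map LinearMap.id (counit X).toLinearMap (comulStep X (inc X i v) z) =
      TensorProduct.map (LinearMap.mulLeft K (ι X (inc X i v))) LinearMap.id
        (TensorProduct.map LinearMap.id (counit X).toLinearMap z) := by
    intro z
    induction z using TensorProduct.induction_on with
    | zero => simp
    | add a b ha hb => simp only [map_add, ha, hb]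
    | tmul a b => simp [comulStep_apply, counit_mul]
  rw [this, hx]; simp

/-- The sign depends only on the parity of the generator. This form applies to letters q(a) of which
only the parity is known. -/
theorem comulStep_isPar [CharZero K] {i : ℤ} {v : Tot X} (hv : IsPar (parity X) i v) (a b : Sym X) :
    comulStep X v (a ⊗ₜ b) = (ι X v * a) ⊗ₜ b + epow (par X).toLinearMap i a ⊗ₜ (ι X v * b) := by
  refine isPar_ext X (f := (comulStep X).flip (a ⊗ₜ b))
    (g := (TensorProduct.mk K _ _).flip b ∘ₗ LinearMap.mulRight K a ∘ₗ ι X +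
      TensorProduct.mk K _ _ (epow (par X).toLinearMap i a) ∘ₗ LinearMap.mulRight K b ∘ₗ ι X)
    (fun j x hij => ?_) hv
  have : epow (par X).toLinearMap j = epow (par X).toLinearMap i := by
    have : Even j ↔ Even i := by rw [Int.even_sub] at hij; exact hij.symm
    simp only [epow, this]
  simp [comulStep_apply, this]

section Degree

theorem ι_deg {i : ℤ} {v : Tot X} (hv : v ∈ LinearMap.range (inc X i)) : ι X v ∈ deg X i := by
  obtain ⟨x, rfl⟩ := hv
  exact Submodule.subset_span ⟨[⟨i, x⟩], by simp, by simp⟩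

theorem one_deg : (1 : Sym X) ∈ deg X 0 := Submodule.subset_span ⟨[], by simp, by simp⟩

theorem mul_deg {i j d : ℤ} (h : i + j = d) {x y : Sym X} (hx : x ∈ deg X i) (hy : y ∈ deg X j) :
    x * y ∈ deg X d := by
  induction hx using Submodule.span_induction with
  | zero => simp
  | add a b _ _ ha hb => rw [add_mul]; exact add_mem ha hb
  | smul c a _ ha => rw [smul_mul_assoc]; exact Submodule.smul_mem _ _ ha
  | mem a ha =>
    induction hy using Submodule.span_induction with
    | zero => simp
    | add a b _ _ ha hb => rw [mul_add]; exact add_mem ha hb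
    | smul c a _ ha => rw [mul_smul_comm]; exact Submodule.smul_mem _ _ ha
    | mem b hb =>
      obtain ⟨l, rfl, rfl⟩ := ha
      obtain ⟨l', rfl, rfl⟩ := hb
      exact Submodule.subset_span ⟨l ++ l', by simp [h], by simp⟩

theorem deg_induct {P : ℤ → Sym X → Prop} (h0 : ∀ n, P n 0)
    (ha : ∀ n x y, P n x → P n y → P n (x + y)) (hs : ∀ n (c : K) x, P n x → P n (c • x))
    (h1 : P 0 1) (hm : ∀ n i (v : X i) x, x ∈ deg X n → P n x → P (i + n) (ι X (inc X i v) * x))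
    {n : ℤ} {x : Sym X} (hx : x ∈ deg X n) : P n x := by
  induction hx using Submodule.span_induction with
  | zero => exact h0 n
  | add a b _ _ h h' => exact ha _ _ _ h h'
  | smul c a _ h => exact hs _ _ _ h
  | mem a h =>
    obtain ⟨l, rfl, rfl⟩ := h
    induction l with
    | nil => exact h1
    | cons p l ih =>
      simp only [List.sum_cons, List.map_cons, List.prod_cons]
      exact hm _ _ _ _ (Submodule.subset_span ⟨l, rfl, rfl⟩) ih

theorem isPar_deg {d : ℤ} {x : Sym X} (hx : x ∈ deg X d) : IsPar (par X).toLinearMap d x := by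
  refine deg_induct X (P := fun d x => IsPar (par X).toLinearMap d x) (fun _ => .zero)
    (fun n x y hx hy => ?_) (fun n c x hx => hx.smul c) (isPar_one X) (fun n i v x _ hx => ?_) hx
  · rw [IsPar] at *; rw [map_add, hx, hy, smul_add]
  · exact isPar_mul X (isPar_ι X (isPar_inc X i v)) hx

theorem epow_deg (i : ℤ) {d : ℤ} {x : Sym X} (hx : x ∈ deg X d) :
    epow (par X).toLinearMap i x ∈ deg X d := by
  rw [(isPar_deg X hx).epow]; exact Submodule.smul_mem _ _ hx

theorem par_deg {d : ℤ} {x : Sym X} (hx : x ∈ deg X d) : par X x ∈ deg X d := by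
  rw [← AlgHom.toLinearMap_apply, isPar_deg X hx]; exact Submodule.smul_mem _ _ hx

/-- Every element is a sum of homogeneous elements. -/
theorem iSup_deg (x : Sym X) : x ∈ ⨆ d, deg X d := by
  refine induct X (Submodule.mem_iSup_of_mem 0 (one_deg X)) (fun i v x hx => ?_) x
  induction hx using Submodule.iSup_induction' with
  | mem n x hx => exact Submodule.mem_iSup_of_mem (i + n) (mul_deg X rfl (ι_deg X ⟨v, rfl⟩) hx)
  | zero => simp
  | add a b _ _ ha hb => rw [mul_add]; exact add_mem ha hb

/-- This uses only that the homogeneous elements span, not that the sum of the degrees is direct. -/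
theorem deg_ext {M : Type*} [AddCommGroup M] [Module K M] {f g : Sym X →ₗ[K] M}
    (h : ∀ d, ∀ x ∈ deg X d, f x = g x) (x : Sym X) : f x = g x := by
  have : (⨆ d, deg X d) ≤ LinearMap.eqLocus f g := iSup_le fun d x hx => h d x hx
  exact this (iSup_deg X x)

theorem counit_deg {d : ℤ} (hd : d ≠ 0) {x : Sym X} (hx : x ∈ deg X d) : counit X x = 0 := by
  induction hx using Submodule.span_induction with
  | zero => simp
  | add a b _ _ h h' => rw [map_add, h, h', add_zero]
  | smul c a _ h => rw [map_smul, h, smul_zero]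
  | mem a h =>
    obtain ⟨l, rfl, rfl⟩ := h
    cases l with
    | nil => simp at hd
    | cons p l => simp [counit_ι]

theorem proj_deg {d : ℤ} {x : Sym X} (hx : x ∈ deg X d) :
    proj X x ∈ LinearMap.range (inc X d) := by
  induction hx using Submodule.span_induction with
  | zero => simp
  | add a b _ _ h h' => rw [map_add]; exact add_mem h h'
  | smul c a _ h => rw [map_smul]; exact Submodule.smul_mem _ _ h
  | mem a h =>
    obtain ⟨l, rfl, rfl⟩ := h
    cases l with
    | nil => simp [proj_one]
    | cons p l =>
      simp only [List.map_cons, List.prod_cons, proj_mul]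
      cases l with
      | nil =>
        rw [show ([p].map Sigma.fst).sum = p.1 by simp]
        exact Submodule.smul_mem _ _ ⟨p.2, rfl⟩
      | cons q l => simp [counit_ι]

/-- The tensors of degree `d`. -/
def deg₂ (d : ℤ) : Submodule K (Sym X ⊗[K] Sym X) :=
  Submodule.span K {z | ∃ i j x y, i + j = d ∧ x ∈ deg X i ∧ y ∈ deg X j ∧ x ⊗ₜ y = z}

theorem comul_deg {d : ℤ} {x : Sym X} (hx : x ∈ deg X d) : comul X x ∈ deg₂ X d := by
  refine deg_induct X (P := fun d x => comul X x ∈ deg₂ X d) (by simp)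
    (fun n x y hx hy => by rw [map_add]; exact add_mem hx hy)
    (fun n c x hx => by rw [map_smul]; exact Submodule.smul_mem _ _ hx)
    ?_ (fun n i v x _ hx => ?_) hx
  · rw [comul_one]
    exact Submodule.subset_span ⟨0, 0, 1, 1, rfl, one_deg X, one_deg X, rfl⟩
  · rw [comul_mul]
    generalize comul X x = z at hx
    induction hx using Submodule.span_induction with
    | zero => simp
    | add a b _ _ ha hb => rw [map_add]; exact add_mem ha hb
    | smul c a _ ha => rw [map_smul]; exact Submodule.smul_mem _ _ ha
    | mem a ha =>
      obtain ⟨p, q, a, b, rfl, ha, hb, rfl⟩ := ha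
      rw [comulStep_apply]
      have hv := ι_deg X (v := inc X i v) ⟨v, rfl⟩
      exact add_mem
        (Submodule.subset_span ⟨i + p, q, _, b, by ring, mul_deg X rfl hv ha, hb, rfl⟩)
        (Submodule.subset_span ⟨p, i + q, _, _, by ring, epow_deg X i ha, mul_deg X rfl hv hb, rfl⟩)

theorem deg₂_induct {d : ℤ} {M : Type*} [AddCommGroup M] [Module K M] (N : Submodule K M)
    (f : Sym X ⊗[K] Sym X →ₗ[K] M)
    (h : ∀ i j x y, i + j = d → x ∈ deg X i → y ∈ deg X j → f (x ⊗ₜ y) ∈ N)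
    {z : Sym X ⊗[K] Sym X} (hz : z ∈ deg₂ X d) : f z ∈ N := by
  have : deg₂ X d ≤ N.comap f := by
    refine Submodule.span_le.2 ?_
    rintro _ ⟨i, j, x, y, hij, hx, hy, rfl⟩
    exact h i j x y hij hx hy
  exact this hz

/-- A homogeneous map commutes with the parity operators up to a sign. -/
theorem comm_par_of_deg {Z : ℤ → ModuleCat.{w} K} {s : ℤ} {g : Sym X →ₗ[K] Sym Z}
    (hg : ∀ d, ∀ x ∈ deg X d, g x ∈ deg Z (d + s)) (x : Sym X) :
    (par Z).toLinearMap (g x) = sgn K s • g ((par X).toLinearMap x) := by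
  refine deg_ext X (f := (par Z).toLinearMap ∘ₗ g) (g := sgn K s • g ∘ₗ (par X).toLinearMap)
    (fun d x hx => ?_) x
  rw [LinearMap.comp_apply, isPar_deg Z (hg d x hx), LinearMap.smul_apply, LinearMap.comp_apply,
    isPar_deg X hx, map_smul, smul_smul, sgn_add, mul_comm]

theorem comm_parity_of_deg {Z : ℤ → ModuleCat.{w} K} {s : ℤ} {q : Sym X →ₗ[K] Tot Z}
    (hq : ∀ d, ∀ x ∈ deg X d, q x ∈ LinearMap.range (inc Z (d + s))) (x : Sym X) :
    parity Z (q x) = sgn K s • q ((par X).toLinearMap x) := by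
  refine deg_ext X (f := parity Z ∘ₗ q) (g := sgn K s • q ∘ₗ (par X).toLinearMap)
    (fun d x hx => ?_) x
  rw [LinearMap.comp_apply, isPar_of_mem_range Z (hq d x hx), LinearMap.smul_apply,
    LinearMap.comp_apply, isPar_deg X hx, map_smul, smul_smul, sgn_add, mul_comm]

end Degree

end Sym

/-! ### Convolution products and coderivations of S(X). -/

namespace Sym
variable {K : Type u} [Field K] {X : ℤ → ModuleCat.{v} K} {Z : ℤ → ModuleCat.{w} K}

/-- The convolution product `x ↦ ∑ q(x') g(x'')`. -/
def cap (q : Sym X →ₗ[K] Tot Z) (g : Sym X →ₗ[K] Sym Z) : Sym X →ₗ[K] Sym Z :=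
  LinearMap.mul' K (Sym Z) ∘ₗ TensorProduct.map (ι Z ∘ₗ q) g ∘ₗ comul X

theorem cap_apply (q : Sym X →ₗ[K] Tot Z) (g : Sym X →ₗ[K] Sym Z) (x : Sym X) :
    cap q g x = LinearMap.mul' K (Sym Z) (TensorProduct.map (ι Z ∘ₗ q) g (comul X x)) := rfl

theorem coderOf_eq_cap (q : Sym X →ₗ[K] Tot X) : coderOf q = cap q LinearMap.id := rfl

/-- In Δ of a product with first letter q(x') this letter goes either to the left or to the right
factor. In the second case it passes the left factor; the flip of the two arguments in S(X) is
absorbed by cocommutativity, and the sign that remains comes from the degree s of q. -/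
theorem comulStep_comul₃ [CharZero K] {q : Sym X →ₗ[K] Tot Z} {s : ℤ}
    (hq : ∀ x, parity Z (q x) = sgn K s • q ((par X).toLinearMap x)) {g₁ g₂ : Sym X →ₗ[K] Sym Z}
    (hg : ∀ x, (par Z).toLinearMap (g₁ x) = g₁ ((par X).toLinearMap x)) (x : Sym X) :
    TensorProduct.lift (comulStep Z ∘ₗ q)
      (TensorProduct.map LinearMap.id (TensorProduct.map g₁ g₂) (comul₃ X x)) =
    TensorProduct.map (cap q g₁) g₂ (comul X x) +
      TensorProduct.map (g₁ ∘ₗ epow (par X).toLinearMap s) (cap q g₂) (comul X x) := by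
  have key : ∀ z, TensorProduct.lift (comulStep Z ∘ₗ q)
      (TensorProduct.map LinearMap.id (TensorProduct.map g₁ g₂) z) =
      TensorProduct.map (LinearMap.mul' K (Sym Z) ∘ₗ TensorProduct.map (ι Z ∘ₗ q) g₁) g₂
        ((TensorProduct.assoc K _ _ _).symm z) +
      TensorProduct.map (g₁ ∘ₗ epow (par X).toLinearMap s)
        (LinearMap.mul' K (Sym Z) ∘ₗ TensorProduct.map (ι Z ∘ₗ q) g₂)
        (gswap₁₂ (par X).toLinearMap (par X).toLinearMap z) := by
    intro z
    refine tmul_tmul_par_induction (par_par' X) (par_par' X) (par_par' X)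
      (fun x y hx hy => ?_) (fun i j k a b c ha hb hc => ?_) z
    · simp only [map_add, hx, hy]; abel
    · have hqa : IsPar (parity Z) (i + s) (q a) := IsPar.map hq ha
      have hgb : IsPar (par Z).toLinearMap j (g₁ b) :=
        (IsPar.map (s := 0) (fun x => by rw [hg, sgn_zero, one_smul]) hb).congr (by simp)
      simp only [TensorProduct.map_tmul, LinearMap.id_apply, TensorProduct.lift.tmul,
        LinearMap.comp_apply, comulStep_isPar Z hqa, hgb.epow, TensorProduct.assoc_symm_tmul,
        LinearMap.mul'_apply, ha.gswap₁₂ hb, map_smul, hb.epow, ← TensorProduct.smul_tmul',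
        smul_smul, ← sgn_add]
      rw [sgn_congr (a := (i + s) * j) (b := i * j + s * j) (by simp [add_mul])]
  rw [key, gswap₁₂_comul₃, comul₃_eq_assoc, LinearEquiv.symm_apply_apply, ← comul₃_eq_assoc,
    comul₃_apply, TensorProduct.map_map, TensorProduct.map_map, LinearMap.comp_id, LinearMap.comp_id]
  rfl

/-- The hypothesis on g is a finite sum so that one formula serves both coderivations (a single
term) and divided powers (terms indexed by an antidiagonal). -/
theorem comul_cap [CharZero K] {q : Sym X →ₗ[K] Tot Z} {s : ℤ}
    (hq : ∀ x, parity Z (q x) = sgn K s • q ((par X).toLinearMap x)) {g : Sym X →ₗ[K] Sym Z}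
    {I : Type*} (F : Finset I) {g₁ g₂ : I → Sym X →ₗ[K] Sym Z}
    (hg : ∀ i x, (par Z).toLinearMap (g₁ i x) = g₁ i ((par X).toLinearMap x))
    (h : ∀ x, comul Z (g x) = ∑ i ∈ F, TensorProduct.map (g₁ i) (g₂ i) (comul X x)) (x : Sym X) :
    comul Z (cap q g x) = ∑ i ∈ F, (TensorProduct.map (cap q (g₁ i)) (g₂ i) (comul X x) +
      TensorProduct.map (g₁ i ∘ₗ epow (par X).toLinearMap s) (cap q (g₂ i)) (comul X x)) := by
  simp_rw [← comulStep_comul₃ hq (hg _), ← map_sum, comul₃_apply, cap_apply]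
  generalize comul X x = z
  induction z using TensorProduct.induction_on with
  | zero => simp
  | add a b ha hb => simp only [map_add, ha, hb, Finset.sum_add_distrib]
  | tmul a b =>
    simp only [TensorProduct.map_tmul, LinearMap.mul'_apply, LinearMap.comp_apply, comul_mul,
      LinearMap.id_apply, h, ← TensorProduct.tmul_sum, TensorProduct.lift.tmul]

/-- A coderivation of odd degree of the coalgebra `S(X)`. -/
theorem comul_coderOf [CharZero K] {q : Sym X →ₗ[K] Tot X}
    (hq : ∀ x, parity X (q x) = sgn K 1 • q ((par X).toLinearMap x)) (x : Sym X) :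
    comul X (coderOf q x) = TensorProduct.map (coderOf q) LinearMap.id (comul X x) +
      TensorProduct.map (par X).toLinearMap (coderOf q) (comul X x) := by
  rw [coderOf_eq_cap, comul_cap hq {()} (g := LinearMap.id) (g₁ := fun _ => LinearMap.id)
    (g₂ := fun _ => LinearMap.id) (fun _ _ => rfl) (by simp), Finset.sum_singleton]
  have : epow (par X).toLinearMap 1 = (par X).toLinearMap := if_neg (by simp)
  rw [this, LinearMap.id_comp]

theorem counit_cap (q : Sym X →ₗ[K] Tot Z) (g : Sym X →ₗ[K] Sym Z) (x : Sym X) :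
    counit Z (cap q g x) = 0 := by
  rw [cap_apply]
  generalize comul X x = z
  induction z using TensorProduct.induction_on with
  | zero => simp
  | add a b ha hb => simp only [map_add, ha, hb, add_zero]
  | tmul a b => simp [counit_ι]

/-- A product with a leading letter projects to that letter times the counit of the other factor. -/
theorem proj_cap (q : Sym X →ₗ[K] Tot Z) (g : Sym X →ₗ[K] Sym Z) (x : Sym X) :
    proj Z (cap q g x) = TensorProduct.rid K _
      (TensorProduct.map q ((counit Z).toLinearMap ∘ₗ g) (comul X x)) := by
  rw [cap_apply]
  generalize comul X x = z
  induction z using TensorProduct.induction_on with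
  | zero => simp
  | add a b ha hb => simp only [map_add, ha, hb]
  | tmul a b => simp [proj_mul]

theorem proj_cap_of_counit (q : Sym X →ₗ[K] Tot Z) {g : Sym X →ₗ[K] Sym Z}
    (hg : ∀ x, counit Z (g x) = counit X x) (x : Sym X) : proj Z (cap q g x) = q x := by
  have : (counit Z).toLinearMap ∘ₗ g = (counit X).toLinearMap := LinearMap.ext hg
  rw [proj_cap, this, ← LinearMap.comp_id q, ← LinearMap.id_comp (counit X).toLinearMap,
    TensorProduct.map_comp, LinearMap.comp_apply, map_counit_comul']
  simp

theorem counit_coderOf (q : Sym X →ₗ[K] Tot X) (x : Sym X) : counit X (coderOf q x) = 0 :=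
  counit_cap q _ x

theorem proj_coderOf (q : Sym X →ₗ[K] Tot X) (x : Sym X) : proj X (coderOf q x) = q x :=
  proj_cap_of_counit q (fun _ => rfl) x

theorem coderOf_one {q : Sym X →ₗ[K] Tot X} (hq : q 1 = 0) : coderOf q 1 = 0 := by
  simp [coderOf_eq_cap, cap_apply, comul_one, hq]

theorem cap_deg {q : Sym X →ₗ[K] Tot Z} {s t : ℤ}
    (hq : ∀ d, ∀ x ∈ deg X d, q x ∈ LinearMap.range (inc Z (d + s))) {g : Sym X →ₗ[K] Sym Z}
    (hg : ∀ d, ∀ x ∈ deg X d, g x ∈ deg Z (d + t)) (d : ℤ) (x : Sym X) (hx : x ∈ deg X d) :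
    cap q g x ∈ deg Z (d + (s + t)) := by
  refine deg₂_induct X (deg Z (d + (s + t)))
    (LinearMap.mul' K (Sym Z) ∘ₗ TensorProduct.map (ι Z ∘ₗ q) g)
    (fun i j x y hij hx hy => ?_) (comul_deg X hx)
  simp only [LinearMap.comp_apply, TensorProduct.map_tmul, LinearMap.mul'_apply]
  exact mul_deg Z (by rw [← hij]; ring) (ι_deg Z (hq _ _ hx)) (hg _ _ hy)

theorem coderOf_deg {q : Sym X →ₗ[K] Tot X} {s : ℤ}
    (hq : ∀ d, ∀ x ∈ deg X d, q x ∈ LinearMap.range (inc X (d + s))) (d : ℤ) (x : Sym X)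
    (hx : x ∈ deg X d) : coderOf q x ∈ deg X (d + s) := by
  simpa [coderOf_eq_cap] using cap_deg hq (g := LinearMap.id) (t := 0) (by simp) d x hx

/-! ### The Euler operator and the injectivity of the embedding into trees. -/

section Euler
variable (X)

theorem mem_wt_zero {x : Sym X} (hx : x ∈ wt X 0) : x = counit X x • 1 := by
  induction hx using Submodule.span_induction with
  | zero => simp
  | add a b _ _ h h' => rw [map_add, add_smul, ← h, ← h']
  | smul c a _ h => rw [map_smul, smul_assoc, ← h]
  | mem a h =>
    obtain ⟨l, hl, rfl⟩ := h
    rw [List.length_eq_zero_iff] at hl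
    simp [hl]

theorem mul_ι_proj (v : Tot X) (i : ℤ) (hv : IsPar (parity X) i v) (a : Sym X) [CharZero K] :
    ι X (proj X (epow (par X).toLinearMap i a)) * ι X v = ι X v * ι X (proj X a) := by
  have h1 : ∀ b : Tot X, ι X (epow (parity X) i b) * ι X v = ι X v * ι X b := by
    intro b
    refine isPar_ext X (i := i) (f := LinearMap.mulLeft K (ι X (epow (parity X) i b)) ∘ₗ ι X)
      (g := LinearMap.mulRight K (ι X b) ∘ₗ ι X) (fun j w hij => ?_) hv
    simp only [LinearMap.comp_apply, LinearMap.mulLeft_apply, LinearMap.mulRight_apply]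
    induction b using DirectSum.induction_on with
    | zero => simp
    | add a b ha hb => simp only [map_add, add_mul, mul_add, ha, hb]
    | of k b =>
      change ι X (epow (parity X) i (inc X k b)) * _ = _ * ι X (inc X k b)
      rw [(isPar_inc X k b).epow, map_smul, smul_mul_assoc, ι_swap, smul_smul, ← sgn_add,
        sgn_even, one_smul]
      obtain ⟨m, hm⟩ := hij
      exact ⟨k * (m + j), by rw [show i = m + m + j by omega]; ring⟩
  have h2 : proj X (epow (par X).toLinearMap i a) = epow (parity X) i (proj X a) := by
    unfold epow; split_ifs
    · rfl
    · exact proj_par X a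
  rw [h2, h1]

/-- The convolution of `proj` with the identity takes each letter out in turn and puts it in front.
By graded commutativity every one of the n choices gives the word back. -/
theorem euler_wt [CharZero K] {n : ℕ} {x : Sym X} (hx : x ∈ wt X n) :
    cap (proj X) LinearMap.id x = (n : K) • x := by
  refine wt_induct X (P := fun n x => cap (proj X) LinearMap.id x = (n : K) • x) (by simp)
    (fun n x y hx hy => by rw [map_add, hx, hy, smul_add])
    (fun n c x hx => by rw [map_smul, hx, smul_comm])
    (by simp [cap_apply, comul_one, proj_one]) (fun n i v x _ hx => ?_) hx
  -- Either the new letter v is the one taken out, or v stays in the remainder and is moved back to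
  -- the front with `mul_ι_proj`.
  have key : ∀ z, LinearMap.mul' K (Sym X) (TensorProduct.map (ι X ∘ₗ proj X) LinearMap.id
      (comulStep X (inc X i v) z)) = ι X (inc X i v) *
        TensorProduct.lid K _ (TensorProduct.map (counit X).toLinearMap LinearMap.id z) +
      ι X (inc X i v) * LinearMap.mul' K (Sym X)
        (TensorProduct.map (ι X ∘ₗ proj X) LinearMap.id z) := by
    intro z
    induction z using TensorProduct.induction_on with
    | zero => simp
    | add a b ha hb => simp only [map_add, mul_add, ha, hb]; abel
    | tmul a b =>
      simp only [comulStep_apply, map_add, TensorProduct.map_tmul, LinearMap.mul'_apply,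
        LinearMap.comp_apply, LinearMap.id_apply, proj_mul, map_smul,
        TensorProduct.lid_tmul, AlgHom.toLinearMap_apply, smul_mul_assoc, mul_smul_comm,
        ← mul_assoc]
      rw [mul_ι_proj X _ i (isPar_inc X i v)]
  rw [cap_apply, comul_mul, key, map_counit_comul, ← cap_apply, hx, TensorProduct.lid_tmul,
    one_smul, mul_smul_comm]
  push_cast
  rw [add_smul, one_smul, add_comm]

/-- The right comb with `n + 1` leaves, all vertices labelled by `dot`. -/
def _root_.GerPlus.Shape.comb : ℕ → Shape
  | 0 => Shape.leaf
  | n + 1 => Shape.dot Shape.leaf (comb n)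

theorem _root_.GerPlus.Shape.leaves_comb (n : ℕ) : (Shape.comb n).leaves = n + 1 := by
  induction n with
  | zero => rfl
  | succ n ih => rw [Shape.comb, Shape.leaves, ih, Shape.leaves]; ring

/-- Multiplication of the leaves of a comb. -/
def combMul : (n : ℕ) → TreePow X (Shape.comb n) →ₗ[K] Sym X
  | 0 => ι X
  | n + 1 => LinearMap.mul' K (Sym X) ∘ₗ TensorProduct.map (ι X) (combMul n)

/-- Multiplying the leaves back turns the comb into Euler operators on the weights n + 1, n, …, and
their eigenvalues multiply to the factorial. -/
theorem combMul_treeComponent [CharZero K] (n : ℕ) {x : Sym X} (hx : x ∈ wt X (n + 1)) :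
    combMul X n (treeComponent X (Shape.comb n) x) = ((n + 1).factorial : K) • x := by
  induction n generalizing x with
  | zero =>
    change ι X (proj X x) = _
    refine wt_induct X (n := 1)
      (P := fun n x => n = 1 → ι X (proj X x) = ((0 + 1).factorial : K) • x) (by simp)
      (fun n x y hx hy h => by rw [map_add, map_add, hx h, hy h, smul_add])
      (fun n c x hx h => by rw [map_smul, map_smul, hx h, smul_comm]) (by simp)
      (fun n i v x hx _ h => ?_) hx rfl
    obtain rfl : n = 0 := by omega
    rw [proj_mul, map_smul, mem_wt_zero X hx]
    simp
  | succ n ih =>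
    have h1 : combMul X (n + 1) (treeComponent X (Shape.comb (n + 1)) x) =
        LinearMap.mul' K (Sym X) (TensorProduct.map (ι X ∘ₗ proj X)
          (combMul X n ∘ₗ treeComponent X (Shape.comb n)) (comul X x)) := by
      rw [TensorProduct.map_comp]; rfl
    -- The left leaf only sees weight one, so the right factor has exactly the weight to which the
    -- induction hypothesis applies.
    have h2 : ∀ z ∈ Submodule.span K {z | ∃ p q a b, p + q = n + 1 + 1 ∧ a ∈ wt X p ∧ b ∈ wt X q ∧
        a ⊗ₜ[K] b = z}, TensorProduct.map (ι X ∘ₗ proj X)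
          (combMul X n ∘ₗ treeComponent X (Shape.comb n)) z =
        ((n + 1).factorial : K) • TensorProduct.map (ι X ∘ₗ proj X) LinearMap.id z := by
      intro z hz
      induction hz using Submodule.span_induction with
      | zero => simp
      | add a b _ _ ha hb => rw [map_add, map_add, ha, hb, smul_add]
      | smul c a _ ha => rw [map_smul, map_smul, ha, smul_comm]
      | mem z hz =>
        obtain ⟨p, q, a, b, hpq, ha, hb, rfl⟩ := hz
        rw [TensorProduct.map_tmul, TensorProduct.map_tmul]
        by_cases hp : p = 1
        · obtain rfl : q = n + 1 := by omega
          rw [LinearMap.comp_apply (combMul X n), ih hb, TensorProduct.tmul_smul, LinearMap.id_apply]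
        · have : proj X a = 0 := treeComponent_wt X Shape.leaf (fun h => hp h.symm) ha
          rw [LinearMap.comp_apply (ι X), this, map_zero, TensorProduct.zero_tmul,
            TensorProduct.zero_tmul, smul_zero]
    rw [h1, h2 _ (comul_wt X hx), map_smul, ← cap_apply, euler_wt X hx, smul_smul,
      Nat.factorial_succ (n + 1)]
    push_cast
    rw [mul_comm]

/-- The iterated reduced comultiplications, projected to the generators, determine an element of
`S(X)` up to its counit. -/
theorem eq_zero_of_treeComponent [CharZero K] {x : Sym X} (h0 : counit X x = 0)
    (h : ∀ T, treeComponent X T x = 0) : x = 0 := by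
  classical
  obtain ⟨f, rfl⟩ := (Submodule.mem_iSup_iff_exists_dfinsupp' _ _).1 (iSup_wt X x)
  -- The comb with n + 1 leaves detects the component of weight n + 1 and no other one. Division by
  -- the factorial then kills this component.
  have hpos : ∀ n, (f (n + 1) : Sym X) = 0 := by
    intro n
    have h1 : ∀ k, k ≠ n + 1 → treeComponent X (Shape.comb n) (f k) = 0 := fun k hk =>
      treeComponent_wt X _ (by rw [Shape.leaves_comb]; exact hk.symm) (f k).2
    have h2 := h (Shape.comb n)
    rw [DFinsupp.sum, map_sum, Finset.sum_eq_single (n + 1) (fun k _ hk => h1 k hk)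
      (fun hk => by rw [DFinsupp.notMem_support_iff.1 hk]; simp)] at h2
    have h3 := combMul_treeComponent X n (f (n + 1)).2
    rw [h2, map_zero] at h3
    exact (smul_eq_zero.1 h3.symm).resolve_left (by exact_mod_cast Nat.factorial_ne_zero _)
  have hsum : (f.sum fun _ y => (y : Sym X)) = f 0 := by
    rw [DFinsupp.sum, Finset.sum_eq_single 0 (fun k _ hk => ?_)
      (fun hk => by rw [DFinsupp.notMem_support_iff.1 hk]; simp)]
    obtain ⟨n, rfl⟩ := Nat.exists_eq_succ_of_ne_zero hk
    exact hpos n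
  rw [hsum] at h0 ⊢
  rw [mem_wt_zero X (f 0).2, h0, zero_smul]

theorem eq_of_treeComponent [CharZero K] {x y : Sym X} (h0 : counit X x = counit X y)
    (h : ∀ T, treeComponent X T x = treeComponent X T y) : x = y := by
  rw [← sub_eq_zero]
  exact eq_zero_of_treeComponent X (by rw [map_sub, h0, sub_self])
    (fun T => by rw [map_sub, h, sub_self])

/-- The scalars are the whole kernel of `toGer`, so the counits have to be compared separately. -/
theorem eq_of_toGer [CharZero K] {x y : Sym X} (h0 : counit X x = counit X y)
    (h : toGer X x = toGer X y) : x = y := by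
  refine eq_of_treeComponent X h0 fun T => ?_
  rw [← toTree_apply, ← toTree_apply]
  exact congrArg (fun z : GerCofree X => (z : Tree X) T) h

end Euler

end Sym

/-! ### The cooperations on the image of S(X) in the cofree coalgebra. -/

section Restrict
variable {K : Type u} [Field K]

theorem mapIncl_restrictCoop {M : Type*} [AddCommGroup M] [Module K M] (f : M →ₗ[K] M ⊗[K] M)
    (N : Submodule K M) (h : ∀ x ∈ N, f x ∈ LinearMap.range (TensorProduct.mapIncl N N)) (x : N) :
    TensorProduct.mapIncl N N (restrictCoop f N h x) = f x := by
  have := (LinearEquiv.ofInjective (TensorProduct.mapIncl N N)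
    (Module.Flat.tensorProduct_mapIncl_injective_of_right N N)).apply_symm_apply
    ((f ∘ₗ N.subtype).codRestrict _ (fun x => h x x.2) x)
  exact congrArg Subtype.val this

variable (X : ℤ → ModuleCat.{v} K)

theorem Tree.component_cobr (y : Tree X) (l r : Shape) :
    TensorProduct.map (DirectSum.component K Shape (fun T => TreePow X T) l)
        (DirectSum.component K Shape (fun T => TreePow X T) r) (Tree.cobr X y) =
      y (Shape.br l r) := by
  induction y using DirectSum.induction_on with
  | zero => rw [map_zero, map_zero]; rfl
  | add a b ha hb => rw [map_add, map_add, ha, hb]; rfl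
  | of T y =>
    change TensorProduct.map _ _ (Tree.cobr X (Tree.of X T y)) = Tree.of X T y (Shape.br l r)
    rw [Tree.cobr, Tree.of, DirectSum.toModule_lof]
    match T, y with
    | Shape.leaf, y => exact (map_zero _).trans (Tree.of_ne X (T := Shape.br l r) (by simp) y).symm
    | Shape.dot a b, y => exact (map_zero _).trans (Tree.of_ne X (T := Shape.br l r) (by simp) y).symm
    | Shape.br a b, y =>
      change TensorProduct.map _ _ (TensorProduct.map (Tree.of X a) (Tree.of X b) y) =
        Tree.of X (Shape.br a b) y (Shape.br l r)
      have h1 : ∀ (i j : Shape) (z : TreePow X i), DirectSum.component K Shape (fun T => TreePow X T) j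
          (Tree.of X i z) = Tree.of X i z j := fun _ _ _ => rfl
      by_cases hab : a = l ∧ b = r
      · obtain ⟨rfl, rfl⟩ := hab
        rw [Tree.of_same]
        change TensorProduct.map _ _ (TensorProduct.map (Tree.of X a) (Tree.of X b)
          (y : TreePow X a ⊗[K] TreePow X b)) = (y : TreePow X a ⊗[K] TreePow X b)
        change TreePow X a ⊗[K] TreePow X b at y
        induction y using TensorProduct.induction_on with
        | zero => simp
        | add p q hp hq => rw [map_add, map_add, hp, hq]
        | tmul p q => simp only [TensorProduct.map_tmul, h1, Tree.of_same]
      · rw [Tree.of_ne X (by simpa using hab)]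
        change TensorProduct.map _ _ (TensorProduct.map (Tree.of X a) (Tree.of X b)
          (y : TreePow X a ⊗[K] TreePow X b)) = 0
        change TreePow X a ⊗[K] TreePow X b at y
        induction y using TensorProduct.induction_on with
        | zero => simp
        | add p q hp hq => rw [map_add, map_add, hp, hq, add_zero]
        | tmul p q =>
          simp only [TensorProduct.map_tmul, h1]
          obtain ha | hb := not_and_or.1 hab
          · rw [Tree.of_ne X ha, TensorProduct.zero_tmul]
          · rw [Tree.of_ne X hb, TensorProduct.tmul_zero]

namespace Sym

theorem treeComponent_deg (T : Shape) {d : ℤ} {x : Sym X} (hx : x ∈ deg X d) :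
    treeComponent X T x ∈ TreePow.deg X T d := by
  induction T generalizing d x with
  | leaf => exact proj_deg X hx
  | dot l r hl hr =>
    refine deg₂_induct X (TreePow.deg X (Shape.dot l r) d)
      (TensorProduct.map (treeComponent X l) (treeComponent X r))
      (fun i j x y hij hx hy => ?_) (comul_deg X hx)
    exact Submodule.subset_span ⟨i, j, _, _, hij, hl hx, hr hy, rfl⟩
  | br l r => exact zero_mem _

theorem treeComponent_one (T : Shape) : treeComponent X T 1 = 0 := by
  induction T with
  | leaf => exact proj_one X
  | dot l r hl hr =>
    change TensorProduct.map (treeComponent X l) (treeComponent X r) (comul X 1) = 0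
    rw [comul_one, TensorProduct.map_tmul, hl, TensorProduct.zero_tmul]
  | br l r => rfl

variable [CharZero K]

theorem coe_toGer (x : Sym X) : (toGer X x : Tree X) = toTree X x := rfl

theorem toGer_deg {d : ℤ} {x : Sym X} (hx : x ∈ deg X d) : toGer X x ∈ GerCofree.deg X d := by
  change ∀ T, toTree X x T ∈ _
  intro T
  rw [toTree_apply]
  exact treeComponent_deg X T hx

/-- The comparison takes place in the tensor square of the tree coalgebra, into which the tensor
square of the subcoalgebra embeds by flatness. -/
theorem comul_toGer (x : Sym X) : GerCofree.comul X (toGer X x) =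
    TensorProduct.map (toGer X) (toGer X) (comul X x) := by
  apply Module.Flat.tensorProduct_mapIncl_injective_of_right (GerCofree X) (GerCofree X)
  rw [GerCofree.comul, mapIncl_restrictCoop, coe_toGer, comul_toTree, TensorProduct.mapIncl,
    TensorProduct.map_map]
  rfl

theorem cobr_toGer (x : Sym X) : GerCofree.cobr X (toGer X x) = 0 := by
  apply Module.Flat.tensorProduct_mapIncl_injective_of_right (GerCofree X) (GerCofree X)
  rw [GerCofree.cobr, mapIncl_restrictCoop, coe_toGer, cobr_toTree, map_zero]

theorem toGer_one : toGer X 1 = 0 :=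
  Subtype.ext (DFinsupp.ext fun T => (toTree_apply X 1 T).trans (treeComponent_one X T))

end Sym
end Restrict

/-! ### The ΛLie_∞-structure of a Ger_∞-structure. -/

section Lie
variable {K : Type u} [Field K] [CharZero K] {V : CochainComplex (ModuleCat.{v} K) ℤ}
open GerPlus.Sym

/-- Degrees in the cofree coalgebra are imposed tree by tree; the tree with one leaf is the one that
matters here. -/
theorem GerInf.taylor_deg (G : GerInf V) (d : ℤ) (x : Sym (closedGen V))
    (hx : x ∈ Sym.deg (closedGen V) d) :
    (GerCofree.proj (closedGen V) ∘ₗ G.D ∘ₗ toGer (closedGen V)) x ∈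
      LinearMap.range (inc (closedGen V) (d + 1)) :=
  G.D_deg d _ (toGer_deg _ hx) Shape.leaf

theorem GerInf.lie_deg (G : GerInf V) (d : ℤ) (x : Sym (closedGen V))
    (hx : x ∈ Sym.deg (closedGen V) d) : G.lie x ∈ Sym.deg (closedGen V) (d + 1) :=
  coderOf_deg G.taylor_deg d x hx

theorem GerInf.comul_lie (G : GerInf V) (x : Sym (closedGen V)) :
    Sym.comul (closedGen V) (G.lie x) =
      TensorProduct.map G.lie LinearMap.id (Sym.comul (closedGen V) x) +
      TensorProduct.map (Sym.par (closedGen V)).toLinearMap G.lie (Sym.comul (closedGen V) x) :=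
  comul_coderOf (comm_parity_of_deg _ G.taylor_deg) x

theorem GerInf.counit_lie (G : GerInf V) (x : Sym (closedGen V)) :
    Sym.counit (closedGen V) (G.lie x) = 0 := counit_coderOf _ x

theorem GerInf.lie_one (G : GerInf V) : G.lie 1 = 0 :=
  coderOf_one (by rw [LinearMap.comp_apply, LinearMap.comp_apply, toGer_one, map_zero, map_zero])

/-- Both sides are coderivations along the embedding of S(X), with equal Taylor components by the
definition of `lie`. For a root `dot` the coderivation rules reduce the claim to the subtrees; for a
root `br` it holds because δ anticommutes with D and vanishes on the image of S(X). -/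
theorem GerInf.D_toGer_apply (G : GerInf V) (T : Shape) (x : Sym (closedGen V)) :
    (G.D (toGer (closedGen V) x) : Tree (closedGen V)) T =
      treeComponent (closedGen V) T (G.lie x) := by
  induction T generalizing x with
  | leaf => exact (proj_coderOf (GerCofree.proj _ ∘ₗ G.D ∘ₗ toGer _) x).symm
  | br l r =>
    rw [← Tree.component_cobr, G.D_cobr, cobr_toGer, map_zero, neg_zero, map_zero]
    rfl
  | dot l r hl hr =>
    rw [← Tree.component_comul, G.D_comul, comul_toGer]
    change _ = TensorProduct.map (treeComponent _ l) (treeComponent _ r) (Sym.comul _ (G.lie x))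
    rw [G.comul_lie]
    have h1 : ∀ (T : Shape) (y : Sym (closedGen V)), DirectSum.component K Shape
        (fun T => TreePow (closedGen V) T) T (toTree (closedGen V) y) =
          treeComponent (closedGen V) T y := fun T y => toTree_apply _ y T
    have hl' : ∀ y, DirectSum.component K Shape (fun T => TreePow (closedGen V) T) l
        (G.D (toGer (closedGen V) y) : Tree (closedGen V)) = treeComponent _ l (G.lie y) := hl
    have hr' : ∀ y, DirectSum.component K Shape (fun T => TreePow (closedGen V) T) r
        (G.D (toGer (closedGen V) y) : Tree (closedGen V)) = treeComponent _ r (G.lie y) := hr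
    generalize Sym.comul (closedGen V) x = z
    induction z using TensorProduct.induction_on with
    | zero => simp only [map_zero, add_zero]
    | add a b ha hb =>
      simp only [map_add] at ha hb ⊢
      rw [ha, hb]; abel
    | tmul a b =>
      simp only [GerCofree.leibniz, LinearMap.add_apply, TensorProduct.map_tmul,
        LinearMap.comp_apply, Submodule.subtype_apply, coe_toGer, map_add, par_toTree, h1,
        hl', hr', LinearMap.id_apply, AlgHom.toLinearMap_apply]

theorem GerInf.D_toGer (G : GerInf V) (x : Sym (closedGen V)) :
    G.D (toGer (closedGen V) x) = toGer (closedGen V) (G.lie x) :=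
  Subtype.ext (DFinsupp.ext fun T => (G.D_toGer_apply T x).trans (toTree_apply _ _ T).symm)

/-- This is D² = 0 seen through the embedding, which is injective on the kernel of the counit. -/
theorem GerInf.lie_lie (G : GerInf V) (x : Sym (closedGen V)) : G.lie (G.lie x) = 0 := by
  refine eq_of_toGer _ (by rw [G.counit_lie, map_zero]) ?_
  rw [← G.D_toGer, ← G.D_toGer, G.D_sq, map_zero]

end Lie

/-! ### The convolution exponential and coalgebra morphisms to S(Z). -/

section Exp
variable {K : Type u} [Field K] {X : ℤ → ModuleCat.{v} K} {Z : ℤ → ModuleCat.{w} K}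
namespace Sym

/-- The divided convolution powers of a map `ψ : S(X) → Z`. -/
def dpow (ψ : Sym X →ₗ[K] Tot Z) : ℕ → Sym X →ₗ[K] Sym Z
  | 0 => Algebra.linearMap K (Sym Z) ∘ₗ (counit X).toLinearMap
  | n + 1 => (n + 1 : K)⁻¹ • cap ψ (dpow ψ n)

theorem dpow_zero_apply (ψ : Sym X →ₗ[K] Tot Z) (x : Sym X) : dpow ψ 0 x = counit X x • 1 := by
  simp [dpow, Algebra.algebraMap_eq_smul_one]

/-- As ψ vanishes on scalars, each of the n convolution factors uses up at least one letter. This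
makes the exponential series finite on every element. -/
theorem dpow_wt {ψ : Sym X →ₗ[K] Tot Z} (h1 : ψ 1 = 0) {n k : ℕ} (hk : k < n) {x : Sym X}
    (hx : x ∈ wt X k) : dpow ψ n x = 0 := by
  induction n generalizing k x with
  | zero => omega
  | succ n ih =>
    rw [dpow, LinearMap.smul_apply, cap_apply]
    have h2 : ∀ z ∈ Submodule.span K {z | ∃ p q a b, p + q = k ∧ a ∈ wt X p ∧ b ∈ wt X q ∧
        a ⊗ₜ[K] b = z}, TensorProduct.map (ι Z ∘ₗ ψ) (dpow ψ n) z = 0 := by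
      intro z hz
      induction hz using Submodule.span_induction with
      | zero => simp
      | add a b _ _ ha hb => rw [map_add, ha, hb, add_zero]
      | smul c a _ ha => rw [map_smul, ha, smul_zero]
      | mem z hz =>
        obtain ⟨p, q, a, b, hpq, ha, hb, rfl⟩ := hz
        rw [TensorProduct.map_tmul]
        obtain rfl | hp := Nat.eq_zero_or_pos p
        · rw [mem_wt_zero X ha, map_smul, LinearMap.comp_apply, h1, map_zero, smul_zero,
            TensorProduct.zero_tmul]
        · rw [ih (by omega) hb, TensorProduct.tmul_zero]
    rw [h2 _ (comul_wt X hx), map_zero, smul_zero]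

theorem exists_dpow_eq_zero {ψ : Sym X →ₗ[K] Tot Z} (h1 : ψ 1 = 0) (x : Sym X) :
    ∃ N, ∀ n, N ≤ n → dpow ψ n x = 0 := by
  have hx := iSup_wt X x
  induction hx using Submodule.iSup_induction' with
  | mem k x hx => exact ⟨k + 1, fun n hn => dpow_wt h1 hn hx⟩
  | zero => exact ⟨0, by simp⟩
  | add a b _ _ ha hb =>
    obtain ⟨N, hN⟩ := ha
    obtain ⟨M, hM⟩ := hb
    refine ⟨max N M, fun n hn => ?_⟩
    rw [map_add, hN n (le_of_max_le_left hn), hM n (le_of_max_le_right hn), add_zero]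

theorem finite_dpow {ψ : Sym X →ₗ[K] Tot Z} (h1 : ψ 1 = 0) (x : Sym X) :
    (Function.support fun n => dpow ψ n x).Finite := by
  obtain ⟨N, hN⟩ := exists_dpow_eq_zero h1 x
  refine (Finset.finite_toSet (Finset.range N)).subset fun n hn => ?_
  by_contra h
  exact hn (hN n (by simpa using h))

/-- The convolution exponential of a map `ψ : S(X) → Z` with `ψ(1) = 0`: the coalgebra map with
Taylor components `ψ`. -/
def expMap (ψ : Sym X →ₗ[K] Tot Z) (h1 : ψ 1 = 0) : Sym X →ₗ[K] Sym Z where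
  toFun x := ∑ᶠ n, dpow ψ n x
  map_add' x y := by
    simp_rw [map_add]
    exact finsum_add_distrib (finite_dpow h1 x) (finite_dpow h1 y)
  map_smul' c x := by
    simp_rw [map_smul]
    exact (smul_finsum' c (finite_dpow h1 x)).symm

theorem expMap_eq {ψ : Sym X →ₗ[K] Tot Z} (h1 : ψ 1 = 0) {x : Sym X} {N : ℕ}
    (hN : ∀ n, N ≤ n → dpow ψ n x = 0) : expMap ψ h1 x = ∑ n ∈ Finset.range N, dpow ψ n x := by
  refine finsum_eq_sum_of_support_subset _ fun n hn => ?_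
  by_contra h
  exact hn (hN n (by simpa using h))

theorem counit_dpow_succ (ψ : Sym X →ₗ[K] Tot Z) (n : ℕ) (x : Sym X) :
    counit Z (dpow ψ (n + 1) x) = 0 := by
  rw [dpow, LinearMap.smul_apply, map_smul, counit_cap, smul_zero]

theorem counit_expMap {ψ : Sym X →ₗ[K] Tot Z} (h1 : ψ 1 = 0) (x : Sym X) :
    counit Z (expMap ψ h1 x) = counit X x := by
  obtain ⟨N, hN⟩ := exists_dpow_eq_zero h1 x
  rw [expMap_eq h1 (N := N + 1) (fun n hn => hN n (by omega)), map_sum, Finset.sum_range_succ']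
  simp [counit_dpow_succ, dpow_zero_apply]

theorem expMap_one {ψ : Sym X →ₗ[K] Tot Z} (h1 : ψ 1 = 0) : expMap ψ h1 1 = 1 := by
  rw [expMap_eq h1 (N := 1) (fun n hn => dpow_wt h1 hn (one_wt X))]
  simp [dpow_zero_apply]

/-- The n-th divided power is a sum of products of n letters, so only n = 1 has a nonzero projection
to the generators. -/
theorem proj_expMap {ψ : Sym X →ₗ[K] Tot Z} (h1 : ψ 1 = 0) (x : Sym X) :
    proj Z (expMap ψ h1 x) = ψ x := by
  obtain ⟨N, hN⟩ := exists_dpow_eq_zero h1 x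
  -- The bound is raised by two so that the terms with n = 0 and n = 1 can be split off.
  rw [expMap_eq h1 (N := N + 2) (fun n hn => hN n (by omega)), map_sum, Finset.sum_range_succ',
    Finset.sum_range_succ']
  have h2 : ∀ n, proj Z (dpow ψ (n + 1 + 1) x) = 0 := by
    intro n
    have : (counit Z).toLinearMap ∘ₗ dpow ψ (n + 1) = 0 := LinearMap.ext (counit_dpow_succ ψ n)
    rw [dpow, LinearMap.smul_apply, map_smul, proj_cap, this, TensorProduct.map_zero_right]
    simp
  have h3 : proj Z (dpow ψ (0 + 1) x) = ψ x := by
    rw [dpow, LinearMap.smul_apply, map_smul, proj_cap_of_counit]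
    · simp
    · intro x; simp [dpow_zero_apply]
  simp [h2, h3, dpow_zero_apply, proj_one]

theorem dpow_deg {ψ : Sym X →ₗ[K] Tot Z}
    (hψ : ∀ d, ∀ x ∈ deg X d, ψ x ∈ LinearMap.range (inc Z d)) (n : ℕ) (d : ℤ) (x : Sym X)
    (hx : x ∈ deg X d) : dpow ψ n x ∈ deg Z d := by
  induction n generalizing d x with
  | zero =>
    rw [dpow_zero_apply]
    by_cases hd : d = 0
    · subst hd; exact Submodule.smul_mem _ _ (one_deg Z)
    · rw [counit_deg X hd hx, zero_smul]; exact zero_mem _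
  | succ n ih =>
    refine Submodule.smul_mem _ _ ?_
    simpa using cap_deg (s := 0) (t := 0) (fun d x hx => by rw [add_zero]; exact hψ d x hx) (by simpa using ih) d x hx

theorem expMap_deg {ψ : Sym X →ₗ[K] Tot Z} (h1 : ψ 1 = 0)
    (hψ : ∀ d, ∀ x ∈ deg X d, ψ x ∈ LinearMap.range (inc Z d)) (d : ℤ) (x : Sym X)
    (hx : x ∈ deg X d) : expMap ψ h1 x ∈ deg Z d := by
  obtain ⟨N, hN⟩ := exists_dpow_eq_zero h1 x
  rw [expMap_eq h1 hN]
  exact sum_mem fun n _ => dpow_deg hψ n d x hx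

variable [CharZero K]

/-- In the induction step `comul_cap` raises one of the two indices, with coefficient equal to the
raised index. After reindexing over the antidiagonal of n + 1 the coefficients add up to p.1 + p.2 =
n + 1, which cancels the denominator of the divided power. -/
theorem comul_dpow {ψ : Sym X →ₗ[K] Tot Z}
    (hψ : ∀ d, ∀ x ∈ deg X d, ψ x ∈ LinearMap.range (inc Z d)) (n : ℕ) (x : Sym X) :
    comul Z (dpow ψ n x) = ∑ p ∈ Finset.HasAntidiagonal.antidiagonal n,
      TensorProduct.map (dpow ψ p.1) (dpow ψ p.2) (comul X x) := by
  have hcap : ∀ n, cap ψ (dpow ψ n) = (n + 1 : K) • dpow ψ (n + 1) := by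
    intro n
    rw [dpow, smul_smul, mul_inv_cancel₀ (by exact_mod_cast Nat.succ_ne_zero n), one_smul]
  induction n generalizing x with
  | zero =>
    have h : TensorProduct.map (dpow ψ 0) (dpow ψ 0) = TensorProduct.map
        (Algebra.linearMap K (Sym Z)) (dpow ψ 0) ∘ₗ
          TensorProduct.map (counit X).toLinearMap LinearMap.id := by
      rw [← TensorProduct.map_comp]; rfl
    simp [h, map_counit_comul, dpow_zero_apply, comul_one]
  | succ n ih =>
    have h0 : epow (par X).toLinearMap 0 = LinearMap.id := if_pos (by simp)
    have hpar : ∀ (p : ℕ × ℕ) x, (par Z).toLinearMap (dpow ψ p.1 x) =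
        dpow ψ p.1 ((par X).toLinearMap x) := fun p x =>
      (comm_par_of_deg X (s := 0) (by simpa using dpow_deg hψ p.1) x).trans
        (by rw [sgn_zero, one_smul])
    rw [dpow, LinearMap.smul_apply, map_smul, comul_cap (s := 0)
      (comm_parity_of_deg X (fun d x hx => by rw [add_zero]; exact hψ d x hx)) (Finset.HasAntidiagonal.antidiagonal n) hpar ih, h0,
      Finset.sum_add_distrib]
    simp only [hcap, LinearMap.comp_id, TensorProduct.map_smul_left, TensorProduct.map_smul_right,
      LinearMap.smul_apply]
    have h1 := Finset.Nat.sum_antidiagonal_succ (n := n) (f := fun p : ℕ × ℕ =>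
      (p.1 : K) • TensorProduct.map (dpow ψ p.1) (dpow ψ p.2) (comul X x))
    have h2 := Finset.Nat.sum_antidiagonal_succ' (n := n) (f := fun p : ℕ × ℕ =>
      (p.2 : K) • TensorProduct.map (dpow ψ p.1) (dpow ψ p.2) (comul X x))
    simp only [Nat.cast_zero, zero_smul, zero_add, Nat.cast_succ] at h1 h2
    rw [← h1, ← h2, ← Finset.sum_add_distrib, inv_smul_eq_iff₀ (by exact_mod_cast Nat.succ_ne_zero n),
      Finset.smul_sum]
    refine Finset.sum_congr rfl fun p hp => ?_
    rw [← add_smul, ← Nat.cast_add, Finset.HasAntidiagonal.mem_antidiagonal.1 hp, Nat.cast_succ]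

/-- The usual reason for an exponential to be grouplike: the sum over all antidiagonals is the
product of two series. On a given tensor both series are finite, so it suffices to compare
sufficiently long partial sums. -/
theorem comul_expMap {ψ : Sym X →ₗ[K] Tot Z} (h1 : ψ 1 = 0)
    (hψ : ∀ d, ∀ x ∈ deg X d, ψ x ∈ LinearMap.range (inc Z d)) (x : Sym X) :
    comul Z (expMap ψ h1 x) =
      TensorProduct.map (expMap ψ h1) (expMap ψ h1) (comul X x) := by
  have key : ∀ z : Sym X ⊗[K] Sym X, ∃ N, ∀ M, N ≤ M →
      TensorProduct.map (expMap ψ h1) (expMap ψ h1) z = ∑ n ∈ Finset.range M,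
        ∑ p ∈ Finset.HasAntidiagonal.antidiagonal n, TensorProduct.map (dpow ψ p.1) (dpow ψ p.2) z := by
    intro z
    induction z using TensorProduct.induction_on with
    | zero => exact ⟨0, by simp⟩
    | add a b ha hb =>
      obtain ⟨N, hN⟩ := ha
      obtain ⟨N', hN'⟩ := hb
      refine ⟨max N N', fun M hM => ?_⟩
      rw [map_add, hN M (le_of_max_le_left hM), hN' M (le_of_max_le_right hM)]
      simp only [map_add, Finset.sum_add_distrib]
    | tmul a b =>
      obtain ⟨A, hA⟩ := exists_dpow_eq_zero h1 a
      obtain ⟨B, hB⟩ := exists_dpow_eq_zero h1 b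
      -- With M ≥ A + B the inner range M - i contains all nonzero terms at b whenever i < A, while
      -- for i ≥ A the factor at a vanishes.
      refine ⟨A + B, fun M hM => ?_⟩
      simp_rw [TensorProduct.map_tmul, Finset.Nat.sum_antidiagonal_eq_sum_range_succ_mk]
      rw [Finset.sum_range_diag_flip M (fun i j => dpow ψ i a ⊗ₜ[K] dpow ψ j b),
        expMap_eq h1 (x := a) (N := M) (fun n hn => hA n (by omega)), TensorProduct.sum_tmul]
      refine Finset.sum_congr rfl fun i _ => ?_
      by_cases hi : A ≤ i
      · rw [hA i hi]; simp
      · rw [expMap_eq h1 (x := b) (N := M - i) (fun n hn => hB n (by omega)), TensorProduct.tmul_sum]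
  obtain ⟨A, hA⟩ := key (comul X x)
  obtain ⟨B, hB⟩ := exists_dpow_eq_zero h1 x
  rw [hA (max A B) (le_max_left _ _),
    expMap_eq h1 (N := max A B) (fun n hn => hB n (le_of_max_le_right hn)), map_sum]
  exact Finset.sum_congr rfl fun n _ => comul_dpow hψ n x

/-- A morphism of coalgebras to `S(Z)` is determined by its Taylor components. -/
theorem coalgHom_ext {U U' : Sym X →ₗ[K] Sym Z}
    (hc : ∀ x, counit Z (U x) = counit Z (U' x))
    (hU : ∀ x, comul Z (U x) = TensorProduct.map U U (comul X x))
    (hU' : ∀ x, comul Z (U' x) = TensorProduct.map U' U' (comul X x))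
    (hp : ∀ x, proj Z (U x) = proj Z (U' x)) : U = U' := by
  refine LinearMap.ext fun x => eq_of_treeComponent Z (hc x) fun T => ?_
  induction T generalizing x with
  | leaf => exact hp x
  | br l r => rfl
  | dot l r hl hr =>
    change TensorProduct.map (treeComponent Z l) (treeComponent Z r) (comul Z (U x)) =
      TensorProduct.map (treeComponent Z l) (treeComponent Z r) (comul Z (U' x))
    rw [hU, hU', TensorProduct.map_map, TensorProduct.map_map,
      LinearMap.ext (f := treeComponent Z l ∘ₗ U) (g := treeComponent Z l ∘ₗ U') hl,
      LinearMap.ext (f := treeComponent Z r ∘ₗ U) (g := treeComponent Z r ∘ₗ U') hr]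

/-- Compatibility of a morphism of coalgebras with coderivations can be checked on Taylor
components. -/
theorem comm_of_proj {U : Sym X →ₗ[K] Sym Z} {P : Sym X →ₗ[K] Sym X} {R : Sym Z →ₗ[K] Sym Z}
    (hUP : ∀ x, counit Z (U (P x)) = 0) (hR0 : ∀ x, counit Z (R x) = 0)
    (hU : ∀ x, comul Z (U x) = TensorProduct.map U U (comul X x))
    (hUpar : ∀ x, (par Z).toLinearMap (U x) = U ((par X).toLinearMap x))
    (hP : ∀ x, comul X (P x) = TensorProduct.map P LinearMap.id (comul X x) +
      TensorProduct.map (par X).toLinearMap P (comul X x))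
    (hR : ∀ x, comul Z (R x) = TensorProduct.map R LinearMap.id (comul Z x) +
      TensorProduct.map (par Z).toLinearMap R (comul Z x))
    (hp : ∀ x, proj Z (U (P x)) = proj Z (R (U x))) (x : Sym X) : U (P x) = R (U x) := by
  refine eq_of_treeComponent Z (by rw [hUP, hR0]) fun T => ?_
  induction T generalizing x with
  | leaf => exact hp x
  | br l r => rfl
  | dot l r hl hr =>
    change TensorProduct.map (treeComponent Z l) (treeComponent Z r) (comul Z (U (P x))) =
      TensorProduct.map (treeComponent Z l) (treeComponent Z r) (comul Z (R (U x)))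
    -- Both composites are coderivations along U; after Δ they differ only in factors covered by the
    -- induction hypotheses.
    have hl' : treeComponent Z l ∘ₗ U ∘ₗ P = treeComponent Z l ∘ₗ R ∘ₗ U := LinearMap.ext hl
    have hr' : treeComponent Z r ∘ₗ U ∘ₗ P = treeComponent Z r ∘ₗ R ∘ₗ U := LinearMap.ext hr
    have hu : (par Z).toLinearMap ∘ₗ U = U ∘ₗ (par X).toLinearMap := LinearMap.ext hUpar
    rw [hU, hP, hR, hU]
    simp only [map_add, TensorProduct.map_map, LinearMap.comp_id, LinearMap.id_comp, hl', hr', hu]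

end Sym
end Exp

/-! ### The coalgebra T(Y) and its coderivations by insertion. -/

namespace Ten
variable {K : Type u} [Field K] (Y : ℤ → ModuleCat.{w} K)

theorem induct {N : Submodule K (Ten Y)} (h1 : (1 : Ten Y) ∈ N)
    (hm : ∀ (i : ℤ) (v : Y i) (x : Ten Y), x ∈ N → ι Y (inc Y i v) * x ∈ N) (x : Ten Y) :
    x ∈ N := by
  have hm' : ∀ (v : Tot Y) (x : Ten Y), x ∈ N → ι Y v * x ∈ N := by
    intro v x hx
    induction v using DirectSum.induction_on with
    | zero => simp
    | of i v => exact hm i v x hx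
    | add v w hv hw => rw [map_add, add_mul]; exact N.add_mem hv hw
  have key : ∀ y ∈ N, x * y ∈ N := by
    induction x using TensorAlgebra.induction with
    | algebraMap r => intro y hy; simpa [Algebra.algebraMap_eq_smul_one] using N.smul_mem r hy
    | ι v => intro y hy; exact hm' v y hy
    | mul a b ha hb => intro y hy; rw [mul_assoc]; exact ha _ (hb _ hy)
    | add a b ha hb => intro y hy; rw [add_mul]; exact N.add_mem (ha _ hy) (hb _ hy)
  simpa using key 1 h1

theorem ext {M : Type*} [AddCommGroup M] [Module K M] {f g : Ten Y →ₗ[K] M} (h1 : f 1 = g 1)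
    (hm : ∀ (i : ℤ) (v : Y i) (x : Ten Y), f x = g x →
      f (ι Y (inc Y i v) * x) = g (ι Y (inc Y i v) * x)) (x : Ten Y) : f x = g x :=
  induct Y (N := LinearMap.eqLocus f g) h1 hm x

theorem par_ι {i : ℤ} (v : Y i) : par Y (ι Y (inc Y i v)) = sgn K i • ι Y (inc Y i v) := by
  simp [par, ι, parity]

theorem par_par (a : Ten Y) : (par Y).toLinearMap ((par Y).toLinearMap a) = a := by
  refine ext Y (f := (par Y).toLinearMap ∘ₗ (par Y).toLinearMap) (g := LinearMap.id) (by simp)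
    (fun i v x hx => ?_) a
  simp only [LinearMap.comp_apply, AlgHom.toLinearMap_apply, map_mul,
    par_ι, smul_mul_assoc, map_smul, LinearMap.id_apply, smul_smul, sgn_mul_self, one_smul] at hx ⊢
  rw [hx]

theorem isPar_one : IsPar (par Y).toLinearMap 0 (1 : Ten Y) := by simp [IsPar]

theorem isPar_mul {i j : ℤ} {a b : Ten Y} (ha : IsPar (par Y).toLinearMap i a)
    (hb : IsPar (par Y).toLinearMap j b) : IsPar (par Y).toLinearMap (i + j) (a * b) := by
  rw [IsPar, AlgHom.toLinearMap_apply, map_mul]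
  rw [IsPar, AlgHom.toLinearMap_apply] at ha hb
  rw [ha, hb, smul_mul_smul_comm, sgn_add]

theorem isPar_ι {i : ℤ} {v : Tot Y} (hv : IsPar (parity Y) i v) :
    IsPar (par Y).toLinearMap i (ι Y v) := by
  have : (par Y) (ι Y v) = ι Y (parity Y v) := by simp [par, ι]
  rw [IsPar, AlgHom.toLinearMap_apply, this, hv, map_smul]

theorem isPar_deg {d : ℤ} {x : Ten Y} (hx : x ∈ deg Y d) : IsPar (par Y).toLinearMap d x := by
  induction hx using Submodule.span_induction with
  | zero => exact .zero
  | add a b _ _ ha hb => rw [IsPar] at *; rw [map_add, ha, hb, smul_add]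
  | smul c a _ ha => exact ha.smul c
  | mem a ha =>
    obtain ⟨l, rfl, rfl⟩ := ha
    induction l with
    | nil => exact isPar_one Y
    | cons p l ih =>
      simp only [List.map_cons, List.prod_cons, List.sum_cons]
      exact isPar_mul Y (isPar_ι Y (isPar_inc Y _ _)) ih

theorem iSup_deg (x : Ten Y) : x ∈ ⨆ d, deg Y d := by
  refine induct Y (Submodule.mem_iSup_of_mem 0 (one_deg Y)) (fun i v x hx => ?_) x
  induction hx using Submodule.iSup_induction' with
  | mem n x hx => exact Submodule.mem_iSup_of_mem (i + n) (mul_deg Y rfl (ι_deg Y v) hx)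
  | zero => simp
  | add a b _ _ ha hb => rw [mul_add]; exact add_mem ha hb

theorem deg_ext {M : Type*} [AddCommGroup M] [Module K M] {f g : Ten Y →ₗ[K] M}
    (h : ∀ d, ∀ x ∈ deg Y d, f x = g x) (x : Ten Y) : f x = g x := by
  have : (⨆ d, deg Y d) ≤ LinearMap.eqLocus f g := iSup_le fun d x hx => h d x hx
  exact this (iSup_deg Y x)

theorem counit_ι (v : Tot Y) : counit Y (ι Y v) = 0 := by
  simp [counit, ι, TensorAlgebra.algebraMapInv]

theorem proj_ι (v : Tot Y) : proj Y (ι Y v) = v := TensorAlgebra.ι_leftInverse v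

theorem proj_one : proj Y 1 = 0 := by
  -- `proj` is built on the trivial square-zero extension of K by Y; this is the right action used
  -- there, so that `change` below can unfold it.
  let _ : Module Kᵐᵒᵖ (Tot Y) := Module.compHom _ ((RingHom.id K).fromOpposite mul_comm)
  have : IsCentralScalar K (Tot Y) := ⟨fun r m => rfl⟩
  change (TensorAlgebra.toTrivSqZeroExt (1 : Ten Y)).snd = 0
  rw [map_one, TrivSqZeroExt.snd_one]

/-- The counit and the projection are the two components of an algebra map to K ⊕ Y with Y² = 0. -/
theorem proj_mul (a b : Ten Y) :
    proj Y (a * b) = counit Y a • proj Y b + counit Y b • proj Y a := by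
  let _ : Module Kᵐᵒᵖ (Tot Y) := Module.compHom _ ((RingHom.id K).fromOpposite mul_comm)
  have : IsCentralScalar K (Tot Y) := ⟨fun r m => rfl⟩
  have h : ∀ a : Ten Y, (TensorAlgebra.toTrivSqZeroExt a).fst = counit Y a := by
    intro a
    have : (TrivSqZeroExt.fstHom K K (Tot Y)).comp TensorAlgebra.toTrivSqZeroExt = counit Y := by
      refine TensorAlgebra.hom_ext (LinearMap.ext fun v => ?_)
      simp [counit, TensorAlgebra.algebraMapInv]
    exact DFunLike.congr_fun this a
  change (TensorAlgebra.toTrivSqZeroExt (a * b)).snd = _ • (TensorAlgebra.toTrivSqZeroExt b).snd +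
    _ • (TensorAlgebra.toTrivSqZeroExt a).snd
  rw [map_mul, TrivSqZeroExt.snd_mul, h, h, op_smul_eq_smul]

theorem counit_par (x : Ten Y) : counit Y (par Y x) = counit Y x := by
  refine ext Y (f := (counit Y).toLinearMap ∘ₗ (par Y).toLinearMap) (g := (counit Y).toLinearMap)
    (by simp) (fun i v x hx => ?_) x
  simp [par_ι, counit_ι]

theorem counit_epow (i : ℤ) (x : Ten Y) : counit Y (epow (par Y).toLinearMap i x) = counit Y x := by
  unfold epow; split_ifs
  · rfl
  · exact counit_par Y x

theorem map_counit_comul (x : Ten Y) :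
    TensorProduct.map (counit Y).toLinearMap LinearMap.id (comul Y x) = 1 ⊗ₜ x := by
  refine ext Y (f := TensorProduct.map (counit Y).toLinearMap LinearMap.id ∘ₗ comul Y)
    (g := TensorProduct.mk K K (Ten Y) 1) (by simp [comul_one]) (fun i v x hx => ?_) x
  have h : (counit Y).toLinearMap ∘ₗ LinearMap.mulLeft K (ι Y (inc Y i v)) = 0 := by
    ext; simp [counit_ι]
  simp [comul_mul, TensorProduct.map_map, h]

theorem map_counit_comul' (x : Ten Y) :
    TensorProduct.map LinearMap.id (counit Y).toLinearMap (comul Y x) = x ⊗ₜ 1 := by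
  refine ext Y (f := TensorProduct.map LinearMap.id (counit Y).toLinearMap ∘ₗ comul Y)
    (g := (TensorProduct.mk K (Ten Y) K).flip 1) (by simp [comul_one]) (fun i v x hx => ?_) x
  simp only [LinearMap.comp_apply, LinearMap.flip_apply, TensorProduct.mk_apply] at hx ⊢
  have h := congrArg (TensorProduct.map (LinearMap.mulLeft K (ι Y (inc Y i v))) LinearMap.id) hx
  rw [TensorProduct.map_map, LinearMap.comp_id, LinearMap.id_comp, TensorProduct.map_tmul,
    LinearMap.mulLeft_apply, LinearMap.id_apply] at h
  rw [comul_mul, map_add, TensorProduct.map_map, LinearMap.comp_id, LinearMap.id_comp, h]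
  simp [counit_ι]

/-- An element of `T(Y)` is determined by its counit and by `(proj ⊗ 1) Δ`. -/
theorem eq_counit_add (x : Ten Y) : x = counit Y x • 1 +
    LinearMap.mul' K _ (TensorProduct.map (ι Y ∘ₗ proj Y) LinearMap.id (comul Y x)) := by
  refine ext Y (f := LinearMap.id) (g := (counit Y).toLinearMap.smulRight 1 + LinearMap.mul' K _ ∘ₗ
    TensorProduct.map (ι Y ∘ₗ proj Y) LinearMap.id ∘ₗ comul Y)
    (by simp [comul_one, proj_one]) (fun i v x hx => ?_) x
  have h : (ι Y ∘ₗ proj Y) ∘ₗ LinearMap.mulLeft K (ι Y (inc Y i v)) =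
      LinearMap.toSpanSingleton K _ (ι Y (inc Y i v)) ∘ₗ (counit Y).toLinearMap := by
    ext a; simp [proj_mul, counit_ι, proj_ι]
  simp only [LinearMap.id_apply, LinearMap.add_apply, LinearMap.smulRight_apply,
    AlgHom.toLinearMap_apply, map_mul, counit_ι, zero_mul, zero_smul, zero_add,
    LinearMap.comp_apply, comul_mul, map_add, TensorProduct.map_tmul, proj_one, map_zero,
    TensorProduct.zero_tmul, TensorProduct.map_map, h, LinearMap.comp_id]
  rw [← LinearMap.comp_id LinearMap.id, TensorProduct.map_comp, LinearMap.comp_apply,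
    map_counit_comul]
  simp

/-- Recursion for the insertion into a product. -/
theorem insPrefix_apply (f : Ten Y →ₗ[K] Tot Y) (x : Ten Y) : insPrefix Y f x =
    LinearMap.mul' K (Ten Y) (TensorProduct.map (ι Y ∘ₗ f) LinearMap.id (comul Y x)) := rfl

theorem ins_apply (k : ℤ) (f : Ten Y →ₗ[K] Tot Y) (x : Ten Y) : ins Y k f x =
    LinearMap.mul' K (Ten Y)
      (TensorProduct.map (epow (par Y).toLinearMap (k - 1)) (insPrefix Y f) (comul Y x)) := rfl

theorem epow_one (i : ℤ) : epow (par Y).toLinearMap i 1 = 1 := by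
  unfold epow; split_ifs <;> simp

theorem ins_one (k : ℤ) (f : Ten Y →ₗ[K] Tot Y) : ins Y k f 1 = ι Y (f 1) := by
  simp [ins_apply, insPrefix_apply, comul_one, epow_one]

theorem insPrefix_one (f : Ten Y →ₗ[K] Tot Y) : insPrefix Y f 1 = ι Y (f 1) := by
  simp [insPrefix_apply, comul_one]

theorem epow_mul (i j : ℤ) (y : Y j) (a : Ten Y) :
    epow (par Y).toLinearMap i (ι Y (inc Y j y) * a) =
      sgn K (i * j) • (ι Y (inc Y j y) * epow (par Y).toLinearMap i a) := by
  have h : ∀ a b : Ten Y, epow (par Y).toLinearMap i (a * b) =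
      epow (par Y).toLinearMap i a * epow (par Y).toLinearMap i b := by
    intro a b; unfold epow; split_ifs <;> simp
  rw [h, (isPar_ι Y (isPar_inc Y j y)).epow, smul_mul_assoc]

/-- An insertion starts either at the front of the word or behind v; the latter costs the Koszul
sign of f and v. -/
theorem ins_mul (k : ℤ) (f : Ten Y →ₗ[K] Tot Y) (i : ℤ) (v : Y i) (x : Ten Y) :
    ins Y k f (ι Y (inc Y i v) * x) = insPrefix Y f (ι Y (inc Y i v) * x) +
      sgn K ((k - 1) * i) • (ι Y (inc Y i v) * ins Y k f x) := by
  rw [ins_apply, comul_mul, map_add, map_add, TensorProduct.map_tmul, epow_one,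
    LinearMap.mul'_apply, one_mul, ins_apply]
  congr 1
  generalize comul Y x = z
  induction z using TensorProduct.induction_on with
  | zero => simp
  | add a b ha hb => simp only [map_add, ha, hb, mul_add, smul_add]
  | tmul a b =>
    simp only [TensorProduct.map_tmul, LinearMap.mulLeft_apply, LinearMap.id_apply, epow_mul,
      LinearMap.mul'_apply, smul_mul_assoc, mul_assoc]

theorem comul_coassoc (x : Ten Y) :
    TensorProduct.assoc K _ _ _ (TensorProduct.map (comul Y) LinearMap.id (comul Y x)) =
      TensorProduct.map LinearMap.id (comul Y) (comul Y x) := by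
  refine ext Y (f := (TensorProduct.assoc K _ _ _).toLinearMap ∘ₗ
      TensorProduct.map (comul Y) LinearMap.id ∘ₗ comul Y)
      (g := TensorProduct.map LinearMap.id (comul Y) ∘ₗ comul Y) ?_ (fun i v x hx => ?_) x
  · simp [comul_one]
  · simp only [LinearMap.comp_apply, LinearEquiv.coe_coe] at hx ⊢
    have h1 : ∀ z : Ten Y ⊗[K] Ten Y, TensorProduct.assoc K _ _ _
        (TensorProduct.map (comul Y) LinearMap.id
          (TensorProduct.map (LinearMap.mulLeft K (ι Y (inc Y i v))) LinearMap.id z)) =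
        1 ⊗ₜ TensorProduct.map (LinearMap.mulLeft K (ι Y (inc Y i v))) LinearMap.id z +
        TensorProduct.map (LinearMap.mulLeft K (ι Y (inc Y i v))) LinearMap.id
          (TensorProduct.assoc K _ _ _ (TensorProduct.map (comul Y) LinearMap.id z)) := by
      intro z
      induction z using TensorProduct.induction_on with
      | zero => simp
      | add a b ha hb => simp only [map_add, TensorProduct.tmul_add, ha, hb]; abel
      | tmul a b =>
        simp only [TensorProduct.map_tmul, LinearMap.mulLeft_apply, LinearMap.id_apply, comul_mul,
          TensorProduct.add_tmul, map_add, TensorProduct.assoc_tmul]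
        congr 1
        generalize comul Y a = w
        induction w using TensorProduct.induction_on with
        | zero => simp
        | add p q hp hq => simp only [map_add, TensorProduct.add_tmul, hp, hq]
        | tmul p q => simp
    rw [comul_mul, map_add, map_add, map_add, h1, hx]
    simp only [TensorProduct.map_tmul, LinearMap.id_apply, comul_one, TensorProduct.assoc_tmul,
      comul_mul, TensorProduct.tmul_add, TensorProduct.map_map, LinearMap.comp_id,
      LinearMap.id_comp]
    abel

/-- The word f(x')x'' is cut either before the inserted letter or somewhere after it.
Coassociativity identifies the cuts of the second kind with insertions into the left factor. -/
theorem comul_insPrefix (f : Ten Y →ₗ[K] Tot Y) (x : Ten Y) :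
    comul Y (insPrefix Y f x) = 1 ⊗ₜ insPrefix Y f x +
      TensorProduct.map (insPrefix Y f) LinearMap.id (comul Y x) := by
  have h1 : ∀ z : Ten Y ⊗[K] Ten Y, comul Y (LinearMap.mul' K (Ten Y)
        (TensorProduct.map (ι Y ∘ₗ f) LinearMap.id z)) =
      1 ⊗ₜ LinearMap.mul' K (Ten Y) (TensorProduct.map (ι Y ∘ₗ f) LinearMap.id z) +
      TensorProduct.map (LinearMap.mul' K (Ten Y) ∘ₗ TensorProduct.map (ι Y ∘ₗ f) LinearMap.id)
        LinearMap.id ((TensorProduct.assoc K _ _ _).symm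
          (TensorProduct.map LinearMap.id (comul Y) z)) := by
    intro z
    induction z using TensorProduct.induction_on with
    | zero => simp
    | add a b ha hb => simp only [map_add, TensorProduct.tmul_add, ha, hb]; abel
    | tmul a b =>
      simp only [TensorProduct.map_tmul, LinearMap.comp_apply, LinearMap.id_apply,
        LinearMap.mul'_apply, comul_mul]
      congr 1
      generalize comul Y b = w
      induction w using TensorProduct.induction_on with
      | zero => simp
      | add p q hp hq => simp only [map_add, TensorProduct.tmul_add, hp, hq]
      | tmul p q => simp
  rw [insPrefix_apply, h1, ← comul_coassoc, LinearEquiv.symm_apply_apply, TensorProduct.map_map]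
  rfl

/-- The insertion of a cochain is a coderivation. -/
theorem comul_ins (k : ℤ) (f : Ten Y →ₗ[K] Tot Y) (x : Ten Y) :
    comul Y (ins Y k f x) = TensorProduct.map (ins Y k f) LinearMap.id (comul Y x) +
      TensorProduct.map (epow (par Y).toLinearMap (k - 1)) (ins Y k f) (comul Y x) := by
  refine ext Y (f := comul Y ∘ₗ ins Y k f)
    (g := TensorProduct.map (ins Y k f) LinearMap.id ∘ₗ comul Y +
      TensorProduct.map (epow (par Y).toLinearMap (k - 1)) (ins Y k f) ∘ₗ comul Y)
      ?_ (fun i v x hx => ?_) x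
  · simp only [LinearMap.comp_apply, LinearMap.add_apply, ins_one, comul_one,
      TensorProduct.map_tmul, epow_one, LinearMap.id_apply]
    have := comul_mul Y (f 1) 1
    rw [mul_one] at this
    rw [this, comul_one]
    simp [add_comm]
  · simp only [LinearMap.comp_apply, LinearMap.add_apply] at hx ⊢
    have h1 : ∀ z : Ten Y ⊗[K] Ten Y, TensorProduct.map (ins Y k f) LinearMap.id
          (TensorProduct.map (LinearMap.mulLeft K (ι Y (inc Y i v))) LinearMap.id z) =
        TensorProduct.map (insPrefix Y f) LinearMap.id
          (TensorProduct.map (LinearMap.mulLeft K (ι Y (inc Y i v))) LinearMap.id z) +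
        sgn K ((k - 1) * i) • TensorProduct.map (LinearMap.mulLeft K (ι Y (inc Y i v)))
          LinearMap.id (TensorProduct.map (ins Y k f) LinearMap.id z) := by
      intro z
      induction z using TensorProduct.induction_on with
      | zero => simp
      | add a b ha hb => simp only [map_add, smul_add, ha, hb]; abel
      | tmul a b => simp [ins_mul, TensorProduct.add_tmul, TensorProduct.smul_tmul']
    have h2 : ∀ z : Ten Y ⊗[K] Ten Y,
        TensorProduct.map (epow (par Y).toLinearMap (k - 1)) (ins Y k f)
          (TensorProduct.map (LinearMap.mulLeft K (ι Y (inc Y i v))) LinearMap.id z) =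
        sgn K ((k - 1) * i) • TensorProduct.map (LinearMap.mulLeft K (ι Y (inc Y i v)))
          LinearMap.id (TensorProduct.map (epow (par Y).toLinearMap (k - 1)) (ins Y k f) z) := by
      intro z
      induction z using TensorProduct.induction_on with
      | zero => simp
      | add a b ha hb => simp only [map_add, smul_add, ha, hb]
      | tmul a b => simp [epow_mul, TensorProduct.smul_tmul']
    -- Insertions at the front and cuts before the first letter match directly; the other terms are
    -- the induction hypothesis multiplied by v.
    rw [ins_mul, map_add, map_smul, comul_mul Y _ (ins Y k f x), hx, comul_insPrefix, comul_mul,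
      map_add, map_add, map_add, map_add, h1, h2]
    simp only [smul_add, TensorProduct.map_tmul, LinearMap.id_apply, epow_one, ins_one,
      insPrefix_one, ins_mul, TensorProduct.tmul_add, TensorProduct.tmul_smul]
    abel

theorem counit_insPrefix (f : Ten Y →ₗ[K] Tot Y) (x : Ten Y) : counit Y (insPrefix Y f x) = 0 := by
  rw [insPrefix_apply]
  generalize comul Y x = z
  induction z using TensorProduct.induction_on with
  | zero => simp
  | add a b ha hb => simp only [map_add, ha, hb, add_zero]
  | tmul a b => simp [counit_ι]

theorem proj_insPrefix (f : Ten Y →ₗ[K] Tot Y) (x : Ten Y) : proj Y (insPrefix Y f x) = f x := by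
  have : ∀ z, proj Y (LinearMap.mul' K (Ten Y) (TensorProduct.map (ι Y ∘ₗ f) LinearMap.id z)) =
      TensorProduct.rid K _ (TensorProduct.map f LinearMap.id
        (TensorProduct.map LinearMap.id (counit Y).toLinearMap z)) := by
    intro z
    induction z using TensorProduct.induction_on with
    | zero => simp
    | add a b ha hb => simp only [map_add, ha, hb]
    | tmul a b => simp [proj_mul, counit_ι, proj_ι]
  rw [insPrefix_apply, this, map_counit_comul']
  simp

theorem counit_ins (k : ℤ) (f : Ten Y →ₗ[K] Tot Y) (x : Ten Y) : counit Y (ins Y k f x) = 0 := by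
  rw [ins_apply]
  generalize comul Y x = z
  induction z using TensorProduct.induction_on with
  | zero => simp
  | add a b ha hb => simp only [map_add, ha, hb, add_zero]
  | tmul a b => simp [counit_insPrefix]

/-- The result is a single letter only when f takes the whole word. Thus the coderivation remembers
the cochain. -/
theorem proj_ins (k : ℤ) (f : Ten Y →ₗ[K] Tot Y) (x : Ten Y) : proj Y (ins Y k f x) = f x := by
  have : ∀ z, proj Y (LinearMap.mul' K (Ten Y)
      (TensorProduct.map (epow (par Y).toLinearMap (k - 1)) (insPrefix Y f) z)) =
      TensorProduct.lid K _ (TensorProduct.map LinearMap.id f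
        (TensorProduct.map (counit Y).toLinearMap LinearMap.id z)) := by
    intro z
    induction z using TensorProduct.induction_on with
    | zero => simp
    | add a b ha hb => simp only [map_add, ha, hb]
    | tmul a b => simp [proj_mul, counit_insPrefix, proj_insPrefix, counit_epow]
  rw [ins_apply, this, map_counit_comul]
  simp

end Ten

/-! ### Finite sums of Hochschild cochains acting as coderivations. -/

section Hoch
variable {K : Type u} [Field K] (Y : ℤ → ModuleCat.{w} K)

/-- The coderivations of `T(Y)` given by the Hochschild cochains. -/
def hochIns : Tot (hoch Y) →ₗ[K] Ten Y →ₗ[K] Ten Y :=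
  DirectSum.toModule K ℤ _ fun i => ins Y (i + 2) ∘ₗ (cochain Y (i + 2)).subtype

theorem hochIns_inc (i : ℤ) (f : cochain Y (i + 2)) :
    hochIns Y (inc (hoch Y) i f) = ins Y (i + 2) f.1 := by
  simp [hochIns]

theorem hochEval_inc (i : ℤ) (f : cochain Y (i + 2)) :
    hochEval Y (inc (hoch Y) i f) = f.1 := by
  simp [hochEval]

theorem proj_hochIns (f : Tot (hoch Y)) (x : Ten Y) :
    Ten.proj Y (hochIns Y f x) = hochEval Y f x := by
  induction f using DirectSum.induction_on with
  | zero => simp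
  | add a b ha hb => rw [map_add, map_add, LinearMap.add_apply, LinearMap.add_apply, map_add, ha, hb]
  | of i f =>
    change Ten.proj Y (hochIns Y (inc (hoch Y) i f) x) = hochEval Y (inc (hoch Y) i f) x
    rw [hochIns_inc, hochEval_inc, Ten.proj_ins]

theorem counit_hochIns (f : Tot (hoch Y)) (x : Ten Y) : Ten.counit Y (hochIns Y f x) = 0 := by
  induction f using DirectSum.induction_on with
  | zero => simp
  | add a b ha hb => rw [map_add, LinearMap.add_apply, map_add, ha, hb, add_zero]
  | of i f =>
    change Ten.counit Y (hochIns Y (inc (hoch Y) i f) x) = 0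
    rw [hochIns_inc, Ten.counit_ins]

/-- The index i in s^{-2}C(A, A) means total degree i + 2, and hence degree i + 1 as an operator on
T(Y). -/
theorem hochIns_deg {i : ℤ} {f : Tot (hoch Y)} (hf : f ∈ LinearMap.range (inc (hoch Y) i))
    {d : ℤ} {x : Ten Y} (hx : x ∈ Ten.deg Y d) : hochIns Y f x ∈ Ten.deg Y (d + (i + 1)) := by
  obtain ⟨f, rfl⟩ := hf
  rw [hochIns_inc]
  have := ins_deg Y f.2 d x hx
  rwa [show i + 2 - 1 = i + 1 by ring] at this

variable [CharZero K]

/-- The sign operator depends only on a parity, so `isPar_ext` reduces to one homogeneous cochain,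
where `Ten.comul_ins` applies. -/
theorem comul_hochIns {i : ℤ} {f : Tot (hoch Y)} (hf : IsPar (parity (hoch Y)) i f) (x : Ten Y) :
    Ten.comul Y (hochIns Y f x) =
      TensorProduct.map (hochIns Y f) LinearMap.id (Ten.comul Y x) +
      TensorProduct.map (epow (Ten.par Y).toLinearMap (i + 1)) (hochIns Y f) (Ten.comul Y x) := by
  refine isPar_ext (hoch Y) (i := i) (f := Ten.comul Y ∘ₗ (hochIns Y).flip x)
    (g := ((TensorProduct.mapBilinear (RingHom.id K) _ _ _ _).flip LinearMap.id ∘ₗ hochIns Y).flip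
        (Ten.comul Y x) +
      (TensorProduct.mapBilinear (RingHom.id K) _ _ _ _ (epow (Ten.par Y).toLinearMap (i + 1)) ∘ₗ
        hochIns Y).flip (Ten.comul Y x)) (fun j g hij => ?_) hf
  have : epow (Ten.par Y).toLinearMap (i + 1) = epow (Ten.par Y).toLinearMap (j + 2 - 1) := by
    have : Even (i + 1) ↔ Even (j + 2 - 1) := by
      obtain ⟨m, hm⟩ := hij
      exact ⟨fun ⟨n, hn⟩ => ⟨n - m, by omega⟩, fun ⟨n, hn⟩ => ⟨n + m, by omega⟩⟩
    simp only [epow, this]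
  simp only [LinearMap.comp_apply, LinearMap.add_apply, LinearMap.flip_apply,
    TensorProduct.mapBilinear_apply, this]
  rw [hochIns_inc]
  exact Ten.comul_ins Y (j + 2) g.1 x

theorem par_hochIns {i : ℤ} {f : Tot (hoch Y)} (hf : IsPar (parity (hoch Y)) i f) {d : ℤ}
    {x : Ten Y} (hx : IsPar (Ten.par Y).toLinearMap d x) :
    IsPar (Ten.par Y).toLinearMap (d + (i + 1)) (hochIns Y f x) := by
  have h1 : ∀ x, (Ten.par Y).toLinearMap (hochIns Y f x) =
      sgn K (i + 1) • hochIns Y f ((Ten.par Y).toLinearMap x) := by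
    intro x
    refine isPar_ext (hoch Y) (i := i) (f := (Ten.par Y).toLinearMap ∘ₗ (hochIns Y).flip x)
      (g := sgn K (i + 1) • (hochIns Y).flip ((Ten.par Y).toLinearMap x)) (fun j g hij => ?_) hf
    simp only [LinearMap.comp_apply, LinearMap.flip_apply, LinearMap.smul_apply]
    refine Ten.deg_ext Y (f := (Ten.par Y).toLinearMap ∘ₗ hochIns Y (inc (hoch Y) j g))
      (g := sgn K (i + 1) • hochIns Y (inc (hoch Y) j g) ∘ₗ (Ten.par Y).toLinearMap)
      (fun d x hx => ?_) x
    rw [LinearMap.comp_apply, Ten.isPar_deg Y (hochIns_deg Y ⟨g, rfl⟩ hx), LinearMap.smul_apply,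
      LinearMap.comp_apply, Ten.isPar_deg Y hx, map_smul, smul_smul, ← sgn_add]
    congr 1
    refine sgn_congr ?_
    obtain ⟨m, hm⟩ := hij
    exact ⟨-m, by omega⟩
  exact IsPar.map h1 hx

end Hoch

section Shuffle
variable {K : Type u} [Field K] {M N P P' : Type*} [AddCommGroup M] [Module K M]
  [AddCommGroup N] [Module K N] [AddCommGroup P] [Module K P] [AddCommGroup P'] [Module K P']

/-- The Koszul flip of the two middle factors. -/
def shuf (e : N →ₗ[K] N) (f : P →ₗ[K] P) :
    (M ⊗[K] N) ⊗[K] (P ⊗[K] P') →ₗ[K] (M ⊗[K] P) ⊗[K] (N ⊗[K] P') :=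
  (TensorProduct.tensorTensorTensorComm K M N P P').toLinearMap ∘ₗ
    twist (TensorProduct.map LinearMap.id e) (TensorProduct.map f LinearMap.id)

theorem IsPar.shuf [CharZero K] {e : N →ₗ[K] N} {f : P →ₗ[K] P} {i j : ℤ} {y : N} {z : P}
    (hy : IsPar e i y) (hz : IsPar f j z) (x : M) (t : P') :
    shuf e f ((x ⊗ₜ[K] y) ⊗ₜ[K] (z ⊗ₜ[K] t)) =
      sgn K (i * j) • (x ⊗ₜ[K] z) ⊗ₜ[K] (y ⊗ₜ[K] t) := by
  have h1 : IsPar (TensorProduct.map LinearMap.id e) i (x ⊗ₜ[K] y) := by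
    rw [IsPar, TensorProduct.map_tmul, hy, TensorProduct.tmul_smul, LinearMap.id_apply]
  have h2 : IsPar (TensorProduct.map f LinearMap.id) j (z ⊗ₜ[K] t) := by
    rw [IsPar, TensorProduct.map_tmul, hz, TensorProduct.smul_tmul', LinearMap.id_apply]
  rw [GerPlus.shuf, LinearMap.comp_apply, h1.twist h2, map_smul]
  rfl

end Shuffle

/-! ### Coderivations of S(X) ⊗ T(Y): uniqueness. -/

namespace OpenC
variable {K : Type u} [Field K] (X : ℤ → ModuleCat.{v} K) (Y : ℤ → ModuleCat.{w} K)

/-- The projection to `S(X)`. -/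
def prS : OpenC X Y →ₗ[K] Sym X :=
  (TensorProduct.rid K (Sym X)).toLinearMap ∘ₗ
    TensorProduct.map LinearMap.id (Ten.counit Y).toLinearMap

/-- The projection to `T(Y)`. -/
def prT : OpenC X Y →ₗ[K] Ten Y :=
  (TensorProduct.lid K (Ten Y)).toLinearMap ∘ₗ
    TensorProduct.map (Sym.counit X).toLinearMap LinearMap.id

@[simp] theorem prS_tmul (x : Sym X) (t : Ten Y) : prS X Y (x ⊗ₜ t) = Ten.counit Y t • x := by
  simp [prS]

@[simp] theorem prT_tmul (x : Sym X) (t : Ten Y) : prT X Y (x ⊗ₜ t) = Sym.counit X x • t := by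
  simp [prT]

theorem proj_eq (z : OpenC X Y) : proj X Y z = Ten.proj Y (prT X Y z) := by
  induction z using TensorProduct.induction_on with
  | zero => simp
  | add a b ha hb => simp only [map_add, ha, hb]
  | tmul a b => simp [proj]

theorem counit_eq_prS (z : OpenC X Y) : counit X Y z = Sym.counit X (prS X Y z) := by
  induction z using TensorProduct.induction_on with
  | zero => simp
  | add a b ha hb => simp only [map_add, ha, hb]
  | tmul a b => simp [counit, mul_comm]

theorem counit_eq_prT (z : OpenC X Y) : counit X Y z = Ten.counit Y (prT X Y z) := by
  induction z using TensorProduct.induction_on with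
  | zero => simp
  | add a b ha hb => simp only [map_add, ha, hb]
  | tmul a b => simp [counit]

theorem rho_eq [CharZero K] (z : OpenC X Y) : rho X Y z = Sym.toGer X (prS X Y z) := by
  induction z using TensorProduct.induction_on with
  | zero => simp
  | add a b ha hb => simp only [map_add, ha, hb]
  | tmul a b => simp [rho]

theorem par_par (z : OpenC X Y) : par X Y (par X Y z) = z :=
  map_map_self (Sym.par_par' X) (Ten.par_par Y) z

theorem isPar_tmul {i j : ℤ} {x : Sym X} {t : Ten Y} (hx : IsPar (Sym.par X).toLinearMap i x)
    (ht : IsPar (Ten.par Y).toLinearMap j t) : IsPar (par X Y) (i + j) (x ⊗ₜ t) := hx.tmul ht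

theorem comul_tmul (x : Sym X) (t : Ten Y) : comul X Y (x ⊗ₜ t) =
    shuf (Sym.par X).toLinearMap (Ten.par Y).toLinearMap (Sym.comul X x ⊗ₜ Ten.comul Y t) := rfl

/-- The counit vanishes on odd elements, the only ones for which the sign can be -1. -/
theorem _root_.GerPlus.Sym.sgn_smul_counit {i : ℤ} {x : Sym X}
    (hx : IsPar (Sym.par X).toLinearMap i x) (j : ℤ) :
    sgn K (i * j) * Sym.counit X x = Sym.counit X x := by
  rw [mul_comm i j, ← smul_eq_mul, ← map_smul, ← hx.epow, Sym.counit_epow]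

theorem _root_.GerPlus.Ten.sgn_smul_counit {i : ℤ} {x : Ten Y}
    (hx : IsPar (Ten.par Y).toLinearMap i x) (j : ℤ) :
    sgn K (i * j) * Ten.counit Y x = Ten.counit Y x := by
  rw [mul_comm i j, ← smul_eq_mul, ← map_smul, ← hx.epow, Ten.counit_epow]

section
variable [CharZero K]

/-- Induction for statements on `(S ⊗ S) ⊗ (T ⊗ T)`. -/
theorem tmul_shuf_induction {p : Sym X ⊗[K] Sym X → Ten Y ⊗[K] Ten Y → Prop}
    (h1 : ∀ z z' y, p z y → p z' y → p (z + z') y) (h2 : ∀ z y y', p z y → p z y' → p z (y + y'))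
    (h : ∀ i j k l a b c d, IsPar (Sym.par X).toLinearMap i a → IsPar (Sym.par X).toLinearMap j b →
      IsPar (Ten.par Y).toLinearMap k c → IsPar (Ten.par Y).toLinearMap l d →
      p (a ⊗ₜ b) (c ⊗ₜ d)) (z : Sym X ⊗[K] Sym X) (y : Ten Y ⊗[K] Ten Y) : p z y := by
  refine tmul_par_induction (Sym.par_par' X) (Sym.par_par' X) (p := fun z => p z y)
    (fun z z' => h1 z z' y) (fun i j a b ha hb => ?_) z
  exact tmul_par_induction (Ten.par_par Y) (Ten.par_par Y) (p := p (a ⊗ₜ b))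
    (fun y y' => h2 _ y y') (fun k l c d hc hd => h i j k l a b c d ha hb hc hd) y

/-- The counits hit the two inner factors of the comultiplication, exactly those that the Koszul
sign involves; so the sign disappears. It follows that a map to S(X) ⊗ T(Y) can be controlled
through the two projections. -/
theorem map_prS_prT_comul (z : OpenC X Y) :
    TensorProduct.map (prS X Y) (prT X Y) (comul X Y z) = z := by
  have h : ∀ w u, TensorProduct.map (prS X Y) (prT X Y)
      (shuf (Sym.par X).toLinearMap (Ten.par Y).toLinearMap (w ⊗ₜ u)) =
      TensorProduct.rid K _ (TensorProduct.map LinearMap.id (Sym.counit X).toLinearMap w) ⊗ₜ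
      TensorProduct.lid K _ (TensorProduct.map (Ten.counit Y).toLinearMap LinearMap.id u) := by
    refine tmul_shuf_induction X Y (fun z z' y hz hz' => ?_) (fun z y y' hy hy' => ?_)
      (fun i j k l a b c d ha hb hc hd => ?_)
    · simp only [TensorProduct.add_tmul, map_add, hz, hz']
    · simp only [TensorProduct.tmul_add, map_add, hy, hy']
    · rw [hb.shuf hc]
      simp only [map_smul, TensorProduct.map_tmul, prS_tmul, prT_tmul, TensorProduct.smul_tmul_smul,
        LinearMap.id_apply, TensorProduct.rid_tmul, TensorProduct.lid_tmul,
        AlgHom.toLinearMap_apply, smul_smul]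
      congr 1
      linear_combination Ten.counit Y c * Sym.sgn_smul_counit X hb k
  induction z using TensorProduct.induction_on with
  | zero => simp
  | add a b ha hb => rw [map_add, map_add, ha, hb]
  | tmul x t =>
    rw [comul_tmul, h, Sym.map_counit_comul', Ten.map_counit_comul]
    simp

theorem comul_prT (z : OpenC X Y) :
    Ten.comul Y (prT X Y z) = TensorProduct.map (prT X Y) (prT X Y) (comul X Y z) := by
  have h : ∀ w u, TensorProduct.map (prT X Y) (prT X Y)
      (shuf (Sym.par X).toLinearMap (Ten.par Y).toLinearMap (w ⊗ₜ u)) =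
      TensorProduct.rid K _ (TensorProduct.map (Sym.counit X).toLinearMap
        (Sym.counit X).toLinearMap w) • u := by
    refine tmul_shuf_induction X Y (fun z z' y hz hz' => ?_) (fun z y y' hy hy' => ?_)
      (fun i j k l a b c d ha hb hc hd => ?_)
    · simp only [TensorProduct.add_tmul, map_add, hz, hz', add_smul]
    · simp only [TensorProduct.tmul_add, map_add, hy, hy', smul_add]
    · rw [hb.shuf hc]
      simp only [map_smul, TensorProduct.map_tmul, prT_tmul, TensorProduct.smul_tmul_smul,
        TensorProduct.rid_tmul, AlgHom.toLinearMap_apply, smul_smul, smul_eq_mul]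
      congr 1
      linear_combination Sym.counit X a * Sym.sgn_smul_counit X hb k
  induction z using TensorProduct.induction_on with
  | zero => simp
  | add a b ha hb => simp only [map_add, ha, hb]
  | tmul x t =>
    rw [comul_tmul, h, prT_tmul, map_smul]
    congr 1
    have h1 : ∀ w : Sym X ⊗[K] Sym X, TensorProduct.map (Sym.counit X).toLinearMap
        (Sym.counit X).toLinearMap w = TensorProduct.map LinearMap.id (Sym.counit X).toLinearMap
          (TensorProduct.map (Sym.counit X).toLinearMap LinearMap.id w) := fun w => by
      rw [TensorProduct.map_map, LinearMap.comp_id, LinearMap.id_comp]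
    rw [h1, Sym.map_counit_comul]
    simp

/-- A coderivation of `S(X) ⊗ T(Y)` with zero projections to `S(X)` and to `Y` vanishes. -/
theorem eq_zero_of_proj {R : OpenC X Y →ₗ[K] OpenC X Y} (i : ℤ)
    (hR : ∀ z, comul X Y (R z) = TensorProduct.map R LinearMap.id (comul X Y z) +
      TensorProduct.map (epow (par X Y) i) R (comul X Y z))
    (hS : ∀ z, prS X Y (R z) = 0) (hp : ∀ z, proj X Y (R z) = 0) : R = 0 := by
  have hS' : prS X Y ∘ₗ R = 0 := LinearMap.ext hS
  have hp' : Ten.proj Y ∘ₗ prT X Y ∘ₗ R = 0 := LinearMap.ext fun z => by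
    rw [LinearMap.comp_apply, LinearMap.comp_apply, ← proj_eq, hp]; rfl
  -- By `Ten.eq_counit_add` an element of T(Y) is its counit plus its first letters times the
  -- remainders. Here the counit vanishes since the projection to S(X) does, and the terms with R on
  -- the left have first letter zero.
  have h1 : ∀ z, prT X Y (R z) = LinearMap.mul' K _ (TensorProduct.map (Ten.ι Y) LinearMap.id
      (TensorProduct.map (Ten.proj Y ∘ₗ prT X Y ∘ₗ epow (par X Y) i) (prT X Y ∘ₗ R)
        (comul X Y z))) := by
    intro z
    rw [Ten.eq_counit_add Y (prT X Y (R z)), ← counit_eq_prT, counit_eq_prS, hS, map_zero, zero_smul,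
      zero_add, comul_prT, hR]
    simp only [map_add, TensorProduct.map_map, LinearMap.comp_assoc, LinearMap.id_comp]
    rw [hp', LinearMap.comp_zero, TensorProduct.map_zero_left,
      LinearMap.zero_apply, map_zero, zero_add]
  -- Projecting the left factor to Y keeps only the cut directly after v. Then R acts on a tensor
  -- with the shorter word s.
  have hmul : ∀ (k : ℤ) (v : Y k) (s : Ten Y), (∀ x, prT X Y (R (x ⊗ₜ s)) = 0) → ∀ (x : Sym X),
      TensorProduct.map (Ten.proj Y ∘ₗ prT X Y ∘ₗ epow (par X Y) i) (prT X Y ∘ₗ R)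
        (comul X Y (x ⊗ₜ (Ten.ι Y (inc Y k v) * s))) = 0 := by
    intro k v s hs x
    have hv := Ten.isPar_ι Y (isPar_inc Y k v)
    rw [comul_tmul, Ten.comul_mul]
    generalize Sym.comul X x = w
    induction w using tmul_par_induction (Sym.par_par' X) (Sym.par_par' X) with
    | ha w w' hw hw' => rw [TensorProduct.add_tmul, map_add, map_add, hw, hw', add_zero]
    | h m n a b ha hb =>
      have h2 : ∀ u : Ten Y ⊗[K] Ten Y,
          TensorProduct.map (Ten.proj Y ∘ₗ prT X Y ∘ₗ epow (par X Y) i) (prT X Y ∘ₗ R)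
          (shuf (Sym.par X).toLinearMap (Ten.par Y).toLinearMap ((a ⊗ₜ b) ⊗ₜ
            TensorProduct.map (LinearMap.mulLeft K (Ten.ι Y (inc Y k v))) LinearMap.id u)) =
          (sgn K (n * k + i * (m + k)) * Sym.counit X a) • inc Y k v ⊗ₜ
            prT X Y (R (b ⊗ₜ TensorProduct.lid K _
              (TensorProduct.map (Ten.counit Y).toLinearMap LinearMap.id u))) := by
        intro u
        induction u using tmul_par_induction (Ten.par_par Y) (Ten.par_par Y) with
        | ha u u' hu hu' => simp only [map_add, TensorProduct.tmul_add, hu, hu', smul_add]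
        | h p q c d hc hd =>
          rw [TensorProduct.map_tmul, LinearMap.mulLeft_apply, LinearMap.id_apply,
            hb.shuf (Ten.isPar_mul Y hv hc), map_smul, TensorProduct.map_tmul,
            LinearMap.comp_apply, LinearMap.comp_apply,
            (isPar_tmul X Y ha (Ten.isPar_mul Y hv hc)).epow]
          simp only [map_smul, prT_tmul, Ten.proj_mul, Ten.counit_ι, zero_smul, zero_add,
            Ten.proj_ι, TensorProduct.map_tmul, LinearMap.id_apply, AlgHom.toLinearMap_apply,
            TensorProduct.lid_tmul, TensorProduct.tmul_smul, LinearMap.comp_apply,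
            ← TensorProduct.smul_tmul', smul_smul]
          congr 1
          -- The factor c is evaluated by the counit, so every sign caused by its parity p can be
          -- dropped.
          have := Ten.sgn_smul_counit Y hc (n + i)
          rw [mul_add, sgn_add] at this
          rw [sgn_congr (a := n * (k + p)) (b := n * k + p * n) (by simp [mul_add, mul_comm]),
            sgn_congr (a := i * (m + (k + p))) (b := i * (m + k) + p * i)
              (by rw [mul_comm p]; ring_nf; simp), sgn_add, sgn_add, sgn_add]
          linear_combination (sgn K (n * k) * sgn K (i * (m + k)) * Sym.counit X a) * this
      have h3 : shuf (Sym.par X).toLinearMap (Ten.par Y).toLinearMap ((a ⊗ₜ b) ⊗ₜ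
          ((1 : Ten Y) ⊗ₜ (Ten.ι Y (inc Y k v) * s))) =
          (a ⊗ₜ 1) ⊗ₜ (b ⊗ₜ (Ten.ι Y (inc Y k v) * s)) := by
        rw [hb.shuf (Ten.isPar_one Y), mul_zero, sgn_zero, one_smul]
      rw [TensorProduct.tmul_add, map_add, map_add, h2, Ten.map_counit_comul, h3,
        TensorProduct.lid_tmul, one_smul, hs, TensorProduct.tmul_zero, smul_zero, add_zero,
        TensorProduct.map_tmul, LinearMap.comp_apply, LinearMap.comp_apply,
        (isPar_tmul X Y ha (Ten.isPar_one Y)).epow, map_smul, map_smul, prT_tmul, map_smul,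
        Ten.proj_one, smul_zero, smul_zero, TensorProduct.zero_tmul]
  have hone : ∀ x : Sym X, TensorProduct.map (Ten.proj Y ∘ₗ prT X Y ∘ₗ epow (par X Y) i)
      (prT X Y ∘ₗ R) (comul X Y (x ⊗ₜ 1)) = 0 := by
    intro x
    rw [comul_tmul, Ten.comul_one]
    generalize Sym.comul X x = w
    induction w using tmul_par_induction (Sym.par_par' X) (Sym.par_par' X) with
    | ha w w' hw hw' => rw [TensorProduct.add_tmul, map_add, map_add, hw, hw', add_zero]
    | h m n a b ha hb =>
      rw [hb.shuf (Ten.isPar_one Y), map_smul, TensorProduct.map_tmul, LinearMap.comp_apply,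
        LinearMap.comp_apply, (isPar_tmul X Y ha (Ten.isPar_one Y)).epow, map_smul, map_smul,
        prT_tmul, map_smul, Ten.proj_one, smul_zero, smul_zero, TensorProduct.zero_tmul, smul_zero]
  -- The induction on the word t is for all x at once, since cutting off a letter also changes the
  -- element of S(X).
  have h2 : ∀ (t : Ten Y) (x : Sym X), prT X Y (R (x ⊗ₜ t)) = 0 := by
    intro t
    refine LinearMap.congr_fun (Ten.ext Y (f := (TensorProduct.curry (prT X Y ∘ₗ R)).flip) (g := 0)
      (LinearMap.ext fun x => ?_) (fun k v s hs => LinearMap.ext fun x => ?_) t)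
    · refine (h1 (x ⊗ₜ 1)).trans ?_
      rw [hone, map_zero, map_zero]; rfl
    · refine (h1 (x ⊗ₜ _)).trans ?_
      rw [hmul k v s (LinearMap.congr_fun hs), map_zero, map_zero]; rfl
  refine LinearMap.ext fun z => ?_
  have h3 : prT X Y ∘ₗ R = 0 := TensorProduct.ext' fun x t => h2 t x
  rw [← map_prS_prT_comul X Y (R z), hR, map_add, TensorProduct.map_map, TensorProduct.map_map,
    hS', h3, TensorProduct.map_zero_left, TensorProduct.map_zero_right]
  simp

end
end OpenC

section
variable {K : Type u} [Field K] {M N P P' : Type*} [AddCommGroup M] [Module K M]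
  [AddCommGroup N] [Module K N] [AddCommGroup P] [Module K P] [AddCommGroup P'] [Module K P']

theorem tmap_sub_left (f g : M →ₗ[K] P) (h : N →ₗ[K] P') :
    TensorProduct.map (f - g) h = TensorProduct.map f h - TensorProduct.map g h :=
  TensorProduct.ext' fun x y => by simp [TensorProduct.sub_tmul]

theorem tmap_sub_right (f : M →ₗ[K] P) (g h : N →ₗ[K] P') :
    TensorProduct.map f (g - h) = TensorProduct.map f g - TensorProduct.map f h :=
  TensorProduct.ext' fun x y => by simp [TensorProduct.tmul_sub]

end

theorem Ten.proj_deg {K : Type u} [Field K] (Y : ℤ → ModuleCat.{w} K) {d : ℤ} {x : Ten Y}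
    (hx : x ∈ Ten.deg Y d) : Ten.proj Y x ∈ LinearMap.range (inc Y d) := by
  induction hx using Submodule.span_induction with
  | zero => simp
  | add a b _ _ h h' => rw [map_add]; exact add_mem h h'
  | smul c a _ h => rw [map_smul]; exact Submodule.smul_mem _ _ h
  | mem a h =>
    obtain ⟨l, rfl, rfl⟩ := h
    cases l with
    | nil => simp [Ten.proj_one]
    | cons p l =>
      simp only [List.map_cons, List.prod_cons, Ten.proj_mul, Ten.counit_ι, zero_smul, zero_add,
        Ten.proj_ι]
      cases l with
      | nil =>
        rw [show ([p].map Sigma.fst).sum = p.1 by simp]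
        exact Submodule.smul_mem _ _ ⟨p.2, rfl⟩
      | cons q l => simp [Ten.counit_ι]

/-! ### Coderivations of S(X) ⊗ T(Y): construction. -/

namespace OpenC
variable {K : Type u} [Field K] {X : ℤ → ModuleCat.{v} K} {Y : ℤ → ModuleCat.{w} K}

/-- `(x ⊗ x') ⊗ t ↦ (-1)^{|x|} x ⊗ ψ(x')(t)`, where `ψ(x')` acts as a coderivation. -/
def insert (ψ : Sym X →ₗ[K] Tot (hoch Y)) : (Sym X ⊗[K] Sym X) ⊗[K] Ten Y →ₗ[K] OpenC X Y :=
  TensorProduct.map (Sym.par X).toLinearMap (TensorProduct.lift (hochIns Y ∘ₗ ψ)) ∘ₗ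
    (TensorProduct.assoc K _ _ _).toLinearMap

theorem insert_tmul (ψ : Sym X →ₗ[K] Tot (hoch Y)) (a b : Sym X) (t : Ten Y) :
    insert ψ ((a ⊗ₜ b) ⊗ₜ t) = (Sym.par X).toLinearMap a ⊗ₜ hochIns Y (ψ b) t := rfl

/-- The coderivation of `S(X) ⊗ T(Y)` over `S(X)` with Taylor components `ψ`. -/
def theta (ψ : Sym X →ₗ[K] Tot (hoch Y)) : OpenC X Y →ₗ[K] OpenC X Y :=
  insert ψ ∘ₗ TensorProduct.map (Sym.comul X) LinearMap.id

theorem theta_tmul (ψ : Sym X →ₗ[K] Tot (hoch Y)) (x : Sym X) (t : Ten Y) :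
    theta ψ (x ⊗ₜ t) = insert ψ (Sym.comul X x ⊗ₜ t) := rfl

section
variable [CharZero K]

theorem map_theta_left (ψ : Sym X →ₗ[K] Tot (hoch Y)) (w : Sym X ⊗[K] Sym X)
    (u : Ten Y ⊗[K] Ten Y) :
    TensorProduct.map (theta ψ) LinearMap.id
      (shuf (Sym.par X).toLinearMap (Ten.par Y).toLinearMap (w ⊗ₜ u)) =
    TensorProduct.map (insert ψ) LinearMap.id
      (shuf (Sym.par X).toLinearMap (Ten.par Y).toLinearMap
        (TensorProduct.map (Sym.comul X) LinearMap.id w ⊗ₜ u)) := by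
  revert w u
  refine tmul_shuf_induction X Y (fun z z' y hz hz' => ?_) (fun z y y' hy hy' => ?_)
    (fun i j k l a b c d ha hb hc hd => ?_)
  · simp only [TensorProduct.add_tmul, map_add, hz, hz']
  · simp only [TensorProduct.tmul_add, map_add, hy, hy']
  · rw [hb.shuf hc, TensorProduct.map_tmul, LinearMap.id_apply, hb.shuf hc, map_smul, map_smul]
    rfl

/-- Δ preserves parity, so comultiplying the second factor before or after it passes an element of
T(Y) yields the same sign. -/
theorem map_theta_right (ψ : Sym X →ₗ[K] Tot (hoch Y)) (w : Sym X ⊗[K] Sym X)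
    (u : Ten Y ⊗[K] Ten Y) :
    TensorProduct.map (par X Y) (theta ψ)
      (shuf (Sym.par X).toLinearMap (Ten.par Y).toLinearMap (w ⊗ₜ u)) =
    TensorProduct.map (par X Y) (insert ψ)
      (shuf (TensorProduct.map (Sym.par X).toLinearMap (Sym.par X).toLinearMap)
        (Ten.par Y).toLinearMap (TensorProduct.map LinearMap.id (Sym.comul X) w ⊗ₜ u)) := by
  revert w u
  refine tmul_shuf_induction X Y (fun z z' y hz hz' => ?_) (fun z y y' hy hy' => ?_)
    (fun i j k l a b c d ha hb hc hd => ?_)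
  · simp only [TensorProduct.add_tmul, map_add, hz, hz']
  · simp only [TensorProduct.tmul_add, map_add, hy, hy']
  · have hb' : IsPar (TensorProduct.map (Sym.par X).toLinearMap (Sym.par X).toLinearMap) j
        (Sym.comul X b) := by
      have := Sym.comul_par X b
      rw [IsPar, ← this, ← AlgHom.toLinearMap_apply, hb, map_smul]
    rw [hb.shuf hc, TensorProduct.map_tmul, LinearMap.id_apply, hb'.shuf hc, map_smul, map_smul]
    rfl

/-- The coderivation ψ(b) acts on the left or on the right part of the cut word. To reach the left
part, b has to pass the second part of the comultiplied factor a, which is the flip in the first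
summand. -/
theorem comul_insert {ψ : Sym X →ₗ[K] Tot (hoch Y)}
    (hψ : ∀ x, parity (hoch Y) (ψ x) = sgn K 0 • ψ ((Sym.par X).toLinearMap x))
    (w : Sym X ⊗[K] Sym X) (t : Ten Y) :
    comul X Y (insert ψ (w ⊗ₜ t)) =
    TensorProduct.map (insert ψ) LinearMap.id
      (shuf (Sym.par X).toLinearMap (Ten.par Y).toLinearMap
        ((TensorProduct.assoc K _ _ _).symm
          (TensorProduct.map LinearMap.id (gswap (Sym.par X).toLinearMap (Sym.par X).toLinearMap)
            (TensorProduct.assoc K _ _ _ (TensorProduct.map (Sym.comul X) LinearMap.id w))) ⊗ₜ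
          Ten.comul Y t)) +
    TensorProduct.map (par X Y) (insert ψ)
      (shuf (TensorProduct.map (Sym.par X).toLinearMap (Sym.par X).toLinearMap)
        (Ten.par Y).toLinearMap ((TensorProduct.assoc K _ _ _
          (TensorProduct.map (Sym.comul X) LinearMap.id w)) ⊗ₜ Ten.comul Y t)) := by
  induction w using tmul_par_induction (Sym.par_par' X) (Sym.par_par' X) with
  | ha w w' hw hw' => simp only [TensorProduct.add_tmul, map_add, hw, hw']; abel
  | h i j a b _ hb =>
    have hf : IsPar (parity (hoch Y)) j (ψ b) := (IsPar.map hψ hb).congr (by simp)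
    rw [insert_tmul, comul_tmul, AlgHom.toLinearMap_apply, Sym.comul_par, comul_hochIns Y hf,
      TensorProduct.map_tmul, LinearMap.id_apply]
    generalize Sym.comul X a = q
    generalize Ten.comul Y t = u
    revert q u
    refine tmul_shuf_induction X Y (fun z z' y hz hz' => ?_) (fun z y y' hy hy' => ?_)
      (fun m n k l a' a c d ha' ha hc hd => ?_)
    · simp only [TensorProduct.add_tmul, map_add, hz, hz']; abel
    · simp only [TensorProduct.tmul_add, map_add] at hy hy' ⊢
      rw [add_add_add_comm, hy, hy']; abel
    · have h1 := par_hochIns Y hf hc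
      simp only [TensorProduct.map_tmul, LinearMap.id_apply, TensorProduct.assoc_tmul, ha.gswap hb,
        TensorProduct.tmul_smul, map_smul, TensorProduct.assoc_symm_tmul, ha.shuf hc, hc.epow,
        TensorProduct.tmul_add, map_add, ← TensorProduct.smul_tmul', (ha.tmul hb).shuf hc,
        insert_tmul, show par X Y (a' ⊗ₜ c) = _ from isPar_tmul X Y ha' hc, ha.shuf h1,
        show (Sym.par X).toLinearMap a' = _ from ha', show (Sym.par X).toLinearMap a = _ from ha,
        smul_smul, ← sgn_add]
      congr 2
      · refine sgn_congr ?_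
        simp only [Int.even_add, Int.even_sub, Int.even_mul, Int.not_even_one]
        grind
      · refine sgn_congr ?_
        simp only [Int.even_add, Int.even_sub, Int.even_mul, Int.not_even_one]
        grind

/-- The flip in `comul_insert` becomes invisible because the iterated comultiplication of S(X) is
cocommutative. -/
theorem comul_theta {ψ : Sym X →ₗ[K] Tot (hoch Y)}
    (hψ : ∀ x, parity (hoch Y) (ψ x) = sgn K 0 • ψ ((Sym.par X).toLinearMap x)) (z : OpenC X Y) :
    comul X Y (theta ψ z) = TensorProduct.map (theta ψ) LinearMap.id (comul X Y z) +
      TensorProduct.map (par X Y) (theta ψ) (comul X Y z) := by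
  induction z using TensorProduct.induction_on with
  | zero => simp
  | add a b ha hb => simp only [map_add, ha, hb]; abel
  | tmul x t =>
    rw [theta_tmul, comul_insert hψ, ← Sym.comul₃_eq_assoc, Sym.gswap₂₃_comul₃, comul_tmul,
      map_theta_left, map_theta_right, ← Sym.comul₃_apply, Sym.comul₃_eq_assoc,
      LinearEquiv.symm_apply_apply]

theorem comul_map_left {P : Sym X →ₗ[K] Sym X}
    (hP : ∀ x, Sym.comul X (P x) = TensorProduct.map P LinearMap.id (Sym.comul X x) +
      TensorProduct.map (Sym.par X).toLinearMap P (Sym.comul X x))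
    (hpar : ∀ x, (Sym.par X).toLinearMap (P x) = sgn K 1 • P ((Sym.par X).toLinearMap x))
    (z : OpenC X Y) :
    comul X Y (TensorProduct.map P LinearMap.id z) =
      TensorProduct.map (TensorProduct.map P LinearMap.id) LinearMap.id (comul X Y z) +
      TensorProduct.map (par X Y) (TensorProduct.map P LinearMap.id) (comul X Y z) := by
  induction z using TensorProduct.induction_on with
  | zero => simp
  | add a b ha hb => simp only [map_add, ha, hb]; abel
  | tmul x t =>
    rw [TensorProduct.map_tmul, LinearMap.id_apply, comul_tmul, comul_tmul, hP]
    generalize Sym.comul X x = w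
    generalize Ten.comul Y t = u
    revert w u
    refine tmul_shuf_induction X Y (fun z z' y hz hz' => ?_) (fun z y y' hy hy' => ?_)
      (fun i j k l a b c d ha hb hc hd => ?_)
    · simp only [TensorProduct.add_tmul, map_add] at hz hz' ⊢
      rw [add_add_add_comm, hz, hz']; abel
    · simp only [TensorProduct.tmul_add, map_add] at hy hy' ⊢
      rw [hy, hy']; abel
    · have h1 := IsPar.map hpar hb
      simp only [TensorProduct.map_tmul, LinearMap.id_apply, TensorProduct.add_tmul, map_add,
        hb.shuf hc, h1.shuf hc, map_smul]
      rw [(isPar_tmul X Y ha hc), show (Sym.par X).toLinearMap a = _ from ha]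
      simp only [← TensorProduct.smul_tmul', smul_smul, ← sgn_add]
      congr 2
      refine sgn_congr ?_
      simp only [Int.even_add, Int.even_sub, Int.even_mul, Int.not_even_one]
      grind

/-- The coderivation of `S(X) ⊗ T(Y)` with components `-P` and `ψ`. -/
def codiff (P : Sym X →ₗ[K] Sym X) (ψ : Sym X →ₗ[K] Tot (hoch Y)) : OpenC X Y →ₗ[K] OpenC X Y :=
  theta ψ - TensorProduct.map P LinearMap.id

theorem comul_codiff {P : Sym X →ₗ[K] Sym X} {ψ : Sym X →ₗ[K] Tot (hoch Y)}
    (hP : ∀ x, Sym.comul X (P x) = TensorProduct.map P LinearMap.id (Sym.comul X x) +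
      TensorProduct.map (Sym.par X).toLinearMap P (Sym.comul X x))
    (hpar : ∀ x, (Sym.par X).toLinearMap (P x) = sgn K 1 • P ((Sym.par X).toLinearMap x))
    (hψ : ∀ x, parity (hoch Y) (ψ x) = sgn K 0 • ψ ((Sym.par X).toLinearMap x)) (z : OpenC X Y) :
    comul X Y (codiff P ψ z) = TensorProduct.map (codiff P ψ) LinearMap.id (comul X Y z) +
      TensorProduct.map (par X Y) (codiff P ψ) (comul X Y z) := by
  rw [codiff, LinearMap.sub_apply, map_sub, comul_theta hψ, comul_map_left hP hpar,
    tmap_sub_left, tmap_sub_right, LinearMap.sub_apply,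
    LinearMap.sub_apply]
  abel

end

/-- Every insertion has its values in the kernel of the counit of T(Y). -/
theorem prS_theta (ψ : Sym X →ₗ[K] Tot (hoch Y)) (z : OpenC X Y) :
    prS X Y (theta ψ z) = 0 := by
  have h : prS X Y ∘ₗ insert ψ = 0 := by
    refine TensorProduct.ext_threefold fun a b t => ?_
    simp [insert_tmul, counit_hochIns]
  exact LinearMap.congr_fun h _

theorem prS_map (P : Sym X →ₗ[K] Sym X) (z : OpenC X Y) :
    prS X Y (TensorProduct.map P LinearMap.id z) = P (prS X Y z) := by
  induction z using TensorProduct.induction_on with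
  | zero => simp
  | add a b ha hb => simp only [map_add, ha, hb]
  | tmul a b => simp

theorem prS_codiff (P : Sym X →ₗ[K] Sym X) (ψ : Sym X →ₗ[K] Tot (hoch Y)) (z : OpenC X Y) :
    prS X Y (codiff P ψ z) = - P (prS X Y z) := by
  rw [codiff, LinearMap.sub_apply, map_sub, prS_theta, prS_map, zero_sub]

theorem proj_theta (ψ : Sym X →ₗ[K] Tot (hoch Y)) (x : Sym X) (t : Ten Y) :
    proj X Y (theta ψ (x ⊗ₜ t)) = hochEval Y (ψ x) t := by
  have h : ∀ w, proj X Y (insert ψ (w ⊗ₜ t)) = hochEval Y (ψ (TensorProduct.lid K _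
      (TensorProduct.map (Sym.counit X).toLinearMap LinearMap.id w))) t := by
    intro w
    induction w using TensorProduct.induction_on with
    | zero => simp
    | add a b ha hb => simp only [TensorProduct.add_tmul, map_add, ha, hb, LinearMap.add_apply]
    | tmul a b =>
      simp [insert_tmul, proj_eq, Sym.counit_par, proj_hochIns]
  rw [theta_tmul, h, Sym.map_counit_comul, TensorProduct.lid_tmul, one_smul]

/-- The summand with P does not contribute, as the projection to Y applies the counit of S(X). -/
theorem proj_codiff {P : Sym X →ₗ[K] Sym X} (hP : ∀ x, Sym.counit X (P x) = 0)
    (ψ : Sym X →ₗ[K] Tot (hoch Y)) (x : Sym X) (t : Ten Y) :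
    proj X Y (codiff P ψ (x ⊗ₜ t)) = hochEval Y (ψ x) t := by
  rw [codiff, LinearMap.sub_apply, map_sub, proj_theta, proj_eq, TensorProduct.map_tmul, prT_tmul,
    hP, zero_smul, map_zero, sub_zero]

theorem tmul_mem_deg {i j d : ℤ} (h : i + j = d) {x : Sym X} {t : Ten Y} (hx : x ∈ Sym.deg X i)
    (ht : t ∈ Ten.deg Y j) : x ⊗ₜ t ∈ deg X Y d :=
  Submodule.subset_span ⟨i, j, x, t, h, hx, ht, rfl⟩

theorem codiff_deg {P : Sym X →ₗ[K] Sym X} {ψ : Sym X →ₗ[K] Tot (hoch Y)}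
    (hP : ∀ d, ∀ x ∈ Sym.deg X d, P x ∈ Sym.deg X (d + 1))
    (hψ : ∀ d, ∀ x ∈ Sym.deg X d, ψ x ∈ LinearMap.range (inc (hoch Y) d)) (d : ℤ) (z : OpenC X Y)
    (hz : z ∈ deg X Y d) : codiff P ψ z ∈ deg X Y (d + 1) := by
  have : deg X Y d ≤ (deg X Y (d + 1)).comap (codiff P ψ) := by
    refine Submodule.span_le.2 ?_
    rintro _ ⟨i, j, x, t, rfl, hx, ht, rfl⟩
    refine sub_mem ?_ (tmul_mem_deg (i := i + 1) (j := j) (by ring) (hP _ _ hx) ht)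
    refine Sym.deg₂_induct X (deg X Y (i + j + 1))
      (insert ψ ∘ₗ (TensorProduct.mk K _ _).flip t) (fun m n a b hmn ha hb => ?_)
      (Sym.comul_deg X hx)
    exact tmul_mem_deg (by rw [← hmn]; ring) (Sym.par_deg X ha) (hochIns_deg Y (hψ _ _ hb) ht)
  exact this hz

theorem isPar_deg {d : ℤ} {z : OpenC X Y} (hz : z ∈ deg X Y d) : IsPar (par X Y) d z := by
  have : deg X Y d ≤ LinearMap.eqLocus (par X Y) (sgn K d • LinearMap.id) := by
    refine Submodule.span_le.2 ?_
    rintro _ ⟨i, j, x, t, rfl, hx, ht, rfl⟩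
    exact isPar_tmul X Y (Sym.isPar_deg X hx) (Ten.isPar_deg Y ht)
  exact this hz

theorem deg_ext {M : Type*} [AddCommGroup M] [Module K M] {f g : OpenC X Y →ₗ[K] M}
    (h : ∀ d, ∀ z ∈ deg X Y d, f z = g z) (z : OpenC X Y) : f z = g z := by
  refine LinearMap.congr_fun (TensorProduct.ext ?_) z
  refine LinearMap.ext (Sym.deg_ext X fun i x hx => LinearMap.ext (Ten.deg_ext Y fun j t ht => ?_))
  exact h _ _ (tmul_mem_deg rfl hx ht)

theorem proj_deg {d : ℤ} {z : OpenC X Y} (hz : z ∈ deg X Y d) :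
    proj X Y z ∈ LinearMap.range (inc Y d) := by
  have : deg X Y d ≤ (LinearMap.range (inc Y d)).comap (proj X Y) := by
    refine Submodule.span_le.2 ?_
    rintro _ ⟨i, j, x, t, rfl, hx, ht, rfl⟩
    change proj X Y (x ⊗ₜ t) ∈ LinearMap.range (inc Y (i + j))
    rw [proj_eq, prT_tmul, map_smul]
    by_cases hi : i = 0
    · subst hi
      rw [zero_add]
      exact Submodule.smul_mem _ _ (Ten.proj_deg Y ht)
    · rw [Sym.counit_deg X hi hx, zero_smul]; exact zero_mem _
  exact this hz

/-- A map of degree one is odd. -/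
theorem par_comm_of_deg {Q : OpenC X Y →ₗ[K] OpenC X Y}
    (hQ : ∀ d, ∀ z ∈ deg X Y d, Q z ∈ deg X Y (d + 1)) (z : OpenC X Y) :
    par X Y (Q z) = - Q (par X Y z) := by
  refine deg_ext (f := par X Y ∘ₗ Q) (g := -(Q ∘ₗ par X Y)) (fun d z hz => ?_) z
  rw [LinearMap.comp_apply, isPar_deg (hQ d z hz), LinearMap.neg_apply, LinearMap.comp_apply,
    isPar_deg hz, map_smul, sgn_add, sgn_one, mul_neg, mul_one, neg_smul]

/-- The square of a coderivation of degree one vanishes if its projections do. -/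
theorem sq_eq_zero [CharZero K] {Q : OpenC X Y →ₗ[K] OpenC X Y}
    (hQ : ∀ d, ∀ z ∈ deg X Y d, Q z ∈ deg X Y (d + 1))
    (hc : ∀ z, comul X Y (Q z) = TensorProduct.map Q LinearMap.id (comul X Y z) +
      TensorProduct.map (par X Y) Q (comul X Y z))
    (hS : ∀ z, prS X Y (Q (Q z)) = 0) (hp : ∀ z, proj X Y (Q (Q z)) = 0) : Q ∘ₗ Q = 0 := by
  -- The parameter is 0 because the square is an even coderivation: Q is odd, so the two mixed terms
  -- in its comultiplication cancel.
  refine eq_zero_of_proj X Y 0 (fun z => ?_) hS hp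
  have h1 : epow (par X Y) 0 = LinearMap.id := if_pos (by simp)
  have h2 : par X Y ∘ₗ Q = -(Q ∘ₗ par X Y) := LinearMap.ext (par_comm_of_deg hQ)
  have h3 : par X Y ∘ₗ par X Y = LinearMap.id := LinearMap.ext (par_par X Y)
  rw [LinearMap.comp_apply, hc, hc, map_add, map_add]
  simp only [TensorProduct.map_map, LinearMap.id_comp, LinearMap.comp_id, h1, h2, h3]
  have h4 : TensorProduct.map (-(Q ∘ₗ par X Y)) Q = -TensorProduct.map (Q ∘ₗ par X Y) Q := by
    exact TensorProduct.ext' fun x y => by simp [TensorProduct.neg_tmul]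
  rw [h4, LinearMap.neg_apply]
  abel

end OpenC

section Inc
variable {K : Type u} [Field K] (X : ℤ → ModuleCat.{w} K)

theorem inc_same (i : ℤ) (x : X i) : inc X i x i = x := DFinsupp.single_eq_same

theorem inc_ne {i j : ℤ} (h : i ≠ j) (x : X i) : inc X i x j = 0 :=
  DFinsupp.single_eq_of_ne (Ne.symm h)

end Inc

/-! ### Evaluation of cochains and the Gerstenhaber bracket. -/

section Hoch
variable {K : Type u} [Field K] (Y : ℤ → ModuleCat.{w} K)

/-- On a word of degree d the components of f have their values in pairwise different degrees d + i
+ 1. Hence they can be read off from the sum, which makes `hochEval` injective. -/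
theorem component_hochEval (f : Tot (hoch Y)) (i : ℤ) {d : ℤ} {t : Ten Y} (ht : t ∈ Ten.deg Y d) :
    (hochEval Y f t) (d + (i + 2 - 1)) = ((f i).1 t) (d + (i + 2 - 1)) := by
  induction f using DirectSum.induction_on with
  | zero => simp
  | add a b ha hb =>
    rw [map_add, LinearMap.add_apply, DirectSum.add_apply, ha, hb, DirectSum.add_apply,
      Submodule.coe_add, LinearMap.add_apply, DirectSum.add_apply]
  | of j g =>
    change (hochEval Y (inc (hoch Y) j g) t) (d + (i + 2 - 1)) =
      ((inc (hoch Y) j g i : cochain Y (i + 2)).1 t) (d + (i + 2 - 1))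
    rw [hochEval_inc]
    by_cases hij : j = i
    · subst hij
      rw [inc_same (hoch Y)]
    · have h1 : (inc (hoch Y) j g) i = 0 := inc_ne (hoch Y) hij g
      obtain ⟨y, hy⟩ := g.2 d t ht
      rw [h1, ← hy]
      have h2 : (inc Y (d + (j + 2 - 1)) y) (d + (i + 2 - 1)) = 0 :=
        inc_ne Y (by omega) y
      rw [h2]; rfl

theorem hochEval_injective : Function.Injective (hochEval Y) := by
  rw [injective_iff_map_eq_zero]
  intro f hf
  refine DFinsupp.ext fun i => Subtype.ext (LinearMap.ext (Ten.deg_ext Y fun d t ht => ?_))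
  obtain ⟨y, hy⟩ := (f i).2 d t ht
  have h1 := component_hochEval Y f i ht
  rw [hf, ← hy] at h1
  have h2 : (inc Y (d + (i + 2 - 1)) y) (d + (i + 2 - 1)) = y := inc_same Y _ y
  rw [h2] at h1
  change (f i).1 t = 0
  rw [← hy, ← h1]
  exact map_zero _

/-- A homogeneous family of cochains of finite type. -/
theorem exists_hochEval_eq {X : ℤ → ModuleCat.{v} K} {F : Sym X →ₗ[K] Ten Y →ₗ[K] Tot Y}
    (hF : ∀ d, ∀ x ∈ Sym.deg X d, F x ∈ cochain Y (d + 2)) :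
    ∃ ψ : Sym X →ₗ[K] Tot (hoch Y), (∀ x, hochEval Y (ψ x) = F x) ∧
      ∀ d, ∀ x ∈ Sym.deg X d, ψ x ∈ LinearMap.range (inc (hoch Y) d) := by
  -- Each x is a finite sum of homogeneous elements, so F x is a finite sum of homogeneous cochains.
  -- Infinitely many arities may occur in one degree; this is allowed in `cochain`.
  have h1 : ∀ x, F x ∈ LinearMap.range (hochEval Y) := by
    intro x
    have : (⨆ d, Sym.deg X d) ≤ (LinearMap.range (hochEval Y)).comap F :=
      iSup_le fun d x hx => ⟨inc (hoch Y) d ⟨F x, hF d x hx⟩, hochEval_inc Y d _⟩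
    exact this (Sym.iSup_deg X x)
  let e := LinearEquiv.ofInjective (hochEval Y) (hochEval_injective Y)
  have h2 : ∀ x, hochEval Y (e.symm (F.codRestrict _ h1 x)) = F x := fun x =>
    congrArg Subtype.val (e.apply_symm_apply (F.codRestrict _ h1 x))
  refine ⟨e.symm.toLinearMap ∘ₗ F.codRestrict _ h1, h2, fun d x hx => ?_⟩
  exact ⟨⟨F x, hF d x hx⟩, hochEval_injective Y ((hochEval_inc Y d _).trans (h2 x).symm)⟩

theorem hochBracket_inc (i j : ℤ) (f : cochain Y (i + 2)) (g : cochain Y (j + 2)) :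
    hochBracket Y (inc (hoch Y) i f ⊗ₜ inc (hoch Y) j g) =
      sgn K i • inc (hoch Y) (i + j + 1)
        (gerstHom Y (i + 2) (j + 2) (i + j + 1 + 2) (by ring) f g) := by
  simp [hochBracket]

theorem hochEval_hochBracket_inc (i j : ℤ) (f : cochain Y (i + 2)) (g : cochain Y (j + 2)) :
    hochEval Y (hochBracket Y (inc (hoch Y) i f ⊗ₜ inc (hoch Y) j g)) =
      sgn K i • gerst Y (i + 2) (j + 2) f.1 g.1 := by
  rw [hochBracket_inc, map_smul, hochEval_inc]; rfl

theorem hochDiff_inc (m : cochain Y 2) (i : ℤ) (f : cochain Y (i + 2)) :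
    hochDiff Y m (inc (hoch Y) i f) =
      inc (hoch Y) (i + 1) (gerstHom Y 2 (i + 2) (i + 1 + 2) (by ring) m f) := by
  simp [hochDiff]

theorem hochEval_hochDiff_inc (m : cochain Y 2) (i : ℤ) (f : cochain Y (i + 2)) :
    hochEval Y (hochDiff Y m (inc (hoch Y) i f)) = gerst Y 2 (i + 2) m.1 f.1 := by
  rw [hochDiff_inc, hochEval_inc]; rfl

/-- A cochain of total degree two as an element of `s^{-2} C(A, A)`. -/
def hochOf (m : cochain Y 2) : Tot (hoch Y) :=
  inc (hoch Y) 0 (⟨m.1, by rw [zero_add]; exact m.2⟩ : cochain Y (0 + 2))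

theorem hochEval_hochOf (m : cochain Y 2) : hochEval Y (hochOf Y m) = m.1 := hochEval_inc Y 0 _

/-- A cochain of total degree two has index 0, so the sign in front of the bracket is trivial. -/
theorem hochBracket_hochOf_left (m : cochain Y 2) (f : Tot (hoch Y)) :
    hochBracket Y (hochOf Y m ⊗ₜ f) = hochDiff Y m f := by
  refine LinearMap.congr_fun (f := hochBracket Y ∘ₗ TensorProduct.mk K _ _ (hochOf Y m)) (g := hochDiff Y m)
    (DirectSum.linearMap_ext K fun i => LinearMap.ext fun f => ?_) f
  apply hochEval_injective
  refine (hochEval_hochBracket_inc Y 0 i _ f).trans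
    (Eq.trans ?_ (hochEval_hochDiff_inc Y m i f).symm)
  change sgn K 0 • gerst Y (0 + 2) (i + 2) m.1 f.1 = _
  rw [sgn_zero, one_smul, zero_add]

/-- The operation is graded symmetric on s^{-2}C(A, A), and m is even there. -/
theorem hochBracket_hochOf_right (m : cochain Y 2) (f : Tot (hoch Y)) :
    hochBracket Y (f ⊗ₜ hochOf Y m) = hochDiff Y m f := by
  refine LinearMap.congr_fun (f := hochBracket Y ∘ₗ (TensorProduct.mk K _ _).flip (hochOf Y m)) (g := hochDiff Y m)
    (DirectSum.linearMap_ext K fun i => LinearMap.ext fun f => ?_) f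
  apply hochEval_injective
  refine (hochEval_hochBracket_inc Y i 0 f _).trans
    (Eq.trans ?_ (hochEval_hochDiff_inc Y m i f).symm)
  change sgn K i • gerst Y (i + 2) (0 + 2) f.1 m.1 = _
  rw [zero_add, gerst, gerst, smul_sub, smul_smul, ← sgn_add,
    sgn_odd (a := i + (i + 2 + 1) * (2 + 1)) ⟨2 * i + 4, by ring⟩]
  have : sgn K ((2 + 1) * (i + 2 + 1)) = - sgn K i := by
    rw [sgn_congr (b := i + 1) ⟨i + 4, by ring⟩, sgn_add, sgn_one, mul_neg, mul_one]
  rw [this]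
  module

theorem hochDiff_deg (m : cochain Y 2) {d : ℤ} {f : Tot (hoch Y)}
    (hf : f ∈ LinearMap.range (inc (hoch Y) d)) :
    hochDiff Y m f ∈ LinearMap.range (inc (hoch Y) (d + 1)) := by
  obtain ⟨f, rfl⟩ := hf
  rw [hochDiff_inc]
  exact ⟨_, rfl⟩

theorem hochBracket_deg {i j : ℤ} {f g : Tot (hoch Y)}
    (hf : f ∈ LinearMap.range (inc (hoch Y) i)) (hg : g ∈ LinearMap.range (inc (hoch Y) j)) :
    hochBracket Y (f ⊗ₜ g) ∈ LinearMap.range (inc (hoch Y) (i + j + 1)) := by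
  obtain ⟨f, rfl⟩ := hf
  obtain ⟨g, rfl⟩ := hg
  rw [hochBracket_inc]
  exact Submodule.smul_mem _ _ ⟨_, rfl⟩

/-- The form is adapted to `OpenC.hochEval_insert`: the summands will come from a tensor and from
its Koszul flip. -/
theorem hochEval_hochBracket [CharZero K] {i j : ℤ} {f g : Tot (hoch Y)}
    (hf : IsPar (parity (hoch Y)) i f) (hg : IsPar (parity (hoch Y)) j g) :
    hochEval Y (hochBracket Y (f ⊗ₜ g)) = sgn K i • hochEval Y f ∘ₗ hochIns Y g +
      sgn K (i * j + j) • hochEval Y g ∘ₗ hochIns Y f := by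
  have hcomp : ∀ f g : Tot (hoch Y), hochEval Y f ∘ₗ hochIns Y g =
      LinearMap.llcomp K _ _ _ (hochEval Y f) (hochIns Y g) := fun f g => rfl
  -- First f and then g is replaced by a homogeneous cochain, whose index differs from i or j by an
  -- even number.
  refine isPar_ext (hoch Y) (i := i) (f := hochEval Y ∘ₗ hochBracket Y ∘ₗ
      (TensorProduct.mk K _ _).flip g)
    (g := sgn K i • (LinearMap.llcomp K _ _ _).flip (hochIns Y g) ∘ₗ hochEval Y +
      sgn K (i * j + j) • LinearMap.llcomp K _ _ _ (hochEval Y g) ∘ₗ hochIns Y)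
    (fun k f hik => ?_) hf
  refine isPar_ext (hoch Y) (i := j) (f := hochEval Y ∘ₗ hochBracket Y ∘ₗ
      TensorProduct.mk K _ _ (inc (hoch Y) k f))
    (g := sgn K i • LinearMap.llcomp K _ _ _ (hochEval Y (inc (hoch Y) k f)) ∘ₗ hochIns Y +
      sgn K (i * j + j) • (LinearMap.llcomp K _ _ _).flip (hochIns Y (inc (hoch Y) k f)) ∘ₗ
        hochEval Y) (fun l g hjl => ?_) hg
  refine (hochEval_hochBracket_inc Y k l f g).trans ?_
  change _ = sgn K i • hochEval Y (inc (hoch Y) k f) ∘ₗ hochIns Y (inc (hoch Y) l g) +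
    sgn K (i * j + j) • hochEval Y (inc (hoch Y) l g) ∘ₗ hochIns Y (inc (hoch Y) k f)
  rw [hochEval_inc, hochEval_inc, hochIns_inc, hochIns_inc, gerst, smul_sub, smul_smul, ← sgn_add,
    sub_eq_add_neg, ← neg_smul, sgn_congr hik]
  congr 2
  rw [← mul_one (sgn K _), ← mul_neg, ← sgn_one, ← sgn_add]
  refine sgn_congr ?_
  obtain ⟨p, hp⟩ := hik
  obtain ⟨q, hq⟩ := hjl
  obtain rfl : i = k + (p + p) := by omega
  obtain rfl : j = l + (q + q) := by omega
  simp only [Int.even_add, Int.even_sub, Int.even_mul, Int.not_even_one]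
  grind

end Hoch

/-! ### The square of the codifferential as a Maurer-Cartan expression. -/

namespace OpenC
variable {K : Type u} [Field K] [CharZero K] {X : ℤ → ModuleCat.{v} K} {Y : ℤ → ModuleCat.{w} K}

/-- The bracket is the insertion for a tensor plus the insertion for its flip. On a cocommutative
Δ(x) the two are equal, whence the factor ½. -/
theorem hochEval_insert {ψ : Sym X →ₗ[K] Tot (hoch Y)}
    (hψ : ∀ x, parity (hoch Y) (ψ x) = sgn K 0 • ψ ((Sym.par X).toLinearMap x))
    (x : Sym X) (t : Ten Y) :
    TensorProduct.lift (hochEval Y ∘ₗ ψ) (insert ψ (Sym.comul X x ⊗ₜ t)) =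
      hochEval Y ((2 : K)⁻¹ • hochBracket Y (TensorProduct.map ψ ψ (Sym.comul X x))) t := by
  have h2 : (2 : K) ≠ 0 := two_ne_zero
  have h : ∀ w : Sym X ⊗[K] Sym X, hochEval Y (hochBracket Y (TensorProduct.map ψ ψ w)) t =
      TensorProduct.lift (hochEval Y ∘ₗ ψ) (insert ψ (w ⊗ₜ t)) +
      TensorProduct.lift (hochEval Y ∘ₗ ψ)
        (insert ψ (gswap (Sym.par X).toLinearMap (Sym.par X).toLinearMap w ⊗ₜ t)) := by
    intro w
    induction w using tmul_par_induction (Sym.par_par' X) (Sym.par_par' X) with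
    | ha w w' hw hw' =>
      simp only [map_add, LinearMap.add_apply, hw, hw', TensorProduct.add_tmul]; abel
    | h i j a b ha hb =>
      have hfa : IsPar (parity (hoch Y)) i (ψ a) := (IsPar.map hψ ha).congr (by simp)
      have hfb : IsPar (parity (hoch Y)) j (ψ b) := (IsPar.map hψ hb).congr (by simp)
      rw [TensorProduct.map_tmul, hochEval_hochBracket Y hfa hfb, ha.gswap hb,
        ← TensorProduct.smul_tmul', map_smul, map_smul, insert_tmul, insert_tmul, ha, hb]
      simp only [TensorProduct.lift.tmul, LinearMap.comp_apply, map_smul, LinearMap.smul_apply,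
        LinearMap.add_apply, ← TensorProduct.smul_tmul', smul_smul, ← sgn_add]
  have h1 := h (Sym.comul X x)
  rw [Sym.gswap_comul, ← two_smul K] at h1
  rw [map_smul, LinearMap.smul_apply, h1, smul_smul, inv_mul_cancel₀ h2, one_smul]

/-- The outer factor followed by the projection only evaluates ψ; on the two summands of the inner
factor this gives ½[ψ, ψ] and -ψP. Its vanishing is the Maurer-Cartan equation for ψ. -/
theorem proj_codiff_codiff {P : Sym X →ₗ[K] Sym X} (hP : ∀ x, Sym.counit X (P x) = 0)
    {ψ : Sym X →ₗ[K] Tot (hoch Y)}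
    (hψ : ∀ x, parity (hoch Y) (ψ x) = sgn K 0 • ψ ((Sym.par X).toLinearMap x))
    (x : Sym X) (t : Ten Y) :
    proj X Y (codiff P ψ (codiff P ψ (x ⊗ₜ t))) =
      hochEval Y ((2 : K)⁻¹ • hochBracket Y (TensorProduct.map ψ ψ (Sym.comul X x)) - ψ (P x)) t := by
  have h : proj X Y ∘ₗ codiff P ψ = TensorProduct.lift (hochEval Y ∘ₗ ψ) :=
    TensorProduct.ext' fun x t => proj_codiff hP ψ x t
  rw [← LinearMap.comp_apply, h, codiff, LinearMap.sub_apply, map_sub, theta_tmul,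
    hochEval_insert hψ, map_sub]
  rfl

end OpenC

theorem inv_two_smul_add_add {K M : Type*} [Field K] [CharZero K] [AddCommGroup M] [Module K M]
    (a b : M) (c : K) : (2 : K)⁻¹ • (b + a + (a + c • 0)) = a + (2 : K)⁻¹ • b := by
  rw [smul_zero, add_zero, add_assoc, ← two_smul K a, smul_add, inv_smul_smul₀ two_ne_zero,
    add_comm]

/-! ### Twisting by m: from Maurer-Cartan elements to L_∞-morphisms. -/

section HochLie
variable {K : Type u} [Field K] {X : ℤ → ModuleCat.{v} K} (Y : ℤ → ModuleCat.{w} K)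

theorem hochBracket_hochOf {m : cochain Y 2} (hm : gerst Y 2 2 m.1 m.1 = 0) :
    hochBracket Y (hochOf Y m ⊗ₜ hochOf Y m) = 0 := by
  apply hochEval_injective
  rw [hochBracket_hochOf_left, map_zero]
  exact (hochEval_hochDiff_inc Y m 0 _).trans hm

theorem parity_of_deg_zero {Z : ℤ → ModuleCat.{w} K}
    {ψ : Sym X →ₗ[K] Tot Z} (hψ : ∀ d, ∀ x ∈ Sym.deg X d, ψ x ∈ LinearMap.range (inc Z d))
    (x : Sym X) :
    parity Z (ψ x) = sgn K 0 • ψ ((Sym.par X).toLinearMap x) :=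
  Sym.comm_parity_of_deg X (fun d x hx => by rw [add_zero]; exact hψ d x hx) x

/-- The map `S(X) → s^{-2} C(A, A)` that sends `1` to `m` and vanishes on the truncated symmetric
algebra. -/
def scalarPart (X : ℤ → ModuleCat.{v} K) (m : cochain Y 2) : Sym X →ₗ[K] Tot (hoch Y) :=
  (Sym.counit X).toLinearMap.smulRight (hochOf Y m)

theorem scalarPart_apply (m : cochain Y 2) (x : Sym X) :
    scalarPart Y X m x = Sym.counit X x • hochOf Y m := rfl

theorem scalarPart_deg (m : cochain Y 2) (d : ℤ) (x : Sym X) (hx : x ∈ Sym.deg X d) :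
    scalarPart Y X m x ∈ LinearMap.range (inc (hoch Y) d) := by
  rw [scalarPart_apply]
  by_cases hd : d = 0
  · subst hd; exact Submodule.smul_mem _ _ ⟨_, rfl⟩
  · rw [Sym.counit_deg X hd hx, zero_smul]; exact zero_mem _

/-- The Taylor components of the codifferential of the Hochschild complex. -/
def hochTaylor (m : cochain Y 2) : Sym (hoch Y) →ₗ[K] Tot (hoch Y) :=
  hochDiff Y m ∘ₗ Sym.proj (hoch Y) + (2 : K)⁻¹ • (hochBracket Y ∘ₗ
    TensorProduct.map (Sym.proj (hoch Y)) (Sym.proj (hoch Y)) ∘ₗ Sym.comul (hoch Y))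

theorem hochTaylor_deg (m : cochain Y 2) (d : ℤ) (x : Sym (hoch Y)) (hx : x ∈ Sym.deg (hoch Y) d) :
    hochTaylor Y m x ∈ LinearMap.range (inc (hoch Y) (d + 1)) := by
  refine add_mem (hochDiff_deg Y m (Sym.proj_deg _ hx)) (Submodule.smul_mem _ _ ?_)
  refine Sym.deg₂_induct (hoch Y) (LinearMap.range (inc (hoch Y) (d + 1)))
    (hochBracket Y ∘ₗ TensorProduct.map (Sym.proj (hoch Y)) (Sym.proj (hoch Y)))
    (fun i j a b hij ha hb => ?_) (Sym.comul_deg _ hx)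
  rw [← hij]
  exact hochBracket_deg Y (Sym.proj_deg _ ha) (Sym.proj_deg _ hb)

variable [CharZero K]

/-- Twisting the bracket by `m` produces the Hochschild differential. -/
theorem hochBracket_add_scalarPart {m : cochain Y 2} (hm : gerst Y 2 2 m.1 m.1 = 0)
    (φ : Sym X →ₗ[K] Tot (hoch Y)) (x : Sym X) :
    (2 : K)⁻¹ • hochBracket Y (TensorProduct.map (φ + scalarPart Y X m) (φ + scalarPart Y X m)
      (Sym.comul X x)) =
    hochDiff Y m (φ x) + (2 : K)⁻¹ • hochBracket Y (TensorProduct.map φ φ (Sym.comul X x)) := by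
  -- By the counit axioms each of the two mixed terms becomes [m, φ(x)], and with the factor ½ they
  -- give one Hochschild differential. The remaining term is a multiple of [m, m] = 0.
  have h1 : ∀ (f : Sym X →ₗ[K] Tot (hoch Y)) (w : Sym X ⊗[K] Sym X),
      TensorProduct.map f (scalarPart Y X m) w = TensorProduct.map f
        (LinearMap.toSpanSingleton K _ (hochOf Y m))
        (TensorProduct.map LinearMap.id (Sym.counit X).toLinearMap w) := fun f w => by
    rw [TensorProduct.map_map]; rfl
  have h2 : ∀ (f : Sym X →ₗ[K] Tot (hoch Y)) (w : Sym X ⊗[K] Sym X),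
      TensorProduct.map (scalarPart Y X m) f w = TensorProduct.map
        (LinearMap.toSpanSingleton K _ (hochOf Y m)) f
        (TensorProduct.map (Sym.counit X).toLinearMap LinearMap.id w) := fun f w => by
    rw [TensorProduct.map_map]; rfl
  rw [TensorProduct.map_add_left, TensorProduct.map_add_right, TensorProduct.map_add_right]
  simp only [LinearMap.add_apply, map_add]
  rw [h1, h2, h1, Sym.map_counit_comul, Sym.map_counit_comul', TensorProduct.map_tmul,
    TensorProduct.map_tmul, TensorProduct.map_tmul, LinearMap.toSpanSingleton_apply, one_smul,
    hochBracket_hochOf_left, hochBracket_hochOf_right, scalarPart_apply,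
    ← TensorProduct.smul_tmul', map_smul, hochBracket_hochOf Y hm]
  exact inv_two_smul_add_add _ _ _

/-- The Maurer-Cartan expression of a morphism of coalgebras twisted by `m`. -/
theorem hochBracket_of_comul {m : cochain Y 2} (hm : gerst Y 2 2 m.1 m.1 = 0)
    {U : Sym X →ₗ[K] Sym (hoch Y)} {φ : Sym X →ₗ[K] Tot (hoch Y)}
    (hU : ∀ x, Sym.comul (hoch Y) (U x) = TensorProduct.map U U (Sym.comul X x))
    (hφ : ∀ x, Sym.proj (hoch Y) (U x) = φ x) (x : Sym X) :
    (2 : K)⁻¹ • hochBracket Y (TensorProduct.map (φ + scalarPart Y X m) (φ + scalarPart Y X m)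
      (Sym.comul X x)) = hochTaylor Y m (U x) := by
  obtain rfl : Sym.proj (hoch Y) ∘ₗ U = φ := LinearMap.ext hφ
  rw [hochBracket_add_scalarPart Y hm, hochTaylor]
  simp only [LinearMap.add_apply, LinearMap.smul_apply, LinearMap.comp_apply, hU,
    TensorProduct.map_map]

end HochLie

/-! ### From a Ger^+_∞-structure to a triple. -/

section Structures
variable {K : Type u} [Field K] {A : CochainComplex (ModuleCat.{w} K) ℤ}

theorem AInf.proj_hochLie (a : AInf A) (x : Sym (hoch (openGen A))) :
    Sym.proj _ (a.hochLie x) = hochTaylor (openGen A) a.m x := Sym.proj_coderOf _ x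

theorem AInf.counit_hochLie (a : AInf A) (x : Sym (hoch (openGen A))) :
    Sym.counit _ (a.hochLie x) = 0 := Sym.counit_coderOf _ x

variable [CharZero K] {V : CochainComplex (ModuleCat.{v} K) ℤ}

theorem GerInf.par_lie (G : GerInf V) (x : Sym (closedGen V)) :
    (Sym.par (closedGen V)).toLinearMap (G.lie x) =
      sgn K 1 • G.lie ((Sym.par (closedGen V)).toLinearMap x) :=
  Sym.comm_par_of_deg (closedGen V) G.lie_deg x

theorem AInf.comul_hochLie (a : AInf A) (x : Sym (hoch (openGen A))) :
    Sym.comul _ (a.hochLie x) = TensorProduct.map a.hochLie LinearMap.id (Sym.comul _ x) +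
      TensorProduct.map (Sym.par _).toLinearMap a.hochLie (Sym.comul _ x) :=
  Sym.comul_coderOf (Sym.comm_parity_of_deg _ (hochTaylor_deg _ a.m)) x

namespace GerPlusInf
variable (S : GerPlusInf V A)

/-- The components `S(s^{-2} V) ⊗ T(s^{-1} A) → s^{-1} A` of the codifferential. -/
def component : Sym (closedGen V) →ₗ[K] Ten (openGen A) →ₗ[K] Tot (openGen A) :=
  TensorProduct.curry (OpenC.proj (closedGen V) (openGen A) ∘ₗ S.Q)

theorem component_apply (x : Sym (closedGen V)) (t : Ten (openGen A)) :
    S.component x t = OpenC.proj (closedGen V) (openGen A) (S.Q (x ⊗ₜ t)) := rfl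

theorem component_mem (d : ℤ) (x : Sym (closedGen V)) (hx : x ∈ Sym.deg (closedGen V) d) :
    S.component x ∈ cochain (openGen A) (d + 2) := by
  intro e t ht
  rw [show e + (d + 2 - 1) = d + e + 1 by ring]
  exact OpenC.proj_deg (S.Q_deg _ _ (OpenC.tmul_mem_deg rfl hx ht))

/-- The components of the codifferential as a map to the Hochschild cochains. -/
def taylor : Sym (closedGen V) →ₗ[K] Tot (hoch (openGen A)) :=
  (exists_hochEval_eq (openGen A) S.component_mem).choose

theorem hochEval_taylor (x : Sym (closedGen V)) :
    hochEval (openGen A) (S.taylor x) = S.component x :=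
  (exists_hochEval_eq (openGen A) S.component_mem).choose_spec.1 x

theorem taylor_deg (d : ℤ) (x : Sym (closedGen V)) (hx : x ∈ Sym.deg (closedGen V) d) :
    S.taylor x ∈ LinearMap.range (inc (hoch (openGen A)) d) :=
  (exists_hochEval_eq (openGen A) S.component_mem).choose_spec.2 d x hx

/-- The cooperation ρ is this projection followed by the embedding of S(X), so its compatibility
with D and Q decides everything but the counit, which `Q_counit` supplies. -/
theorem prS_Q (z : OpenC (closedGen V) (openGen A)) :
    OpenC.prS _ _ (S.Q z) = - S.lie (OpenC.prS _ _ z) := by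
  refine Sym.eq_of_toGer _ ?_ ?_
  · rw [← OpenC.counit_eq_prS, S.Q_counit, map_neg, S.counit_lie, neg_zero]
  · rw [← OpenC.rho_eq, map_neg, ← S.D_toGer, ← OpenC.rho_eq, S.Q_rho, neg_neg]

/-- The difference is an odd coderivation, hence the parameter 1 below, and both of its projections
vanish. -/
theorem Q_eq_codiff : S.Q = OpenC.codiff S.lie S.taylor := by
  refine sub_eq_zero.1 (OpenC.eq_zero_of_proj (closedGen V) (openGen A) 1 (fun z => ?_)
    (fun z => ?_) fun z => ?_)
  · have h : epow (OpenC.par (closedGen V) (openGen A)) 1 = OpenC.par _ _ := if_neg (by simp)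
    rw [h, LinearMap.sub_apply, map_sub, S.Q_comul,
      OpenC.comul_codiff S.comul_lie S.par_lie (parity_of_deg_zero S.taylor_deg),
      tmap_sub_left, tmap_sub_right, LinearMap.sub_apply, LinearMap.sub_apply]
    abel
  · rw [LinearMap.sub_apply, map_sub, S.prS_Q, OpenC.prS_codiff, sub_self]
  · refine LinearMap.congr_fun (f := OpenC.proj _ _ ∘ₗ (S.Q - OpenC.codiff S.lie S.taylor))
      (g := 0) (TensorProduct.ext' fun x t => ?_) z
    rw [LinearMap.comp_apply, LinearMap.sub_apply, map_sub, OpenC.proj_codiff S.counit_lie,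
      S.hochEval_taylor, S.component_apply, sub_self, LinearMap.zero_apply]

theorem taylor_lie (x : Sym (closedGen V)) : S.taylor (S.lie x) =
    (2 : K)⁻¹ • hochBracket (openGen A) (TensorProduct.map S.taylor S.taylor
      (Sym.comul (closedGen V) x)) := by
  refine (sub_eq_zero.1 (hochEval_injective (openGen A) (LinearMap.ext fun t => ?_))).symm
  rw [← OpenC.proj_codiff_codiff S.counit_lie (parity_of_deg_zero S.taylor_deg), ← S.Q_eq_codiff,
    S.Q_sq, map_zero, map_zero, LinearMap.zero_apply]

/-- The cochain `m`. -/
def openPart : cochain (openGen A) 2 :=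
  ⟨S.component 1, by simpa using S.component_mem 0 1 (Sym.one_deg _)⟩

theorem taylor_one : S.taylor 1 = hochOf (openGen A) S.openPart :=
  hochEval_injective (openGen A) ((S.hochEval_taylor 1).trans (hochEval_hochOf (openGen A) S.openPart).symm)

/-- The `A_∞`-structure on `A`. -/
def ainf : AInf A where
  m := S.openPart
  flat := by
    change OpenC.proj (closedGen V) (openGen A) (S.Q (1 ⊗ₜ 1)) = 0
    rw [S.Q_one, map_zero]
  mc := by
    -- At 1 the Maurer-Cartan equation says 0 = ½[m, m], because `lie` kills 1 and Δ1 = 1 ⊗ 1.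
    have h := S.taylor_lie 1
    rw [S.lie_one, map_zero, Sym.comul_one, TensorProduct.map_tmul, S.taylor_one,
      hochBracket_hochOf_left] at h
    have h' := (smul_eq_zero.1 h.symm).resolve_left (inv_ne_zero two_ne_zero)
    exact (hochEval_hochDiff_inc (openGen A) S.openPart 0 _).symm.trans
      ((congrArg (hochEval (openGen A)) h').trans (map_zero _))
  lin a := S.Q_lin a

/-- The components of the codifferential of positive arity in `V`. -/
def morTaylor : Sym (closedGen V) →ₗ[K] Tot (hoch (openGen A)) :=
  S.taylor - scalarPart (openGen A) (closedGen V) S.openPart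

theorem morTaylor_add : S.morTaylor + scalarPart (openGen A) (closedGen V) S.ainf.m = S.taylor :=
  sub_add_cancel _ _

theorem morTaylor_of_counit {x : Sym (closedGen V)} (hx : Sym.counit (closedGen V) x = 0) :
    S.morTaylor x = S.taylor x := by
  rw [morTaylor, LinearMap.sub_apply, scalarPart_apply, hx, zero_smul, sub_zero]

theorem morTaylor_one : S.morTaylor 1 = 0 := by
  rw [morTaylor, LinearMap.sub_apply, scalarPart_apply, S.taylor_one, map_one, one_smul, sub_self]

theorem morTaylor_deg (d : ℤ) (x : Sym (closedGen V)) (hx : x ∈ Sym.deg (closedGen V) d) :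
    S.morTaylor x ∈ LinearMap.range (inc (hoch (openGen A)) d) :=
  sub_mem (S.taylor_deg d x hx) (scalarPart_deg _ _ d x hx)

/-- The `L_∞`-morphism to the Hochschild complex. -/
def mor : LInfMor (closedGen V) (hoch (openGen A)) S.lie S.ainf.hochLie where
  U := Sym.expMap S.morTaylor S.morTaylor_one
  U_one := Sym.expMap_one _
  U_counit := Sym.counit_expMap _
  U_comul := Sym.comul_expMap _ S.morTaylor_deg
  U_deg := Sym.expMap_deg _ S.morTaylor_deg
  U_comm x := by
    -- Only Taylor components have to be compared, and there the claim is the Maurer-Cartan equation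
    -- twisted by m.
    refine Sym.comm_of_proj (fun x => ?_) S.ainf.counit_hochLie
      (Sym.comul_expMap _ S.morTaylor_deg) (fun x => ?_) S.comul_lie S.ainf.comul_hochLie
      (fun x => ?_) x
    · rw [Sym.counit_expMap, S.counit_lie]
    · rw [Sym.comm_par_of_deg (closedGen V) (s := 0) (g := Sym.expMap S.morTaylor S.morTaylor_one)
        (by simpa using Sym.expMap_deg S.morTaylor_one S.morTaylor_deg), sgn_zero, one_smul]
    · rw [Sym.proj_expMap, S.morTaylor_of_counit (S.counit_lie x), S.taylor_lie, ← S.morTaylor_add,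
        hochBracket_of_comul (openGen A) S.ainf.mc (Sym.comul_expMap _ S.morTaylor_deg)
          (Sym.proj_expMap S.morTaylor_one), S.ainf.proj_hochLie]

/-- The triple of a `Ger^+_∞`-structure. -/
def toTriple : Triple V A := ⟨S.toGerInf, S.ainf, S.mor⟩

/-- The triple remembers ψ; together with `Q_eq_codiff` this yields injectivity. -/
theorem taylor_eq_toTriple : S.taylor = Sym.proj _ ∘ₗ S.toTriple.mor.U +
    scalarPart (openGen A) (closedGen V) S.toTriple.ainf.m := by
  rw [← S.morTaylor_add]
  exact congrArg (· + _) (LinearMap.ext fun x => (Sym.proj_expMap S.morTaylor_one x).symm)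

theorem ext_of_Q {S S' : GerPlusInf V A} (h : S.toGerInf = S'.toGerInf) (hQ : S.Q = S'.Q) :
    S = S' := by
  cases S; cases S'; cases h; cases hQ; rfl

theorem toTriple_injective : Function.Injective (toTriple (V := V) (A := A)) := by
  intro S S' h
  have hG : S.toGerInf = S'.toGerInf := congrArg Triple.ger h
  refine ext_of_Q hG ?_
  rw [S.Q_eq_codiff, S'.Q_eq_codiff, S.taylor_eq_toTriple, S'.taylor_eq_toTriple, h, hG]

end GerPlusInf

/-! ### From a triple to a Ger^+_∞-structure, and the bijection. -/

namespace Triple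
variable (T : Triple V A)

/-- The components of the codifferential of a triple. -/
def taylor : Sym (closedGen V) →ₗ[K] Tot (hoch (openGen A)) :=
  Sym.proj _ ∘ₗ T.mor.U + scalarPart (openGen A) (closedGen V) T.ainf.m

theorem taylor_one : T.taylor 1 = hochOf (openGen A) T.ainf.m := by
  rw [taylor, LinearMap.add_apply, LinearMap.comp_apply, T.mor.U_one, Sym.proj_one, zero_add,
    scalarPart_apply, map_one, one_smul]

theorem taylor_of_counit {x : Sym (closedGen V)} (hx : Sym.counit (closedGen V) x = 0) :
    T.taylor x = Sym.proj _ (T.mor.U x) := by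
  rw [taylor, LinearMap.add_apply, scalarPart_apply, hx, zero_smul, add_zero]
  rfl

theorem taylor_deg (d : ℤ) (x : Sym (closedGen V)) (hx : x ∈ Sym.deg (closedGen V) d) :
    T.taylor x ∈ LinearMap.range (inc (hoch (openGen A)) d) :=
  add_mem (Sym.proj_deg _ (T.mor.U_deg d x hx)) (scalarPart_deg _ _ d x hx)

/-- The Maurer-Cartan equation is the Taylor component of `U_comm`, untwisted by m. -/
theorem taylor_lie (x : Sym (closedGen V)) : T.taylor (T.ger.lie x) =
    (2 : K)⁻¹ • hochBracket (openGen A) (TensorProduct.map T.taylor T.taylor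
      (Sym.comul (closedGen V) x)) := by
  rw [T.taylor_of_counit (T.ger.counit_lie x), T.mor.U_comm, T.ainf.proj_hochLie]
  exact (hochBracket_of_comul (openGen A) T.ainf.mc T.mor.U_comul (fun _ => rfl) x).symm

/-- The codifferential of a triple. -/
def Q : OpenC (closedGen V) (openGen A) →ₗ[K] OpenC (closedGen V) (openGen A) :=
  OpenC.codiff T.ger.lie T.taylor

theorem proj_Q (x : Sym (closedGen V)) (t : Ten (openGen A)) :
    OpenC.proj _ _ (T.Q (x ⊗ₜ t)) = hochEval (openGen A) (T.taylor x) t :=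
  OpenC.proj_codiff T.ger.counit_lie _ x t

theorem Q_deg (d : ℤ) (x : OpenC (closedGen V) (openGen A))
    (hx : x ∈ OpenC.deg (closedGen V) (openGen A) d) :
    T.Q x ∈ OpenC.deg (closedGen V) (openGen A) (d + 1) :=
  OpenC.codiff_deg T.ger.lie_deg T.taylor_deg d x hx

theorem prS_Q (z : OpenC (closedGen V) (openGen A)) :
    OpenC.prS _ _ (T.Q z) = - T.ger.lie (OpenC.prS _ _ z) := OpenC.prS_codiff _ _ z

theorem comul_Q (z : OpenC (closedGen V) (openGen A)) :
    OpenC.comul _ _ (T.Q z) = TensorProduct.map T.Q LinearMap.id (OpenC.comul _ _ z) +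
      TensorProduct.map (OpenC.par _ _) T.Q (OpenC.comul _ _ z) :=
  OpenC.comul_codiff T.ger.comul_lie T.ger.par_lie (parity_of_deg_zero T.taylor_deg) z

/-- Of the two projections of the square, the one to S(X) vanishes by `GerInf.lie_lie` and the one
to Y by the Maurer-Cartan equation. -/
theorem Q_Q : T.Q ∘ₗ T.Q = 0 := by
  refine OpenC.sq_eq_zero T.Q_deg T.comul_Q (fun z => ?_) fun z => ?_
  · rw [T.prS_Q, T.prS_Q, map_neg, T.ger.lie_lie, neg_zero, neg_zero]
  · refine LinearMap.congr_fun (f := OpenC.proj _ _ ∘ₗ T.Q ∘ₗ T.Q) (g := 0)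
      (TensorProduct.ext' fun x t => ?_) z
    refine (OpenC.proj_codiff_codiff T.ger.counit_lie (parity_of_deg_zero T.taylor_deg) x t).trans ?_
    rw [T.taylor_lie, sub_self, map_zero]
    rfl

theorem Q_one : T.Q (1 ⊗ₜ 1) = 0 := by
  have h : OpenC.insert T.taylor ((1 ⊗ₜ 1) ⊗ₜ 1) = 0 := by
    rw [OpenC.insert_tmul, T.taylor_one]
    -- The only insertion into the empty word is m(1), which is zero as m has no component in Hom(K,
    -- A).
    have : hochIns (openGen A) (hochOf (openGen A) T.ainf.m) 1 = 0 := by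
      rw [hochOf, hochIns_inc]
      refine (Ten.ins_one _ _ _).trans ?_
      rw [T.ainf.flat, map_zero]
    rw [this, TensorProduct.tmul_zero]
  rw [Q, OpenC.codiff, LinearMap.sub_apply, OpenC.theta_tmul, Sym.comul_one, h,
    TensorProduct.map_tmul, T.ger.lie_one, TensorProduct.zero_tmul, sub_zero]

/-- The `Ger^+_∞`-structure of a triple. -/
def toGerPlusInf : GerPlusInf V A where
  toGerInf := T.ger
  Q := T.Q
  Q_one := T.Q_one
  Q_counit z := by
    rw [OpenC.counit_eq_prS, T.prS_Q, map_neg, T.ger.counit_lie, neg_zero]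
  Q_deg := T.Q_deg
  Q_comul := T.comul_Q
  Q_rho z := by
    rw [OpenC.rho_eq, OpenC.rho_eq, T.prS_Q, T.ger.D_toGer, map_neg, neg_neg]
  Q_sq := LinearMap.congr_fun T.Q_Q
  Q_lin a := by
    rw [T.proj_Q, T.taylor_one, hochEval_hochOf, T.ainf.lin]

theorem taylor_toGerPlusInf : T.toGerPlusInf.taylor = T.taylor :=
  LinearMap.ext fun x => hochEval_injective (openGen A)
    ((T.toGerPlusInf.hochEval_taylor x).trans (LinearMap.ext (T.proj_Q x)))

theorem ext_of_U {T T' : Triple V A} (hG : T.ger = T'.ger) (hm : T.ainf.m = T'.ainf.m)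
    (hU : T.mor.U = T'.mor.U) : T = T' := by
  obtain ⟨G, ⟨m, _, _, _⟩, ⟨U, _, _, _, _, _⟩⟩ := T
  obtain ⟨G', ⟨m', _, _, _⟩, ⟨U', _, _, _, _, _⟩⟩ := T'
  cases hG
  cases hm
  cases hU
  rfl

/-- The two morphisms have the same Taylor components, which determine a morphism of coalgebras to a
symmetric coalgebra. -/
theorem toTriple_toGerPlusInf : T.toGerPlusInf.toTriple = T := by
  have hm : T.toGerPlusInf.openPart = T.ainf.m := by
    refine Subtype.ext ?_
    rw [← hochEval_hochOf, ← hochEval_hochOf, ← GerPlusInf.taylor_one, taylor_toGerPlusInf,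
      taylor_one]
  refine ext_of_U rfl hm ?_
  refine Sym.coalgHom_ext (fun x => ?_) T.toGerPlusInf.mor.U_comul T.mor.U_comul fun x => ?_
  · exact (T.toGerPlusInf.mor.U_counit x).trans (T.mor.U_counit x).symm
  · refine (Sym.proj_expMap T.toGerPlusInf.morTaylor_one x).trans ?_
    rw [GerPlusInf.morTaylor, taylor_toGerPlusInf, hm, taylor, add_sub_cancel_right]
    rfl

end Triple

/-- `Ger^+_∞`-structures on `(V, A)` as triples. -/
def GerPlusInf.equivTriple : GerPlusInf V A ≃ Triple V A :=
  Equiv.ofBijective GerPlusInf.toTriple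
    ⟨GerPlusInf.toTriple_injective, fun T => ⟨T.toGerPlusInf, T.toTriple_toGerPlusInf⟩⟩

end Structures

end GerPlus
end

theorem theorem4p1 {K : Type u} [Field K] [CharZero K]
    (V : CochainComplex (ModuleCat.{v} K) ℤ) (A : CochainComplex (ModuleCat.{w} K) ℤ) :
    (∀ (G : GerPlus.GerInf V) (x : GerPlus.Sym (GerPlus.closedGen V)),
      G.D (GerPlus.Sym.toGer (GerPlus.closedGen V) x) =
        GerPlus.Sym.toGer (GerPlus.closedGen V) (G.lie x)) ∧
    ∃ e : GerPlus.GerPlusInf V A ≃ GerPlus.Triple V A, ∀ S : GerPlus.GerPlusInf V A,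
      (e S).ger = S.toGerInf ∧
      (∀ t : GerPlus.Ten (GerPlus.openGen A),
        (e S).ainf.m.1 t =
          GerPlus.OpenC.proj (GerPlus.closedGen V) (GerPlus.openGen A) (S.Q (1 ⊗ₜ t))) ∧
      (∀ x : GerPlus.Sym (GerPlus.closedGen V), GerPlus.Sym.counit (GerPlus.closedGen V) x = 0 →
        ∀ t : GerPlus.Ten (GerPlus.openGen A),
          GerPlus.hochEval (GerPlus.openGen A)
            (GerPlus.Sym.proj (GerPlus.hoch (GerPlus.openGen A)) ((e S).mor.U x)) t =
          GerPlus.OpenC.proj (GerPlus.closedGen V) (GerPlus.openGen A) (S.Q (x ⊗ₜ t))) := by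
  refine ⟨fun G x => G.D_toGer x, GerPlus.GerPlusInf.equivTriple, fun S =>
    ⟨rfl, fun t => rfl, fun x hx t => ?_⟩⟩
  -- The Taylor components of U are those of φ = ψ - mε, which agrees with ψ on the kernel of ε,
  -- that is, for k ≥ 1.
  refine (congrArg (fun f => GerPlus.hochEval (GerPlus.openGen A) f t)
    (GerPlus.Sym.proj_expMap S.morTaylor_one x)).trans ?_
  rw [S.morTaylor_of_counit hx, S.hochEval_taylor]
  rfl
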